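/- **Setting.** Let $\lambda=(\lambda_{ij})_{0\le i,j\le n-1}$ be a complex matrix with $\lambda_{ij}=-\lambda_{ji}$ which is *normalized*, i.e. $\sum_j\lambda_{ij}=0$ for all $i$. Put $q_{ij}=e^{\lambda_{ij}}$ and $$\mathsf A_q=\mathbb C\langle x_0,\dots,x_{n-1}\rangle/(x_ix_j-q_{ij}x_jx_i).$$ Assume that $\lambda$ is *generic*: it has rank $n-1$, and for every $w\in\mathbb Z^n$ with all $w_i\ge -1$ and $\sum_i w_i=0$, if $\prod_j q_{ij}^{w_j}=1$ for every $i$ with $w_i\ge 0$, then $\sum_j\lambda_{ij}w_j=0$ for every $i$ with $w_i\ge0$. Let $b$ be the biresidue matrix of $\lambda$: the unique normalized alternating matrix that is inverse to $\lambda$ on $\{z\in\mathbb C^n:\sum_i z_i=0\}$. An edge $i - j$ of the complete graph on $\{0,\dots,n-1\}$ is *smoothable* if $b_{ij}\ne0$ and $(b_{jk}+b_{ki})/b_{ij}\in\mathbb Z_{\ge0}$ for all $k\ne i,j$. Its (unique) smoothable weight $\theta\in\mathbb Z^n$ has $\theta_i=\theta_j=-1$ and $\theta_k=(b_{jk}+b_{ki})/b_{ij}$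 for $k\neq i,j$. Let $I$ be a set of smoothable edges containing no cycle. For $m\ge0$ let $\Theta_m$ be the set of sums of $m$ smoothable weights (repetitions allowed) of edges in $I$. Let $V^*=\operatorname{span}(x_0,\dots,x_{n-1})$, and let $\mathcal F_a$, $a\ge0$, be the decreasing filtration of the tensor algebra $T(V^*)$ (and, extending scalars, of $T(V^*)[\varepsilon]$) spanned by the words in the $x_i$ whose multidegree lies in $\Theta_m+\mathbb Z_{\ge0}^n$ for some $m\ge a$. Write $e_i$ for the standard basis vectors of $\mathbb Z^n$. For nonzero constants $\gamma_i\in\mathbb C$ ($i\in I$), consider $N\ge1$ and constants $C_{ba}^{k\ell}\in\mathbb C$, for $a<b$, $k\le\ell$ and $-e_a-e_b+e_k+e_\ell\in\bigcup_{1\le m\le N}\Theta_m$ (all other $C_{ba}^{k\ell}$ are set to $0$), such that $C_{ba}^{k\ell}=\gamma_i$ whenever $a<b$, $k\le \ell$ and $-e_a-e_b+e_k+e_\ell$ is the smoothable weight of $i\in I$. Let $J\subset T(V^*)[\varepsilon]$ be the two-sided ideal generated by $$r_{ab}(\varepsilon)=-x_bx_a+q_{ba}x_ax_b+\sum_{m=1}^N\varepsilon^m\Bigl(\sum_{\substack{k\le\ell\\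 -e_a-e_b+e_k+e_\ell\in\Theta_m}}C_{ba}^{k\ell}x_kx_\ell\Bigr),\qquad a<b.$$ Call $(N,C)$ *admissible for* $\gamma$ if $T(V^*)[\varepsilon]/J$ is a flat filtered deformation of $\mathsf A_q$: it is flat over $\mathbb C[\varepsilon]$, its quotient by $\varepsilon$ is $\mathsf A_q$ (compatibly with the generators $x_i$), and its associated graded algebra for the filtration induced by $\mathcal F_\bullet$ is that of $\mathsf A_q[\varepsilon]$, i.e. $J$ and the ideal of relations of $\mathsf A_q[\varepsilon]$ have the same associated graded ideal with respect to $\mathcal F_\bullet$. **Theorem.** 1. For every choice of nonzero constants $\gamma_i$, $i\in I$, there is an admissible $(N,C)$. 2. Up to a filtered automorphism of $V^*$, the quadratic $\mathbb C$-algebra $\mathsf A_{q,I}$ obtained by specializing $\varepsilon$ to a nonzero complex number is unique and independent of $\gamma$ and $\varepsilon$. That is, if $(N,C)$ is admissible for $\gamma$ and $(N',C')$ is admissible for $\gamma'$, where all $\gamma_i,\gamma'_i$ are nonzero, and if $\varepsilon_0,\varepsilon_0'\in\mathbb C^\times$, then there is a linear automorphism $g$ of $V^*$ whose extension to $T(V^*)$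 maps each $\mathcal F_a$ onto itself and carries the ideal generated by the relations $r_{ab}(\varepsilon_0)$ of $(N,C)$ onto the ideal generated by the relations $r_{ab}(\varepsilon_0')$ of $(N',C')$. 3. If no $\Theta_m$ with $m\ge1$ contains a weight $e_a-e_b$ with $a\ne b$, then the constants $C_{ba}^{k\ell}$ are uniquely determined by $\gamma$: if $(N,C)$ and $(N',C')$ are both admissible for the same $\gamma$, then $C=C'$. -/

import Mathlib

open scoped Polynomial

/-! ### Alternating matrices, contributing weights, genericity -/

/-- Additively alternating complex matrices. -/
def IsAlternating {n : ℕ} (M : Matrix (Fin n) (Fin n) ℂ) : Prop :=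
  ∀ i j, M i j = -M j i

/-- An additively alternating matrix is normalized if its rows sum to zero. -/
def IsNormalized {n : ℕ} (M : Matrix (Fin n) (Fin n) ℂ) : Prop :=
  ∀ i, ∑ j, M i j = 0

/-- The entrywise exponential. -/
noncomputable def entrywiseExp {n : ℕ} (L : Matrix (Fin n) (Fin n) ℂ) :
    Matrix (Fin n) (Fin n) ℂ :=
  fun i j => Complex.exp (L i j)

/-- A torus weight is relevant if its entries are at least `-1` and sum to zero. -/
def IsRelevant {n : ℕ} (w : Fin n → ℤ) : Prop :=
  (∀ i, -1 ≤ w i) ∧ ∑ i, w i = 0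

/-- The `q`-Hochschild-contributing weights. -/
def IsHochschildContributing {n : ℕ} (q : Matrix (Fin n) (Fin n) ℂ) (w : Fin n → ℤ) : Prop :=
  (∀ i, -1 ≤ w i) ∧ ∀ i, 0 ≤ w i → ∏ j, q i j ^ w j = 1

/-- The Poisson-contributing weights of an additively alternating matrix. -/
def IsPoissonContributing {n : ℕ} (L : Matrix (Fin n) (Fin n) ℂ) (w : Fin n → ℤ) : Prop :=
  (∀ i, -1 ≤ w i) ∧ ∀ i, 0 ≤ w i → ∑ j, L i j * (w j : ℂ) = 0

/-- An additively alternating matrix `L` is generic if it has corank one and every relevant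
weight that is Hochschild-contributing for `exp L` is Poisson-contributing for `L`. -/
def IsGeneric {n : ℕ} (L : Matrix (Fin n) (Fin n) ℂ) : Prop :=
  L.rank + 1 = n ∧
    ∀ w : Fin n → ℤ, IsRelevant w → IsHochschildContributing (entrywiseExp L) w →
      IsPoissonContributing L w

/-! ### The biresidue matrix and smoothable edges -/

/-- `b` is the biresidue matrix of `L`: the normalized alternating matrix which is inverse to `L`
on the space of vectors with coordinate sum zero. For normalized alternating `L` of corank one
it exists and is unique, see `existsUnique_isBiresidue`. -/
structure IsBiresidue {n : ℕ} (L b : Matrix (Fin n) (Fin n) ℂ) : Prop where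
  alternating : IsAlternating b
  normalized : IsNormalized b
  left_inv : ∀ z : Fin n → ℂ, ∑ i, z i = 0 → b.mulVec (L.mulVec z) = z
  right_inv : ∀ z : Fin n → ℂ, ∑ i, z i = 0 → L.mulVec (b.mulVec z) = z

theorem existsUnique_isBiresidue {n : ℕ} (L : Matrix (Fin n) (Fin n) ℂ)
    (halt : IsAlternating L) (hnorm : IsNormalized L) (hrank : L.rank + 1 = n) :
    ∃! b, IsBiresidue L b := by
  have hn : (n : ℂ) ≠ 0 := by
    have : n ≠ 0 := by omega
    exact_mod_cast this
  obtain ⟨P, hP⟩ : ∃ P : Matrix (Fin n) (Fin n) ℂ, ∀ i j, P i j = (n : ℂ)⁻¹ :=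
    ⟨Matrix.of fun _ _ => (n : ℂ)⁻¹, fun _ _ => rfl⟩
  have hT : L.transpose = -L := by
    ext i j
    simp [Matrix.transpose_apply, halt j i]
  have hcol : ∀ j, ∑ i, L i j = 0 := by
    intro j
    have h : ∑ i, L i j = -∑ i, L j i := by
      rw [← Finset.sum_neg_distrib]
      exact Finset.sum_congr rfl fun i _ => halt i j
    rw [h, hnorm j, neg_zero]
  have hPT : P.transpose = P := by
    ext i j
    simp [Matrix.transpose_apply, hP]
  have hPv : ∀ z : Fin n → ℂ, ∑ i, z i = 0 → P.mulVec z = 0 := by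
    intro z hz
    ext i
    simp [Matrix.mulVec, dotProduct, hP, ← Finset.mul_sum, hz]
  have hLP : L * P = 0 := by
    ext i j
    simp [Matrix.mul_apply, hP, ← Finset.sum_mul, hnorm i]
  have hPL : P * L = 0 := by
    ext i j
    simp [Matrix.mul_apply, hP, ← Finset.mul_sum, hcol j]
  have hPP : P * P = P := by
    ext i j
    simp [Matrix.mul_apply, hP, hn]
  -- the kernel of `L` consists of the constant vectors
  have hker : ∀ z : Fin n → ℂ, L.mulVec z = 0 → ∑ i, z i = 0 → z = 0 := by
    intro z hz hs
    have hone : L.mulVec (fun _ => (1 : ℂ)) = 0 := by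
      ext i
      simp [Matrix.mulVec, dotProduct, hnorm i]
    have hfr : Module.finrank ℂ (LinearMap.ker L.mulVecLin) = 1 := by
      have h := LinearMap.finrank_range_add_finrank_ker L.mulVecLin
      rw [Module.finrank_fin_fun] at h
      have h2 : Module.finrank ℂ (LinearMap.range L.mulVecLin) = L.rank := rfl
      omega
    have hne : (⟨fun _ => (1 : ℂ), by simpa using hone⟩ : LinearMap.ker L.mulVecLin) ≠ 0 := by
      intro h
      have h1 := congrArg Subtype.val h
      have : 0 < n := by omega
      have h2 := congrFun h1 ⟨0, this⟩
      simp at h2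
    obtain ⟨c, hc⟩ := (finrank_eq_one_iff_of_nonzero' _ hne).1 hfr ⟨z, by simpa using hz⟩
    have hc' : ∀ i, c = z i := by
      intro i
      have := congrFun (congrArg Subtype.val hc) i
      simpa using this
    have hs' : (n : ℂ) * c = 0 := by
      rw [← hs, ← Finset.sum_congr rfl fun i _ => hc' i]
      simp
    have hc0 : c = 0 := by simpa [hn] using hs'
    ext i
    simp [← hc' i, hc0]
  have hunit : IsUnit (L + P) := by
    rw [← Matrix.mulVec_injective_iff_isUnit]
    intro u v huv
    have h0 : (L + P).mulVec (u - v) = 0 := by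
      rw [Matrix.mulVec_sub]
      exact sub_eq_zero.2 huv
    have h1 : P.mulVec (u - v) = 0 := by
      have := congrArg P.mulVec h0
      rwa [Matrix.mulVec_mulVec, mul_add, hPL, hPP, zero_add, Matrix.mulVec_zero] at this
    have h2 : L.mulVec (u - v) = 0 := by
      rwa [Matrix.add_mulVec, h1, add_zero] at h0
    have h3 : ∑ i, (u - v) i = 0 := by
      have hpos : 0 < n := by omega
      have := congrFun h1 ⟨0, hpos⟩
      simpa [Matrix.mulVec, dotProduct, hP, ← Finset.mul_sum, hn] using this
    exact sub_eq_zero.1 (hker _ h2 h3)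
  have hdet : IsUnit (L + P).det := (Matrix.isUnit_iff_isUnit_det _).1 hunit
  set B := (L + P)⁻¹ with hB
  have hBM : B * (L + P) = 1 := Matrix.nonsing_inv_mul _ hdet
  have hMB : (L + P) * B = 1 := Matrix.mul_nonsing_inv _ hdet
  have hBP : B * P = P := by
    calc B * P = B * ((L + P) * P) := by rw [add_mul, hLP, hPP, zero_add]
      _ = P := by rw [← mul_assoc, hBM, one_mul]
  have hPB : P * B = P := by
    calc P * B = (P * (L + P)) * B := by rw [mul_add, hPL, hPP, zero_add]
      _ = P := by rw [mul_assoc, hMB, mul_one]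
  have hbL : (B - P) * L = 1 - P := by
    rw [sub_mul, hPL, sub_zero, ← hBM, mul_add, hBP, add_sub_cancel_right]
  have hLb : L * (B - P) = 1 - P := by
    rw [mul_sub, hLP, sub_zero, ← hMB, add_mul, hPB, add_sub_cancel_right]
  have hbP : (B - P) * P = 0 := by rw [sub_mul, hBP, hPP, sub_self]
  have hPb : P * (B - P) = 0 := by rw [mul_sub, hPB, hPP, sub_self]
  have hbT : (B - P).transpose = -(B - P) := by
    have h1 : (B - P).transpose * L = -(1 - P) := by
      have := congrArg Matrix.transpose hLb
      rw [Matrix.transpose_mul, hT, mul_neg, Matrix.transpose_sub 1 P, Matrix.transpose_one,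
        hPT] at this
      rw [← this, neg_neg]
    have h2 : (B - P).transpose * P = 0 := by
      have := congrArg Matrix.transpose hPb
      rwa [Matrix.transpose_mul, hPT, Matrix.transpose_zero] at this
    calc (B - P).transpose = (B - P).transpose * (L * (B - P) + P) := by
          rw [hLb, sub_add_cancel, mul_one]
      _ = -(B - P) := by
          rw [mul_add, h2, add_zero, ← mul_assoc, h1, neg_mul, sub_mul, hPb, one_mul, sub_zero]
  refine ⟨B - P, ⟨?_, ?_, ?_, ?_⟩, ?_⟩
  · intro i j
    have := congrFun (congrFun hbT j) i
    simpa [Matrix.transpose_apply] using this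
  · intro i
    have := congrFun (congrFun hbP i) i
    rw [Matrix.mul_apply] at this
    simp only [hP, ← Finset.sum_mul, Matrix.zero_apply] at this
    exact (mul_eq_zero.1 this).resolve_right (inv_ne_zero hn)
  · intro z hz
    rw [Matrix.mulVec_mulVec, hbL, Matrix.sub_mulVec, Matrix.one_mulVec, hPv z hz, sub_zero]
  · intro z hz
    rw [Matrix.mulVec_mulVec, hLb, Matrix.sub_mulVec, Matrix.one_mulVec, hPv z hz, sub_zero]
  · intro c hc
    have hcP : c * P = 0 := by
      ext i j
      simp [Matrix.mul_apply, hP, ← Finset.sum_mul, hc.normalized i]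
    have hcL : c * L = 1 - P := by
      apply Matrix.ext_of_mulVec_single
      intro i
      have hs : ∑ k, ((1 - P).mulVec (Pi.single i 1)) k = 0 := by
        simp [Matrix.one_apply, hP, hn]
      have h := hc.left_inv _ hs
      rw [Matrix.mulVec_mulVec, Matrix.mulVec_mulVec, mul_sub, mul_one, mul_assoc, hLP, mul_zero,
        sub_zero] at h
      rw [h]
    calc c = c * (L * (B - P) + P) := by rw [hLb, sub_add_cancel, mul_one]
      _ = B - P := by
        rw [mul_add, hcP, add_zero, ← mul_assoc, hcL, sub_mul, hPb, one_mul, sub_zero]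

/-- `θ` is the smoothable weight of the edge `i — j`. -/
def IsSmoothableWeight {n : ℕ} (b : Matrix (Fin n) (Fin n) ℂ) (i j : Fin n)
    (θ : Fin n → ℤ) : Prop :=
  θ i = -1 ∧ θ j = -1 ∧ b i j ≠ 0 ∧
    ∀ k, k ≠ i → k ≠ j → 0 ≤ θ k ∧ (b j k + b k i) / b i j = (θ k : ℂ)

/-- The edge `i — j` is smoothable. -/
def IsSmoothableEdge {n : ℕ} (b : Matrix (Fin n) (Fin n) ℂ) (i j : Fin n) : Prop :=
  ∃ θ : Fin n → ℤ, IsSmoothableWeight b i j θ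

/-- `Θ_m`: all sums of `m` smoothable weights (repetitions allowed) of chosen edges, where the
chosen edges are the edges of the graph `G`. -/
def weightSums {n : ℕ} (b : Matrix (Fin n) (Fin n) ℂ) (G : SimpleGraph (Fin n)) (m : ℕ) :
    Set (Fin n → ℤ) :=
  {w | ∃ s : Fin m → Fin n → ℤ,
    (∀ t, ∃ i j, G.Adj i j ∧ IsSmoothableWeight b i j (s t)) ∧ w = ∑ t, s t}

/-- The weight `-e_a - e_b + e_k + e_l`. -/
def quadWeight {n : ℕ} (a b k l : Fin n) : Fin n → ℤ :=
  -Pi.single a 1 - Pi.single b 1 + Pi.single k 1 + Pi.single l 1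

/-! ### The filtration of the tensor algebra -/

/-- The noncommutative monomial `x_{i_1} ⋯ x_{i_p}`. -/
def wordMonomial (R : Type*) [CommRing R] {n : ℕ} (l : List (Fin n)) : FreeAlgebra R (Fin n) :=
  (l.map (FreeAlgebra.ι R)).prod

/-- The decreasing filtration `F_a` of the tensor algebra: it is spanned by the monomials whose
weight lies in `Θ_m + (ℤ_{≥0})^n` for some `m ≥ a`. -/
def smoothFiltration (R : Type*) [CommRing R] {n : ℕ} (b : Matrix (Fin n) (Fin n) ℂ)
    (G : SimpleGraph (Fin n)) (a : ℕ) : Submodule R (FreeAlgebra R (Fin n)) :=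
  Submodule.span R
    {f | ∃ l : List (Fin n), f = wordMonomial R l ∧
      ∃ m, a ≤ m ∧ ∃ w ∈ weightSums b G m, ∀ i, w i ≤ (l.count i : ℤ)}

/-! ### The algebras -/

/-- The ideal of relations of the `q`-symmetric algebra, `x_i x_j = q_ij x_j x_i`, over a
`ℂ`-algebra `R` of scalars. The algebra `A_q` itself is the case `R = ℂ`. -/
noncomputable def toricIdeal (R : Type*) [CommRing R] [Algebra ℂ R] {n : ℕ}
    (q : Matrix (Fin n) (Fin n) ℂ) : TwoSidedIdeal (FreeAlgebra R (Fin n)) :=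
  TwoSidedIdeal.span
    {f | ∃ i j, f = FreeAlgebra.ι R i * FreeAlgebra.ι R j
      - algebraMap ℂ R (q i j) • (FreeAlgebra.ι R j * FreeAlgebra.ι R i)}

open Classical in
/-- The deformed relation
`-x_b x_a + q_ba x_a x_b + ∑_{m=1}^N e^m ∑_{k ≤ l} C_{ba}^{kl} x_k x_l`, the inner sum being over
those `k ≤ l` for which `-e_a - e_b + e_k + e_l ∈ Θ_m`. Here `e` is an element of the ring `R` of
scalars: the variable of `ℂ[ε]` for the deformation, a complex number for its specialization. -/
noncomputable def deformedRelation (R : Type*) [CommRing R] [Algebra ℂ R] {n : ℕ}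
    (q b : Matrix (Fin n) (Fin n) ℂ) (G : SimpleGraph (Fin n)) (N : ℕ)
    (C : Fin n → Fin n → Fin n → Fin n → ℂ) (e : R) (x y : Fin n) : FreeAlgebra R (Fin n) :=
  -(FreeAlgebra.ι R y * FreeAlgebra.ι R x)
    + algebraMap ℂ R (q y x) • (FreeAlgebra.ι R x * FreeAlgebra.ι R y)
    + ∑ m ∈ Finset.Icc 1 N, e ^ m • ∑ k, ∑ l,
        if k ≤ l ∧ quadWeight x y k l ∈ weightSums b G m then
          algebraMap ℂ R (C y x k l) • (FreeAlgebra.ι R k * FreeAlgebra.ι R l)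
        else 0

/-- The two-sided ideal generated by the deformed relations for `x < y`. -/
noncomputable def deformedIdeal (R : Type*) [CommRing R] [Algebra ℂ R] {n : ℕ}
    (q b : Matrix (Fin n) (Fin n) ℂ) (G : SimpleGraph (Fin n)) (N : ℕ)
    (C : Fin n → Fin n → Fin n → Fin n → ℂ) (e : R) : TwoSidedIdeal (FreeAlgebra R (Fin n)) :=
  TwoSidedIdeal.span {f | ∃ x y, x < y ∧ f = deformedRelation R q b G N C e x y}

/-- The `ℂ[ε]`-algebra `T(V*)[ε]/J` is a flat deformation of `T(V*)/J₀`: it is flat over `ℂ[ε]`,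
and its quotient by `ε` is identified with `T(V*)/J₀` as `ℂ`-algebras, compatibly with the
generators. -/
structure IsFlatDeformation {n : ℕ} (J : TwoSidedIdeal (FreeAlgebra ℂ[X] (Fin n)))
    (J₀ : TwoSidedIdeal (FreeAlgebra ℂ (Fin n))) : Prop where
  flat : Module.Flat ℂ[X] J.ringCon.Quotient
  special_fibre : ∃ φ : J.ringCon.Quotient →+* J₀.ringCon.Quotient,
    (∀ p : ℂ[X], φ (algebraMap ℂ[X] J.ringCon.Quotient p)
      = algebraMap ℂ J₀.ringCon.Quotient (p.eval 0)) ∧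
    (∀ i, φ (J.ringCon.mk' (FreeAlgebra.ι ℂ[X] i)) = J₀.ringCon.mk' (FreeAlgebra.ι ℂ i)) ∧
    Function.Surjective φ ∧
    ∀ u, φ u = 0 ↔ ∃ v, u = (Polynomial.X : ℂ[X]) • v

/-- `J` and `J'` have the same associated graded ideal with respect to the filtration
`smoothFiltration`, so the quotients by `J` and `J'`, with the induced filtrations, have the same
associated graded algebra. -/
def SameAssociatedGraded {R : Type*} [CommRing R] {n : ℕ} (b : Matrix (Fin n) (Fin n) ℂ)
    (G : SimpleGraph (Fin n)) (J J' : TwoSidedIdeal (FreeAlgebra R (Fin n))) : Prop :=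
  ∀ (a : ℕ) (f : FreeAlgebra R (Fin n)), f ∈ smoothFiltration R b G a →
    ((∃ g ∈ J, f - g ∈ smoothFiltration R b G (a + 1)) ↔
      ∃ g ∈ J', f - g ∈ smoothFiltration R b G (a + 1))

/-- The coefficients `C` (with top order `N`) define a flat filtered deformation of `A_q` over
`ℂ[ε]` of the prescribed form, whose coefficient at the smoothable weight of each chosen edge is
the prescribed constant `γ`. Coefficients that do not enter the relations are set to zero. -/
structure IsFlatFilteredDeformation {n : ℕ} (q b : Matrix (Fin n) (Fin n) ℂ)
    (G : SimpleGraph (Fin n)) (γ : Sym2 (Fin n) → ℂ) (N : ℕ)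
    (C : Fin n → Fin n → Fin n → Fin n → ℂ) : Prop where
  one_le : 1 ≤ N
  support : ∀ x y k l, C y x k l ≠ 0 →
    x < y ∧ k ≤ l ∧ ∃ m, 1 ≤ m ∧ m ≤ N ∧ quadWeight x y k l ∈ weightSums b G m
  leading : ∀ i j, G.Adj i j → ∀ x y k l, x < y → k ≤ l →
    IsSmoothableWeight b i j (quadWeight x y k l) → C y x k l = γ s(i, j)
  flat : IsFlatDeformation (deformedIdeal ℂ[X] q b G N C Polynomial.X) (toricIdeal ℂ q)
  filtered : SameAssociatedGraded b G (deformedIdeal ℂ[X] q b G N C Polynomial.X)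
    (toricIdeal ℂ[X] q)

/-- The endomorphism of the tensor algebra induced by the linear map
`x_i ↦ ∑ j, g j i x_j` of `V*`. -/
noncomputable def linearSubst {n : ℕ} (g : Matrix (Fin n) (Fin n) ℂ) :
    FreeAlgebra ℂ (Fin n) →ₐ[ℂ] FreeAlgebra ℂ (Fin n) :=
  FreeAlgebra.lift ℂ fun i => ∑ j, g j i • FreeAlgebra.ι ℂ j

/-- A filtered automorphism of `V*`: an invertible linear map whose induced automorphism of the
tensor algebra preserves every step of the filtration. -/
def IsFilteredAutomorphism {n : ℕ} (b : Matrix (Fin n) (Fin n) ℂ) (G : SimpleGraph (Fin n))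
    (g : Matrix (Fin n) (Fin n) ℂ) : Prop :=
  IsUnit g ∧ ∀ a : ℕ,
    (smoothFiltration ℂ b G a).map (linearSubst g).toLinearMap = smoothFiltration ℂ b G a

/-! The sorted monomials form a basis of `A_q`, so a deformation of the required kind amounts to an
associative product on their span whose correction terms shift the multidegree by weights in the
`Θ_m`, m ≥ 1. Such products are built and compared level by level. At a weight w the obstruction is
a three-cocycle and the ambiguity a two-cocycle of the monoid ℕⁿ, with coefficients in the character
by which a monomial of weight w commutes with the others, and with support where adding w leaves the
exponents nonnegative. The theorem holds because both classes vanish for every weight of level at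
least two, while at level one the class is detected by the constants γ.

The vanishing is combinatorial. The matrix L sends the smoothable weight of i — j to a multiple of
e_i − e_j, so a sum of smoothable weights becomes a flow on the forest. Two smoothable edges at a
vertex have biresidues of negative rational ratio, hence no vertex has three, and the forest is a
union of paths. If the character of w is trivial where it matters, genericity confines the
divergence of the flow to the entries −1 of w. If three basis vectors could make w nonnegative, the
divergence would have at most three support points, the flow would split at a vertex r into two
flows between two points each, and the skew-symmetry of b would force w_r ≤ −2. See
`exists_flow_splitting`, `not_nonneg_of_isPoissonContributing` and `isRigid_of_mem_weightSums`. When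
the character is nontrivial a homotopy kills all cohomology. The forest also carries an additive
height equal to m on `Θ_m`; with preservation of degree it bounds the levels above each monomial, so
every recursion over levels stops.

Existence: `exists_isStar` corrects the skew product to an associative one with prescribed level one
part. Its Rees deformation is a module on which the deformed relations act by zero, and this makes
the sorted words independent modulo the relations (`sortedIndependent_of_isStar`). Straightening
shows that they span, so the quotient is free over ℂ[ε], and flatness, the special fibre and the
associated graded ideal follow.

Uniqueness: conversely flatness gives independence of the sorted words, at every value of ε, so
normal forms define an associative product. Products with equal level one commutators are
intertwined, in the degrees needed, by a unitriangular map (`exists_unitriangular`), whose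
restriction to the variables is the desired substitution (`exists_linearSubst`). The constants γ and
ε are first matched by rescaling the variables, which the absence of cycles permits. If no weight
e_a − e_b occurs, the substitution is the identity and the coefficients agree. -/

set_option maxSynthPendingDepth 3

/-! ### Forests -/

/-- A finite acyclic graph with an edge has a leaf. -/
theorem SimpleGraph.IsAcyclic.exists_leaf {V : Type*} [Finite V] {G : SimpleGraph V}
    (hG : G.IsAcyclic) {v w : V} (hvw : G.Adj v w) :
    ∃ x y, G.Adj x y ∧ ∀ z, G.Adj x z → z = y := by
  have : Nonempty V := ⟨v⟩
  -- The start of a longest path is a leaf: a neighbour on the path must be its second vertex, since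
  -- there is no cycle, and a neighbour off the path would lengthen it.
  obtain ⟨x, z, p, hp, hmax⟩ := SimpleGraph.Walk.exists_isPath_forall_isPath_length_le_length G
  have hlen : 1 ≤ p.length := by
    have := hmax v w (SimpleGraph.Walk.cons hvw SimpleGraph.Walk.nil) (by simp [hvw.ne])
    simpa using this
  have hnil : ¬ p.Nil := by
    rw [← SimpleGraph.Walk.length_eq_zero_iff]
    omega
  refine ⟨x, p.snd, p.adj_snd hnil, fun y hy => ?_⟩
  by_cases hmem : y ∈ p.support
  · exact hG.eq_snd_of_adj_start hp hy hmem
  · have := hmax y z (SimpleGraph.Walk.cons hy.symm p) (by simp [hp, hmem])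
    simp at this

/-- On a forest every antisymmetric function on the edges is a coboundary. -/
theorem SimpleGraph.IsAcyclic.exists_potential {V : Type*} [Finite V] {G : SimpleGraph V}
    (hG : G.IsAcyclic) (a : V → V → ℂ) (ha : ∀ i j, a i j = -a j i) :
    ∃ f : V → ℂ, ∀ i j, G.Adj i j → f i - f j = a i j := by
  classical
  induction hk : G.edgeSet.ncard using Nat.strong_induction_on generalizing G with
  | _ k ih =>
  by_cases hE : ∃ v w, G.Adj v w
  · obtain ⟨v, w, hvw⟩ := hE
    obtain ⟨x, y, hxy, hleaf⟩ := hG.exists_leaf hvw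
    let G' := G.deleteEdges {s(x, y)}
    have hle : G' ≤ G := G.deleteEdges_le _
    have hlt : G'.edgeSet.ncard < k := by
      rw [← hk]
      apply Set.ncard_lt_ncard _ (Set.toFinite _)
      rw [SimpleGraph.edgeSet_ssubset_edgeSet]
      refine lt_of_le_of_ne hle fun h => ?_
      have : G'.Adj x y := by rw [h]; exact hxy
      simp [G'] at this
    obtain ⟨f, hf⟩ := ih _ hlt (hG.anti hle) rfl
    have hadj : ∀ i j, G.Adj i j → i ≠ x → j ≠ x → G'.Adj i j := by
      intro i j hij hi hj
      simp only [G', SimpleGraph.deleteEdges_adj, Set.mem_singleton_iff, Sym2.eq_iff]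
      refine ⟨hij, ?_⟩
      rintro (⟨h, -⟩ | ⟨-, h⟩)
      · exact hi h
      · exact hj h
    -- The leaf x has only the edge to y, so its value can be adjusted to that equation without
    -- disturbing the others.
    refine ⟨Function.update f x (f y + a x y), fun i j hij => ?_⟩
    by_cases hi : i = x
    · subst hi
      have := hleaf j hij
      subst this
      rw [Function.update_self, Function.update_of_ne hij.ne']
      ring
    · by_cases hj : j = x
      · subst hj
        have := hleaf i hij.symm
        subst this
        rw [Function.update_self, Function.update_of_ne hi, ha i j]
        ring
      · rw [Function.update_of_ne hi, Function.update_of_ne hj]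
        exact hf i j (hadj i j hij hi hj)
  · push Not at hE
    exact ⟨0, fun i j hij => absurd hij (hE i j)⟩

/-- A flow on a family of edges which forms a union of paths, whose divergence has at most three
support points, splits at a vertex into two flows with two-point divergences. -/
theorem exists_flow_splitting {ι V : Type*} [Fintype V] [DecidableEq ι] [DecidableEq V]
    (u : ι → V → ℂ) (hsum : ∀ t, ∑ k, u t k = 0) (F : Finset ι)
    (hleaf : ∀ F' ⊆ F, F'.Nonempty → ∃ t ∈ F', ∃ v x, v ≠ x ∧ u t v ≠ 0 ∧ u t x ≠ 0 ∧
      (∀ k, u t k ≠ 0 → k = v ∨ k = x) ∧ ∀ t' ∈ F', u t' v ≠ 0 → t' = t)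
    (htri : ∀ t₁ ∈ F, ∀ t₂ ∈ F, ∀ t₃ ∈ F, t₁ ≠ t₂ → t₁ ≠ t₃ → t₂ ≠ t₃ →
      ∀ v, u t₁ v ≠ 0 → u t₂ v ≠ 0 → u t₃ v = 0)
    (hF : 2 ≤ F.card) (hsupp : (Finset.univ.filter fun k => ∑ t ∈ F, u t k ≠ 0).card ≤ 3) :
    ∃ (F₁ F₂ : Finset ι) (x s y : V), Disjoint F₁ F₂ ∧ F₁ ∪ F₂ = F ∧ x ≠ s ∧ y ≠ s ∧
      (∀ k, ∑ t ∈ F₁, u t k ≠ 0 ↔ k = x ∨ k = s) ∧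
      (∀ k, ∑ t ∈ F₂, u t k ≠ 0 ↔ k = y ∨ k = s) ∧
      (∀ t ∈ F₂, u t x = 0) ∧ (∀ t ∈ F₁, u t y = 0) := by
  induction hk : F.card using Nat.strong_induction_on generalizing F with
  | _ k ih =>
  -- Remove a leaf edge t with free end v and inner end x. The support S of the divergence then
  -- loses v and can otherwise change only at x.
  obtain ⟨t, htF, v, x, hvx, hv, hx, htwo, huniq⟩ :=
    hleaf F subset_rfl (Finset.card_pos.1 (by omega))
  set F' := F.erase t with hF'
  have hF'F : F' ⊆ F := Finset.erase_subset _ _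
  have hcard' : F'.card + 1 = F.card := Finset.card_erase_add_one htF
  have hsplit : ∀ k, ∑ r ∈ F, u r k = u t k + ∑ r ∈ F', u r k := fun k =>
    (Finset.add_sum_erase F (fun r => u r k) htF).symm
  have hF'v : ∀ r ∈ F', u r v = 0 := by
    intro r hr
    by_contra h
    exact (Finset.mem_erase.1 hr).1 (huniq r (hF'F hr) h)
  have hut : ∀ k, k ≠ v → k ≠ x → u t k = 0 := by
    intro k h1 h2
    by_contra h
    exact (htwo k h).elim h1 h2
  set S := Finset.univ.filter fun k => ∑ r ∈ F, u r k ≠ 0 with hS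
  set S' := Finset.univ.filter fun k => ∑ r ∈ F', u r k ≠ 0 with hS'
  have hvS' : ∑ r ∈ F', u r v = 0 := Finset.sum_eq_zero hF'v
  have hvS : v ∈ S := by
    simp [hS, hsplit, hvS', hv]
  have hS'S : ∀ k ∈ S', k ≠ x → k ∈ S.erase v := by
    intro k hk hkx
    have hkv : k ≠ v := by
      rintro rfl
      simp [hS', hvS'] at hk
    simp only [hS, Finset.mem_erase, Finset.mem_filter, Finset.mem_univ, true_and]
    refine ⟨hkv, ?_⟩
    rw [hsplit, hut k hkv hkx, zero_add]
    simpa [hS'] using hk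
  have hSv : (S.erase v).card ≤ 2 := by
    have := Finset.card_erase_add_one hvS
    omega
  have hsum' : ∑ k, ∑ r ∈ F', u r k = 0 := by
    rw [Finset.sum_comm]
    exact Finset.sum_eq_zero fun r _ => hsum r
  have hxS' : x ∉ S' → x ∈ S := by
    intro h
    simp only [hS', Finset.mem_filter, Finset.mem_univ, true_and, not_not] at h
    simp [hS, hsplit, h, hx]
  -- the support of the remaining flow has at least two elements
  have hS'two : 2 ≤ S'.card := by
    obtain ⟨t₁, ht₁, v₁, x₁, -, hv₁, -, -, huniq₁⟩ :=
      hleaf F' hF'F (Finset.card_pos.1 (by omega))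
    have hval : ∑ r ∈ F', u r v₁ = u t₁ v₁ := by
      apply Finset.sum_eq_single_of_mem t₁ ht₁
      intro r hr hne
      by_contra h
      exact hne (huniq₁ r hr h)
    have hmem : v₁ ∈ S' := by simp [hS', hval, hv₁]
    by_contra hlt
    have hone : S' = {v₁} := by
      apply Finset.eq_singleton_iff_unique_mem.2 ⟨hmem, fun y hy => ?_⟩
      exact Finset.card_le_one.1 (by omega) _ hy _ hmem
    have : ∑ k, ∑ r ∈ F', u r k = ∑ r ∈ F', u r v₁ := by
      apply Finset.sum_eq_single_of_mem v₁ (Finset.mem_univ _)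
      intro k _ hkne
      by_contra h
      have : k ∈ S' := by simp [hS', h]
      rw [hone, Finset.mem_singleton] at this
      exact hkne this
    rw [hsum', hval] at this
    exact hv₁ this.symm
  -- Without divergence at x, the set S' would lie in S minus v and x, leaving at most one point.
  have hxmem : x ∈ S' := by
    by_contra h
    have hsub : S' ⊆ (S.erase v).erase x := by
      intro k hk
      have hkx : k ≠ x := by
        rintro rfl
        exact h hk
      exact Finset.mem_erase.2 ⟨hkx, hS'S k hk hkx⟩
    have h1 := Finset.card_le_card hsub
    have h2 := Finset.card_erase_add_one
      (Finset.mem_erase.2 ⟨hvx.symm, hxS' h⟩ : x ∈ S.erase v)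
    omega
  have hsub : S'.erase x ⊆ S.erase v := fun k hk =>
    hS'S k (Finset.mem_erase.1 hk).2 (Finset.mem_erase.1 hk).1
  have hcx := Finset.card_erase_add_one hxmem
  have hcs := Finset.card_le_card hsub
  -- With two points left, x is the splitting vertex and the leaf edge is one of the two parts. With
  -- three, the leaf cancels the rest at x, and it is glued on after the rest has been split.
  by_cases hc2 : S'.card = 2
  · obtain ⟨y, hy⟩ := Finset.card_eq_one.1 (show (S'.erase x).card = 1 by omega)
    have hyS' : y ∈ S'.erase x := by rw [hy]; exact Finset.mem_singleton_self _
    have hyx : y ≠ x := (Finset.mem_erase.1 hyS').1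
    have hyv : y ≠ v := (Finset.mem_erase.1 (hsub hyS')).1
    refine ⟨{t}, F', v, x, y, ?_, ?_, hvx, hyx, ?_, ?_, hF'v, ?_⟩
    · simp [hF']
    · rw [hF', ← Finset.insert_eq, Finset.insert_erase htF]
    · intro k
      rw [Finset.sum_singleton]
      refine ⟨htwo k, ?_⟩
      rintro (rfl | rfl)
      · exact hv
      · exact hx
    · intro k
      have : (∑ r ∈ F', u r k ≠ 0) ↔ k ∈ S' := by simp [hS']
      rw [this]
      constructor
      · intro hk
        by_cases hkx : k = x
        · exact Or.inr hkx
        · have : k ∈ S'.erase x := Finset.mem_erase.2 ⟨hkx, hk⟩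
          rw [hy, Finset.mem_singleton] at this
          exact Or.inl this
      · rintro (rfl | rfl)
        · exact (Finset.mem_erase.1 hyS').2
        · exact hxmem
    · intro r hr
      rw [Finset.mem_singleton] at hr
      subst hr
      exact hut y hyv hyx
  · have hc3 : S'.card = 3 := by omega
    have hxS : x ∉ S := by
      intro h
      have hsub2 : S' ⊆ S.erase v := by
        intro k hk
        by_cases hkx : k = x
        · subst hkx
          exact Finset.mem_erase.2 ⟨hvx.symm, h⟩
        · exact hS'S k hk hkx
      have := Finset.card_le_card hsub2
      omega
    have hx0 : u t x + ∑ r ∈ F', u r x = 0 := by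
      rw [← hsplit]
      simpa [hS] using hxS
    have hF'2 : 2 ≤ F'.card := by
      by_contra hlt
      obtain ⟨r, hr⟩ := Finset.card_eq_one.1 (show F'.card = 1 by omega)
      obtain ⟨t₁, ht₁, v₁, x₁, -, -, -, h2, -⟩ :=
        hleaf F' hF'F (Finset.card_pos.1 (by omega))
      have : S' ⊆ {v₁, x₁} := by
        intro k hk
        rw [hr, Finset.mem_singleton] at ht₁
        subst ht₁
        simp only [hS', hr, Finset.sum_singleton, Finset.mem_filter, Finset.mem_univ,
          true_and] at hk
        simpa using h2 k hk
      have := (Finset.card_le_card this).trans Finset.card_le_two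
      omega
    -- attach the leaf edge to the part containing its inner end point as an outer end point
    have attach : ∀ (F₁ F₂ : Finset ι) (s y : V), Disjoint F₁ F₂ → F₁ ∪ F₂ = F' → x ≠ s →
        y ≠ s → (∀ k, ∑ t ∈ F₁, u t k ≠ 0 ↔ k = x ∨ k = s) →
        (∀ k, ∑ t ∈ F₂, u t k ≠ 0 ↔ k = y ∨ k = s) →
        (∀ t ∈ F₂, u t x = 0) → (∀ t ∈ F₁, u t y = 0) →
        Disjoint (insert t F₁) F₂ ∧ insert t F₁ ∪ F₂ = F ∧ v ≠ s ∧ y ≠ s ∧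
          (∀ k, ∑ r ∈ insert t F₁, u r k ≠ 0 ↔ k = v ∨ k = s) ∧
          (∀ k, ∑ t ∈ F₂, u t k ≠ 0 ↔ k = y ∨ k = s) ∧
          (∀ t ∈ F₂, u t v = 0) ∧ (∀ r ∈ insert t F₁, u r y = 0) := by
      intro F₁ F₂ s y hd hun hxs hys h1 h2 h3 h4
      have hF₁ : F₁ ⊆ F' := hun ▸ Finset.subset_union_left
      have hF₂ : F₂ ⊆ F' := hun ▸ Finset.subset_union_right
      have htF' : t ∉ F' := by simp [hF']
      have ht₁ : t ∉ F₁ := fun h => htF' (hF₁ h)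
      have ht₂ : t ∉ F₂ := fun h => htF' (hF₂ h)
      have hF₁v : ∑ r ∈ F₁, u r v = 0 := Finset.sum_eq_zero fun r hr => hF'v r (hF₁ hr)
      have hF₂v : ∑ r ∈ F₂, u r v = 0 := Finset.sum_eq_zero fun r hr => hF'v r (hF₂ hr)
      have hvs : v ≠ s := by
        rintro rfl
        exact (h1 v).2 (Or.inr rfl) hF₁v
      have hyv : y ≠ v := by
        rintro rfl
        exact (h2 y).2 (Or.inl rfl) hF₂v
      have hyx : y ≠ x := by
        rintro rfl
        exact (h1 y).2 (Or.inl rfl) (Finset.sum_eq_zero h4)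
      refine ⟨?_, ?_, hvs, hys, ?_, h2, fun r hr => hF'v r (hF₂ hr), ?_⟩
      · rw [Finset.disjoint_insert_left]
        exact ⟨ht₂, hd⟩
      · rw [Finset.insert_union, hun, hF', Finset.insert_erase htF]
      · intro k
        rw [Finset.sum_insert ht₁]
        by_cases hkv : k = v
        · subst hkv
          simp [hF₁v, hv]
        · by_cases hkx : k = x
          · subst hkx
            have : ∑ r ∈ F', u r k = ∑ r ∈ F₁, u r k := by
              rw [← hun, Finset.sum_union hd, Finset.sum_eq_zero h3, add_zero]
            rw [← this, hx0]
            simp [hxs, hvx.symm]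
          · rw [hut k hkv hkx, zero_add, h1 k]
            simp [hkv, hkx]
      · intro r hr
        rcases Finset.mem_insert.1 hr with rfl | hr
        · exact hut y hyv hyx
        · exact h4 r hr
    obtain ⟨F₁, F₂, x', s, y, hd, hun, hxs, hys, h1, h2, h3, h4⟩ :=
      ih F'.card (by omega) F' (fun F'' h => hleaf F'' (h.trans hF'F))
        (fun t₁ h₁ t₂ h₂ t₃ h₃ => htri t₁ (hF'F h₁) t₂ (hF'F h₂) t₃ (hF'F h₃))
        hF'2 hc3.le rfl
    have hF₁ : F₁ ⊆ F' := hun ▸ Finset.subset_union_left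
    have hF₂ : F₂ ⊆ F' := hun ▸ Finset.subset_union_right
    have htF' : t ∉ F' := by simp [hF']
    have hcase : x = x' ∨ x = y ∨ x = s := by
      have hxne : ∑ r ∈ F', u r x ≠ 0 := by simpa [hS'] using hxmem
      rw [← hun, Finset.sum_union hd] at hxne
      by_cases h : ∑ r ∈ F₁, u r x = 0
      · rw [h, zero_add] at hxne
        rcases (h2 x).1 hxne with h | h <;> simp [h]
      · rcases (h1 x).1 h with h | h <;> simp [h]
    rcases hcase with rfl | rfl | rfl
    · exact ⟨_, _, _, _, _, attach F₁ F₂ s y hd hun hxs hys h1 h2 h3 h4⟩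
    · obtain ⟨a1, a2, a3, a4, a5, a6, a7, a8⟩ :=
        attach F₂ F₁ s x' hd.symm (by rw [Finset.union_comm, hun]) hys hxs h2 h1 h4 h3
      exact ⟨_, _, _, _, _, a1.symm, by rw [Finset.union_comm, a2], a4, a3, a6, a5, a8, a7⟩
    -- The rest cannot be split at x itself: an edge of each part and the leaf edge would all meet
    -- there.
    · exfalso
      obtain ⟨t₁, ht₁, hne₁⟩ := Finset.exists_ne_zero_of_sum_ne_zero ((h1 x).2 (Or.inr rfl))
      obtain ⟨t₂, ht₂, hne₂⟩ := Finset.exists_ne_zero_of_sum_ne_zero ((h2 x).2 (Or.inr rfl))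
      refine hx (htri t₁ (hF'F (hF₁ ht₁)) t₂ (hF'F (hF₂ ht₂)) t htF ?_ ?_ ?_ x hne₁ hne₂)
      · rintro rfl
        exact Finset.disjoint_left.1 hd ht₁ ht₂
      · rintro rfl
        exact htF' (hF₁ ht₁)
      · rintro rfl
        exact htF' (hF₂ ht₂)

/-! ### Smoothable weights -/

section SmoothableWeights

variable {n : ℕ} {L b : Matrix (Fin n) (Fin n) ℂ} {G : SimpleGraph (Fin n)}

theorem IsBiresidue.diag (hb : IsBiresidue L b) (i : Fin n) : b i i = 0 := by
  have := hb.alternating i i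
  linear_combination this / 2

/-- Without the denominator, the entries −1 at the two end points obey the same linear formula as
all the others. -/
theorem IsSmoothableWeight.mul_eq (hb : IsBiresidue L b) {i j : Fin n} {θ : Fin n → ℤ}
    (h : IsSmoothableWeight b i j θ) (k : Fin n) : b i j * (θ k : ℂ) = b j k - b i k := by
  obtain ⟨h1, h2, h3, h4⟩ := h
  by_cases hi : k = i
  · subst hi
    rw [h1, hb.diag, hb.alternating j k]
    push_cast
    ring
  by_cases hj : k = j
  · subst hj
    rw [h2, hb.diag]
    push_cast
    ring
  rw [← (h4 k hi hj).2, mul_div_cancel₀ _ h3, hb.alternating k i]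
  ring

theorem IsSmoothableWeight.nonneg {i j : Fin n} {θ : Fin n → ℤ}
    (h : IsSmoothableWeight b i j θ) {k : Fin n} (hi : k ≠ i) (hj : k ≠ j) : 0 ≤ θ k :=
  (h.2.2.2 k hi hj).1

theorem IsSmoothableWeight.eq_or_of_neg {i j : Fin n} {θ : Fin n → ℤ}
    (h : IsSmoothableWeight b i j θ) {k : Fin n} (hk : θ k < 0) : k = i ∨ k = j := by
  by_contra hne
  push Not at hne
  exact absurd (h.nonneg hne.1 hne.2) (by omega)

theorem IsSmoothableWeight.symm (hb : IsBiresidue L b) {i j : Fin n} {θ : Fin n → ℤ}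
    (h : IsSmoothableWeight b i j θ) : IsSmoothableWeight b j i θ := by
  have hne : b j i ≠ 0 := by
    rw [hb.alternating j i]
    exact neg_ne_zero.2 h.2.2.1
  refine ⟨h.2.1, h.1, hne, fun k hj hi => ⟨h.nonneg hi hj, ?_⟩⟩
  rw [div_eq_iff hne]
  have := h.mul_eq hb k
  rw [hb.alternating j i, hb.alternating k j]
  linear_combination this

theorem IsSmoothableWeight.unique {i j : Fin n} {θ θ' : Fin n → ℤ}
    (h : IsSmoothableWeight b i j θ) (h' : IsSmoothableWeight b i j θ') : θ = θ' := by
  ext k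
  by_cases hi : k = i
  · rw [hi, h.1, h'.1]
  by_cases hj : k = j
  · rw [hj, h.2.1, h'.2.1]
  have := (h.2.2.2 k hi hj).2.symm.trans (h'.2.2.2 k hi hj).2
  exact_mod_cast this

/-- The complexification of an integral weight. -/
def weightVec (w : Fin n → ℤ) : Fin n → ℂ := fun k => (w k : ℂ)

@[simp] theorem weightVec_apply (w : Fin n → ℤ) (k : Fin n) : weightVec w k = (w k : ℂ) := rfl

theorem weightVec_add (u v : Fin n → ℤ) : weightVec (u + v) = weightVec u + weightVec v := by
  ext k
  simp

theorem weightVec_sum {ι : Type*} (s : Finset ι) (w : ι → Fin n → ℤ) :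
    weightVec (∑ t ∈ s, w t) = ∑ t ∈ s, weightVec (w t) := by
  ext k
  simp

theorem IsSmoothableWeight.sum_eq_zero (hb : IsBiresidue L b) {i j : Fin n} {θ : Fin n → ℤ}
    (h : IsSmoothableWeight b i j θ) : ∑ k, θ k = 0 := by
  have h1 : b i j * ∑ k, (θ k : ℂ) = 0 := by
    rw [Finset.mul_sum, Finset.sum_congr rfl fun k _ => h.mul_eq hb k, Finset.sum_sub_distrib,
      hb.normalized, hb.normalized, sub_zero]
  have h2 := (mul_eq_zero.1 h1).resolve_left h.2.2.1
  exact_mod_cast h2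

/-- By `mul_eq`, θ is `b` applied to a multiple of e_i − e_j, and `L` inverts `b` on vectors of sum
zero. Through `L`, smoothable weights are thus flows along single edges. -/
theorem IsSmoothableWeight.mulVec_eq (hb : IsBiresidue L b) {i j : Fin n}
    {θ : Fin n → ℤ} (h : IsSmoothableWeight b i j θ) :
    L.mulVec (weightVec θ) = (b i j)⁻¹ • (Pi.single i 1 - Pi.single j 1) := by
  have hz : ∑ k, (Pi.single i 1 - Pi.single j 1 : Fin n → ℂ) k = 0 := by
    simp [Finset.sum_sub_distrib]
  have hθ : weightVec θ = (b i j)⁻¹ • b.mulVec (Pi.single i 1 - Pi.single j 1) := by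
    ext k
    have h1 := h.mul_eq hb k
    have h3 := h.2.2.1
    rw [Matrix.mulVec_sub]
    simp only [weightVec_apply, Pi.smul_apply, Pi.sub_apply, Matrix.mulVec_single, smul_eq_mul,
      MulOpposite.op_one, one_smul, Matrix.col_apply]
    rw [hb.alternating k i, hb.alternating k j]
    field_simp
    linear_combination h1
  rw [hθ, Matrix.mulVec_smul, hb.right_inv _ hz]

theorem IsSmoothableWeight.mulVec_apply_ne_zero_iff (hb : IsBiresidue L b) {i j : Fin n}
    (hij : i ≠ j) {θ : Fin n → ℤ} (h : IsSmoothableWeight b i j θ) (k : Fin n) :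
    L.mulVec (weightVec θ) k ≠ 0 ↔ k = i ∨ k = j := by
  rw [h.mulVec_eq hb]
  have h3 := h.2.2.1
  by_cases hi : k = i
  · subst hi
    simp [h3, hij]
  by_cases hj : k = j
  · subst hj
    simp [h3, hij.symm]
  simp [hi, hj]

/-- The ratio of the biresidues of two smoothable edges at a vertex is a negative rational
number. -/
theorem IsSmoothableWeight.exists_ratio (hb : IsBiresidue L b) {v x y : Fin n} (hxy : x ≠ y)
    (hvx : v ≠ x) (hvy : v ≠ y) {θ θ' : Fin n → ℤ} (h : IsSmoothableWeight b v x θ)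
    (h' : IsSmoothableWeight b v y θ') :
    ∃ p q : ℤ, 0 < p ∧ 0 < q ∧ (p : ℂ) * b v x + q * b v y = 0 := by
  have h1 := h.mul_eq hb y
  have h2 := h'.mul_eq hb x
  -- Evaluate the weight of v — x at y and that of v — y at x: in the sum b_xy and b_yx cancel, and
  -- the remaining −b_vy and −b_vx account for the two ones.
  refine ⟨1 + θ y, 1 + θ' x, ?_, ?_, ?_⟩
  · have := h.nonneg hvy.symm hxy.symm
    omega
  · have := h'.nonneg hvx.symm hxy
    omega
  · push_cast
    rw [hb.alternating y x] at h2
    linear_combination h1 + h2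

/-- A vertex lies on at most two smoothable edges. -/
theorem IsSmoothableWeight.not_three (hb : IsBiresidue L b) {v x y z : Fin n} (hxy : x ≠ y)
    (hxz : x ≠ z) (hyz : y ≠ z) (hvx : v ≠ x) (hvy : v ≠ y) (hvz : v ≠ z)
    {θ₁ θ₂ θ₃ : Fin n → ℤ} (h₁ : IsSmoothableWeight b v x θ₁) (h₂ : IsSmoothableWeight b v y θ₂)
    (h₃ : IsSmoothableWeight b v z θ₃) : False := by
  obtain ⟨p₁, q₁, hp₁, hq₁, e₁⟩ := h₁.exists_ratio hb hxy hvx hvy h₂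
  obtain ⟨p₂, q₂, hp₂, hq₂, e₂⟩ := h₁.exists_ratio hb hxz hvx hvz h₃
  obtain ⟨p₃, q₃, hp₃, hq₃, e₃⟩ := h₂.exists_ratio hb hyz hvy hvz h₃
  -- Three numbers cannot have pairwise negative ratios: eliminating two of them leaves a positive
  -- multiple of the third.
  have h : ((p₃ * p₁ * q₂ + q₃ * p₂ * q₁ : ℤ) : ℂ) * b v x = 0 := by
    push_cast
    linear_combination (p₃ * q₂ : ℂ) * e₁ + (q₃ * q₁ : ℂ) * e₂ - (q₁ * q₂ : ℂ) * e₃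
  have hpos : 0 < p₃ * p₁ * q₂ + q₃ * p₂ * q₁ := by positivity
  rcases mul_eq_zero.1 h with h | h
  · have : p₃ * p₁ * q₂ + q₃ * p₂ * q₁ = 0 := by exact_mod_cast h
    omega
  · exact h₁.2.2.1 h

/-! ### Sums of smoothable weights -/

theorem zero_mem_weightSums : (0 : Fin n → ℤ) ∈ weightSums b G 0 :=
  ⟨Fin.elim0, fun t => t.elim0, by simp⟩

theorem add_mem_weightSums {u v : Fin n → ℤ} {k m : ℕ} (hu : u ∈ weightSums b G k)
    (hv : v ∈ weightSums b G m) : u + v ∈ weightSums b G (k + m) := by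
  obtain ⟨s, hs, rfl⟩ := hu
  obtain ⟨t, ht, rfl⟩ := hv
  refine ⟨Fin.append s t, fun r => ?_, ?_⟩
  · induction r using Fin.addCases with
    | left r => simpa using hs r
    | right r => simpa using ht r
  · simp [Fin.sum_univ_add]

theorem mem_weightSums_one {w : Fin n → ℤ} :
    w ∈ weightSums b G 1 ↔ ∃ i j, G.Adj i j ∧ IsSmoothableWeight b i j w := by
  constructor
  · rintro ⟨s, hs, rfl⟩
    simpa using hs 0
  · intro h
    exact ⟨fun _ => w, fun _ => h, by simp⟩

theorem sum_eq_zero_of_mem_weightSums (hb : IsBiresidue L b) {w : Fin n → ℤ} {m : ℕ}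
    (h : w ∈ weightSums b G m) : ∑ k, w k = 0 := by
  obtain ⟨s, hs, rfl⟩ := h
  simp only [Finset.sum_apply]
  rw [Finset.sum_comm]
  refine Finset.sum_eq_zero fun t _ => ?_
  obtain ⟨i, j, -, h⟩ := hs t
  exact h.sum_eq_zero hb

/-- On a forest of smoothable edges there is an additive function of the weights with prescribed
values at the smoothable weights. -/
theorem exists_height (hb : IsBiresidue L b) (hG : G.IsAcyclic) (ν : Sym2 (Fin n) → ℂ) :
    ∃ φ : (Fin n → ℤ) →+ ℂ, ∀ i j θ, G.Adj i j → IsSmoothableWeight b i j θ → φ θ = ν s(i, j) := by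
  -- The function w ↦ ∑ f_k (L w)_k takes the value (f_i − f_j) / b_ij at the smoothable weight of i
  -- — j, so f must have coboundary ν b, which is antisymmetric. The choice ν = 1 gives the level;
  -- logarithms will give the rescaling of the variables.
  obtain ⟨f, hf⟩ := hG.exists_potential (fun i j => ν s(i, j) * b i j) (fun i j => by
    rw [Sym2.eq_swap, hb.alternating i j]
    ring)
  refine ⟨{ toFun := fun w => ∑ k, f k * L.mulVec (weightVec w) k
            map_zero' := ?_
            map_add' := fun u v => ?_ }, fun i j θ hij h => ?_⟩
  · have : weightVec (0 : Fin n → ℤ) = 0 := by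
      ext k
      simp
    simp [this]
  · simp [weightVec_add, Matrix.mulVec_add, mul_add, Finset.sum_add_distrib]
  · have h3 := h.2.2.1
    have h1 := hf i j hij
    simp only [AddMonoidHom.coe_mk, ZeroHom.coe_mk, h.mulVec_eq hb]
    simp only [Pi.smul_apply, Pi.sub_apply, smul_eq_mul, mul_sub, Finset.sum_sub_distrib]
    simp only [Pi.single_apply, mul_ite, mul_one, mul_zero, Finset.sum_ite_eq',
      Finset.mem_univ, if_true]
    field_simp
    linear_combination h1

/-- A sum of at least two smoothable weights of edges of a forest which is Poisson-contributing
cannot be made nonnegative by adding three basis vectors. -/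
theorem not_nonneg_of_isPoissonContributing (hb : IsBiresidue L b) (hG : G.IsAcyclic)
    {w : Fin n → ℤ} {m : ℕ} (hm : 2 ≤ m) (hw : w ∈ weightSums b G m)
    (hP : IsPoissonContributing L w) (x y z : Fin n) :
    ∃ k, k ≠ x ∧ k ≠ y ∧ k ≠ z ∧ w k < 0 := by
  classical
  obtain ⟨s, hs, rfl⟩ := hw
  by_contra hneg
  push Not at hneg
  obtain ⟨hge, hP⟩ := hP
  -- Equal summands are grouped, with multiplicities μ, so that distinct elements of F belong to
  -- distinct edges.
  set F : Finset (Fin n → ℤ) := Finset.univ.image s with hF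
  set μ : (Fin n → ℤ) → ℕ := fun θ => (Finset.univ.filter fun t => s t = θ).card with hμ
  have hFs : ∀ θ ∈ F, ∃ i j, G.Adj i j ∧ IsSmoothableWeight b i j θ := by
    intro θ hθ
    obtain ⟨t, -, rfl⟩ := Finset.mem_image.1 hθ
    exact hs t
  have hμpos : ∀ θ ∈ F, 0 < μ θ := by
    intro θ hθ
    obtain ⟨t, -, rfl⟩ := Finset.mem_image.1 hθ
    exact Finset.card_pos.2 ⟨t, by simp⟩
  set w := ∑ t, s t with hw
  have hwF : w = ∑ θ ∈ F, μ θ • θ := by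
    rw [hw, ← Finset.sum_fiberwise_of_maps_to (g := s) (t := F)
      (fun t _ => Finset.mem_image_of_mem _ (Finset.mem_univ t))]
    refine Finset.sum_congr rfl fun θ _ => ?_
    rw [hμ, Finset.sum_congr rfl (g := fun _ => θ) (fun t ht => (Finset.mem_filter.1 ht).2)]
    simp
  have hmμ : m = ∑ θ ∈ F, μ θ := by
    have := Finset.card_eq_sum_card_fiberwise (f := s) (s := Finset.univ) (t := F)
      (fun t _ => by simp [hF])
    simpa [hμ] using this
  set u : (Fin n → ℤ) → Fin n → ℂ := fun θ => (μ θ : ℂ) • L.mulVec (weightVec θ) with hu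
  -- replace `u` by zero outside of `F`
  set u' : (Fin n → ℤ) → Fin n → ℂ := fun θ => if θ ∈ F then u θ else 0 with hu'
  have hu'F : ∀ θ ∈ F, u' θ = u θ := fun θ hθ => by simp [hu', hθ]
  have hne : ∀ θ ∈ F, ∀ {i j}, G.Adj i j → IsSmoothableWeight b i j θ → ∀ k,
      (u' θ k ≠ 0 ↔ k = i ∨ k = j) := by
    intro θ hθ i j hij h k
    rw [hu'F θ hθ, hu, ← h.mulVec_apply_ne_zero_iff hb hij.ne k]
    have : (μ θ : ℂ) ≠ 0 := by exact_mod_cast (hμpos θ hθ).ne'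
    simp [this]
  have hsumF : ∀ F' ⊆ F, ∀ k, ∑ θ ∈ F', u' θ k =
      L.mulVec (weightVec (∑ θ ∈ F', μ θ • θ)) k := by
    intro F' hF' k
    rw [weightVec_sum, Matrix.mulVec_sum, Finset.sum_apply]
    refine Finset.sum_congr rfl fun θ hθ => ?_
    rw [hu'F θ (hF' hθ), hu]
    have : weightVec (μ θ • θ) = (μ θ : ℂ) • weightVec θ := by
      ext l
      simp
    rw [this, Matrix.mulVec_smul]
  -- The Poisson condition kills the divergence wherever w ≥ 0, so it lives on the entries −1, which
  -- by assumption are among x, y, z.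
  have hsuppw : ∀ k, ∑ θ ∈ F, u' θ k ≠ 0 → w k = -1 := by
    intro k hk
    rw [hsumF F subset_rfl, ← hwF] at hk
    by_contra h
    have h1 := hge k
    exact hk (hP k (by omega))
  have hsuppxyz : ∀ k, w k = -1 → k = x ∨ k = y ∨ k = z := by
    intro k hk
    by_contra h
    push Not at h
    have := hneg k h.1 h.2.1 h.2.2
    omega
  -- A single weight repeated m ≥ 2 times would have an entry −m, below −1.
  have hF2 : 2 ≤ F.card := by
    by_contra hlt
    have hFne : F.Nonempty := ⟨s ⟨0, by omega⟩, Finset.mem_image_of_mem _ (Finset.mem_univ _)⟩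
    obtain ⟨θ, hθ⟩ := Finset.card_eq_one.1
      (show F.card = 1 by have := Finset.card_pos.2 hFne; omega)
    have hθF : θ ∈ F := by rw [hθ]; simp
    obtain ⟨i, j, hij, h⟩ := hFs θ hθF
    rw [hθ, Finset.sum_singleton] at hwF hmμ
    have h1 := hge i
    rw [hwF, ← hmμ] at h1
    simp only [Pi.smul_apply, h.1, nsmul_eq_mul] at h1
    omega
  obtain ⟨F₁, F₂, p, r, q, hd, hun, hpr, hqr, h1, h2, h3, h4⟩ :=
    exists_flow_splitting u' (fun θ => by
      by_cases hθ : θ ∈ F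
      · obtain ⟨i, j, hij, h⟩ := hFs θ hθ
        rw [hu'F θ hθ, hu]
        simp only [Pi.smul_apply, smul_eq_mul, ← Finset.mul_sum, h.mulVec_eq hb]
        simp [Finset.sum_sub_distrib]
      · simp [hu', hθ]) F (by
      intro F' hF' hF'ne
      let H : SimpleGraph (Fin n) :=
        { Adj := fun i j => G.Adj i j ∧ ∃ θ ∈ F', IsSmoothableWeight b i j θ
          symm := ⟨fun i j ⟨hij, θ, hθ, h⟩ => ⟨hij.symm, θ, hθ, h.symm hb⟩⟩
          loopless := ⟨fun i h => G.irrefl h.1⟩ }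
      have hH : H.IsAcyclic := hG.anti fun i j h => h.1
      obtain ⟨θ₀, hθ₀⟩ := hF'ne
      obtain ⟨i, j, hij, h⟩ := hFs θ₀ (hF' hθ₀)
      obtain ⟨v, x, ⟨hvx, θ, hθ, h⟩, hleaf⟩ :=
        hH.exists_leaf (show H.Adj i j from ⟨hij, θ₀, hθ₀, h⟩)
      refine ⟨θ, hθ, v, x, hvx.ne, ?_, ?_, ?_, ?_⟩
      · exact (hne θ (hF' hθ) hvx h v).2 (Or.inl rfl)
      · exact (hne θ (hF' hθ) hvx h x).2 (Or.inr rfl)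
      · exact fun k hk => (hne θ (hF' hθ) hvx h k).1 hk
      · intro θ' hθ' hv'
        obtain ⟨i', j', hij', h'⟩ := hFs θ' (hF' hθ')
        rcases (hne θ' (hF' hθ') hij' h' v).1 hv' with rfl | rfl
        · have := hleaf j' ⟨hij', θ', hθ', h'⟩
          subst this
          exact h'.unique h
        · have := hleaf i' ⟨hij'.symm, θ', hθ', h'.symm hb⟩
          subst this
          exact (h'.symm hb).unique h) (by
      intro θ₁ hθ₁ θ₂ hθ₂ θ₃ hθ₃ h12 h13 h23 v hv1 hv2
      by_contra hv3
      have key : ∀ θ ∈ F, u' θ v ≠ 0 → ∃ x, G.Adj v x ∧ IsSmoothableWeight b v x θ := by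
        intro θ hθ hv
        obtain ⟨i, j, hij, h⟩ := hFs θ hθ
        rcases (hne θ hθ hij h v).1 hv with rfl | rfl
        · exact ⟨j, hij, h⟩
        · exact ⟨i, hij.symm, h.symm hb⟩
      obtain ⟨x₁, a₁, e₁⟩ := key θ₁ hθ₁ hv1
      obtain ⟨x₂, a₂, e₂⟩ := key θ₂ hθ₂ hv2
      obtain ⟨x₃, a₃, e₃⟩ := key θ₃ hθ₃ hv3
      refine IsSmoothableWeight.not_three hb ?_ ?_ ?_ a₁.ne a₂.ne a₃.ne e₁ e₂ e₃
      · rintro rfl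
        exact h12 (e₁.unique e₂)
      · rintro rfl
        exact h13 (e₁.unique e₃)
      · rintro rfl
        exact h23 (e₂.unique e₃)) hF2 (by
      refine (Finset.card_le_card (t := {x, y, z}) fun k hk => ?_).trans Finset.card_le_three
      simpa using hsuppxyz k (hsuppw k (by simpa using hk)))
  have hF₁ : F₁ ⊆ F := hun ▸ Finset.subset_union_left
  have hF₂ : F₂ ⊆ F := hun ▸ Finset.subset_union_right
  -- the value of a weight with two-point divergence is the same at the two points
  have hval : ∀ F' ⊆ F, ∀ p r, p ≠ r → (∀ k, ∑ θ ∈ F', u' θ k ≠ 0 ↔ k = p ∨ k = r) →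
      (∑ θ ∈ F', μ θ • θ) p = (∑ θ ∈ F', μ θ • θ) r := by
    intro F' hF' p r hpr hsupp
    set w' := ∑ θ ∈ F', μ θ • θ with hw'
    have hz : ∑ k, weightVec w' k = 0 := by
      have : ∑ k, w' k = 0 := by
        simp only [hw', Finset.sum_apply]
        rw [Finset.sum_comm]
        refine Finset.sum_eq_zero fun θ hθ => ?_
        obtain ⟨i, j, -, h⟩ := hFs θ (hF' hθ)
        simp only [Pi.smul_apply]
        rw [← Finset.smul_sum, h.sum_eq_zero hb, smul_zero]
      simpa [weightVec] using congrArg (Int.cast : ℤ → ℂ) this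
    have hinv := hb.left_inv _ hz
    set c := L.mulVec (weightVec w') with hc
    have hc0 : ∀ k, k ≠ p → k ≠ r → c k = 0 := by
      intro k hkp hkr
      by_contra h
      rw [hc, ← hsumF F' hF'] at h
      exact ((hsupp k).1 h).elim hkp hkr
    have hcsum : c p + c r = 0 := by
      have h0 : ∑ k, c k = 0 := by
        have : ∀ k, c k = ∑ θ ∈ F', u' θ k := fun k => (hsumF F' hF' k).symm
        rw [Finset.sum_congr rfl fun k _ => this k, Finset.sum_comm]
        refine Finset.sum_eq_zero fun θ hθ => ?_
        obtain ⟨i, j, hij, h⟩ := hFs θ (hF' hθ)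
        rw [hu'F θ (hF' hθ), hu]
        simp only [Pi.smul_apply, smul_eq_mul, ← Finset.mul_sum, h.mulVec_eq hb]
        simp [Finset.sum_sub_distrib]
      rw [← h0, ← Finset.sum_pair hpr]
      exact Finset.sum_subset (Finset.subset_univ _) fun k _ hk => by
        simp only [Finset.mem_insert, Finset.mem_singleton, not_or] at hk
        exact hc0 k hk.1 hk.2
    have hb2 : ∀ k, (w' k : ℂ) = b k p * c p + b k r * c r := by
      intro k
      rw [← weightVec_apply w' k, ← hinv, Matrix.mulVec, dotProduct,
        ← Finset.sum_pair (f := fun l => b k l * c l) hpr]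
      symm
      exact Finset.sum_subset (Finset.subset_univ _) fun l _ hl => by
        simp only [Finset.mem_insert, Finset.mem_singleton, not_or] at hl
        rw [hc0 l hl.1 hl.2, mul_zero]
    -- The weight is `b` applied to a multiple of e_p − e_r, whose entries at p and r agree by
    -- skew-symmetry.
    have : (w' p : ℂ) = w' r := by
      rw [hb2, hb2, hb.diag, hb.diag, hb.alternating r p]
      linear_combination (b p r) * hcsum
    exact_mod_cast this
  have hpos : ∀ F' ⊆ F, ∀ k, (∀ θ ∈ F', u' θ k = 0) → 0 ≤ (∑ θ ∈ F', μ θ • θ) k := by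
    intro F' hF' k hk
    rw [Finset.sum_apply]
    refine Finset.sum_nonneg fun θ hθ => ?_
    obtain ⟨i, j, hij, h⟩ := hFs θ (hF' hθ)
    have hk' := mt (hne θ (hF' hθ) hij h k).2 (not_not.2 (hk θ hθ))
    push Not at hk'
    exact nsmul_nonneg (h.nonneg hk'.1 hk'.2) _
  have hadd : ∀ k, w k = (∑ θ ∈ F₁, μ θ • θ) k + (∑ θ ∈ F₂, μ θ • θ) k := by
    intro k
    rw [hwF, ← hun, Finset.sum_union hd, Pi.add_apply]
  have hwp : w p = -1 := by
    apply hsuppw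
    rw [← hun, Finset.sum_union hd, Finset.sum_eq_zero h3, add_zero]
    exact (h1 p).2 (Or.inl rfl)
  have hwq : w q = -1 := by
    apply hsuppw
    rw [← hun, Finset.sum_union hd, Finset.sum_eq_zero h4, zero_add]
    exact (h2 q).2 (Or.inl rfl)
  -- No weight of F₂ is negative at p, so the first part is at most −1 at p, hence also at r. In the
  -- same way the second part is at most −1 at q and at r. Thus w r ≤ −2, a contradiction.
  have e1 := hval F₁ hF₁ p r hpr h1
  have e2 := hval F₂ hF₂ q r hqr h2
  have e3 := hpos F₂ hF₂ p h3
  have e4 := hpos F₁ hF₁ q h4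
  have e5 := hadd p
  have e6 := hadd q
  have e7 := hadd r
  have e8 := hge r
  omega

end SmoothableWeights

/-! ### Twisted cohomology of `ℕⁿ` with supports -/

section Cohomology

variable {n : ℕ}

/-- An element of the extension of the monoid `ℕⁿ` by a right module along a two-cocycle. -/
structure CocycleExtension {N : Type*} [AddCommGroup N] (K : (Fin n → ℕ) → AddSubgroup N) where
  base : Fin n → ℕ
  val : N
  mem : val ∈ K base

/-- A two-cocycle of `ℕⁿ` with values in a right module is a coboundary if the generators have
commuting lifts to the corresponding extension. -/
theorem exists_cochain_of_commuting_lifts {N : Type*} [AddCommGroup N]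
    (act : (Fin n → ℕ) → N →+ N) (c : (Fin n → ℕ) → (Fin n → ℕ) → N)
    (K : (Fin n → ℕ) → AddSubgroup N) (act_zero : ∀ p, ∀ f ∈ K p, act 0 f = f)
    (act_add : ∀ p q f, act (p + q) f = act q (act p f))
    (zero_left : ∀ q, c 0 q = 0) (zero_right : ∀ p, c p 0 = 0)
    (cocycle : ∀ p q r, c q r - c (p + q) r + c p (q + r) - act r (c p q) = 0)
    (K_act : ∀ p q, ∀ f ∈ K p, act q f ∈ K (p + q)) (K_mono : ∀ p q, ∀ f ∈ K q, f ∈ K (p + q))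
    (K_c : ∀ p q, c p q ∈ K (p + q)) (g : Fin n → N) (g_mem : ∀ i, g i ∈ K (Pi.single i 1))
    (comm : ∀ i j, act (Pi.single j 1) (g i) + g j - c (Pi.single i 1) (Pi.single j 1) =
      act (Pi.single i 1) (g j) + g i - c (Pi.single j 1) (Pi.single i 1)) :
    ∃ ψ : (Fin n → ℕ) → N, ψ 0 = 0 ∧ (∀ p, ψ p ∈ K p) ∧
      ∀ p q, c p q = ψ q - ψ (p + q) + act q (ψ p) := by
  have hext : ∀ x y : CocycleExtension K, x.base = y.base → x.val = y.val → x = y := by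
    rintro ⟨p, a, ha⟩ ⟨q, b, hb⟩ h1 h2
    simp only at h1 h2
    subst h1 h2
    rfl
  -- Associativity of this extension is the cocycle identity. As ℕⁿ is the free commutative monoid,
  -- commuting lifts of its generators extend to a multiplicative section, whose second component is
  -- the cochain. The subgroups `K p` carry the support condition along.
  let _ : Monoid (CocycleExtension K) :=
    { mul := fun x y => ⟨x.base + y.base, act y.base x.val + y.val - c x.base y.base,
        sub_mem (add_mem (K_act _ _ _ x.mem) (K_mono _ _ _ y.mem)) (K_c _ _)⟩
      one := ⟨0, 0, zero_mem _⟩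
      mul_assoc := fun x y z => hext _ _ (add_assoc _ _ _) (by
        change act z.base (act y.base x.val + y.val - c x.base y.base) + z.val
            - c (x.base + y.base) z.base = act (y.base + z.base) x.val
            + (act z.base y.val + z.val - c y.base z.base) - c x.base (y.base + z.base)
        rw [act_add, map_sub, map_add]
        have := cocycle x.base y.base z.base
        rw [← sub_eq_zero]
        rw [← this]
        abel)
      one_mul := fun x => hext _ _ (zero_add _) (by
        change act x.base 0 + x.val - c 0 x.base = x.val
        rw [zero_left, map_zero]
        abel)
      mul_one := fun x => hext _ _ (add_zero _) (by
        change act 0 x.val + 0 - c x.base 0 = x.val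
        rw [zero_right, act_zero _ _ x.mem]
        abel) }
  have base_mul : ∀ x y : CocycleExtension K, (x * y).base = x.base + y.base := fun _ _ => rfl
  have val_mul : ∀ x y : CocycleExtension K,
      (x * y).val = act y.base x.val + y.val - c x.base y.base := fun _ _ => rfl
  let gen : Fin n → CocycleExtension K := fun i => ⟨Pi.single i 1, g i, g_mem i⟩
  have hcomm : ∀ x ∈ Set.range gen, ∀ y ∈ Set.range gen, x * y = y * x := by
    rintro _ ⟨i, rfl⟩ _ ⟨j, rfl⟩
    refine hext _ _ ?_ ?_
    · rw [base_mul, base_mul, add_comm]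
    · rw [val_mul, val_mul]
      exact comm i j
  have hclos := Submonoid.isMulCommutative_closure _ hcomm
  let _ : CommMonoid (Submonoid.closure (Set.range gen)) :=
    { (inferInstance : Monoid (Submonoid.closure (Set.range gen))) with
      mul_comm := fun x y => hclos.is_comm.comm x y }
  let gen' : Fin n → Submonoid.closure (Set.range gen) := fun i =>
    ⟨gen i, Submonoid.subset_closure ⟨i, rfl⟩⟩
  let Φ : (Fin n → ℕ) → CocycleExtension K := fun p =>
    ((∏ i, gen' i ^ p i : Submonoid.closure (Set.range gen)) : CocycleExtension K)
  have Φ_zero : Φ 0 = 1 := by simp [Φ]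
  have Φ_add : ∀ p q, Φ (p + q) = Φ p * Φ q := by
    intro p q
    simp only [Φ, Pi.add_apply, pow_add, Finset.prod_mul_distrib, Submonoid.coe_mul]
  have Φ_single : ∀ i, Φ (Pi.single i 1) = gen i := by
    intro i
    have : (∏ k, gen' k ^ (Pi.single i 1 : Fin n → ℕ) k) = gen' i := by
      rw [Finset.prod_eq_single i]
      · simp
      · intro k _ hk
        simp [hk]
      · simp
    simp only [Φ, this, gen']
  have Φ_base : ∀ p, (Φ p).base = p := by
    let B : (Fin n → ℕ) →+ (Fin n → ℕ) :=
      { toFun := fun p => (Φ p).base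
        map_zero' := by
          rw [Φ_zero]
          rfl
        map_add' := fun p q => by rw [Φ_add, base_mul] }
    have hB : B = AddMonoidHom.id _ := by
      apply AddMonoidHom.functions_ext
      intro i x
      have h1 : B (Pi.single i 1) = Pi.single i 1 := by
        change (Φ (Pi.single i 1)).base = _
        rw [Φ_single]
      have h2 : (Pi.single i x : Fin n → ℕ) = x • Pi.single i 1 := by
        rw [← Pi.single_smul]
        simp
      rw [h2, map_nsmul, map_nsmul, h1]
      rfl
    intro p
    exact DFunLike.congr_fun hB p
  refine ⟨fun p => (Φ p).val, ?_, fun p => ?_, fun p q => ?_⟩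
  · simp only [Φ_zero]
    rfl
  · have := (Φ p).mem
    rwa [Φ_base] at this
  · simp only [Φ_add, val_mul, Φ_base]
    abel

/-- The Poincaré lemma for difference forms of degree two on `ℕⁿ`, with supports. -/
theorem exists_difference_primitive (T : (Fin n → ℕ) → Prop) (hT : ∀ p q, p ≤ q → T p → T q)
    (ρ : Fin n → Fin n → (Fin n → ℕ) → ℂ) (hanti : ∀ i j r, ρ i j r = -ρ j i r)
    (hclosed : ∀ i j k r, (ρ j k r - ρ j k (r + Pi.single i 1))
      + (ρ k i r - ρ k i (r + Pi.single j 1)) + (ρ i j r - ρ i j (r + Pi.single k 1)) = 0)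
    (hsupp : ∀ i j r, ρ i j r ≠ 0 → T (r + Pi.single i 1 + Pi.single j 1)) :
    ∃ g : Fin n → (Fin n → ℕ) → ℂ, (∀ i r, g i r ≠ 0 → T (r + Pi.single i 1)) ∧
      ∀ i j r, ρ i j r = (g j r - g j (r + Pi.single i 1)) - (g i r - g i (r + Pi.single j 1)) := by
  -- Induction on the number k of coordinate directions in which the primitive is already correct.
  suffices h : ∀ k ≤ n, ∃ g : Fin n → (Fin n → ℕ) → ℂ,
      (∀ i r, g i r ≠ 0 → T (r + Pi.single i 1)) ∧ ∀ i j : Fin n, i.val < k → j.val < k → ∀ r,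
        ρ i j r = (g j r - g j (r + Pi.single i 1)) - (g i r - g i (r + Pi.single j 1)) by
    obtain ⟨g, hg, h⟩ := h n le_rfl
    exact ⟨g, hg, fun i j => h i j i.2 j.2⟩
  intro k
  induction k with
  | zero => exact fun _ => ⟨0, by simp, by simp⟩
  | succ k ih =>
    intro hk
    obtain ⟨g, hg, hgρ⟩ := ih (by omega)
    let κ : Fin n := ⟨k, hk⟩
    let ρ' : Fin n → Fin n → (Fin n → ℕ) → ℂ := fun i j r =>
      ρ i j r - ((g j r - g j (r + Pi.single i 1)) - (g i r - g i (r + Pi.single j 1)))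
    have hρ'supp : ∀ i j r, ρ' i j r ≠ 0 → T (r + Pi.single i 1 + Pi.single j 1) := by
      intro i j r h
      have hle : r ≤ r + Pi.single i 1 := le_self_add
      by_contra hne
      have e1 : ρ i j r = 0 := not_not.1 fun h => hne (hsupp i j r h)
      have e2 : g j r = 0 := not_not.1 fun h =>
        hne (hT _ _ (add_le_add_left hle _) (hg j r h))
      have e3 : g j (r + Pi.single i 1) = 0 := not_not.1 fun h => hne (hg j _ h)
      have e4 : g i r = 0 := not_not.1 fun h => hne (hT _ _ le_self_add (hg i r h))
      have e5 : g i (r + Pi.single j 1) = 0 := not_not.1 fun h => hne (by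
        have := hg i _ h
        rwa [add_right_comm] at this)
      simp [ρ', e1, e2, e3, e4, e5] at h
    have hρ'anti : ∀ i j r, ρ' i j r = -ρ' j i r := by
      intro i j r
      simp only [ρ', hanti i j r]
      ring
    have hρ'closed : ∀ i j k r, (ρ' j k r - ρ' j k (r + Pi.single i 1))
        + (ρ' k i r - ρ' k i (r + Pi.single j 1)) + (ρ' i j r - ρ' i j (r + Pi.single k 1)) = 0 := by
      intro i j k r
      rw [← hclosed i j k r]
      simp only [ρ', add_right_comm r (Pi.single j 1) (Pi.single i 1),
        add_right_comm r (Pi.single k 1) (Pi.single i 1),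
        add_right_comm r (Pi.single k 1) (Pi.single j 1)]
      ring
    have hρ'zero : ∀ i j : Fin n, i.val < k → j.val < k → ∀ r, ρ' i j r = 0 := by
      intro i j hi hj r
      simp only [ρ', hgρ i j hi hj r, sub_self]
    -- Summation in the direction κ inverts the difference operator in that direction. The remaining
    -- form vanishes on pairs of the first k directions, so integrating its components against κ
    -- suffices.
    let I : ((Fin n → ℕ) → ℂ) → (Fin n → ℕ) → ℂ := fun h r =>
      -∑ t ∈ Finset.range (r κ), h (Function.update r κ t)
    have hI : ∀ h r, I h r - I h (r + Pi.single κ 1) = h r := by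
      intro h r
      have h1 : (r + Pi.single κ 1 : Fin n → ℕ) κ = r κ + 1 := by simp
      have h2 : ∀ t, Function.update (r + Pi.single κ 1) κ t = Function.update r κ t := by
        intro t
        ext l
        by_cases hl : l = κ
        · subst hl
          simp
        · simp [hl]
      simp only [I, h1, h2, Finset.sum_range_succ, Function.update_eq_self]
      ring
    have hIshift : ∀ h r i, i ≠ κ → I h (r + Pi.single i 1) =
        I (fun r => h (r + Pi.single i 1)) r := by
      intro h r i hi
      have h1 : (r + Pi.single i 1 : Fin n → ℕ) κ = r κ := by simp [hi.symm]
      have h2 : ∀ t, Function.update (r + Pi.single i 1) κ t =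
          Function.update r κ t + Pi.single i 1 := by
        intro t
        ext l
        by_cases hl : l = κ
        · subst hl
          simp [hi.symm]
        · simp [hl]
      simp only [I, h1, h2]
    have hIsub : ∀ h h' r, I (fun r => h r - h' r) r = I h r - I h' r := by
      intro h h' r
      simp only [I, Finset.sum_sub_distrib]
      ring
    let g' : Fin n → (Fin n → ℕ) → ℂ := fun i r => if i.val < k then I (ρ' κ i) r else 0
    have hg'supp : ∀ i r, g' i r ≠ 0 → T (r + Pi.single i 1) := by
      intro i r h
      have hi : i.val < k := by
        by_contra hi
        simp [g', hi] at h
      simp only [g', hi, if_true, I, neg_ne_zero] at h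
      obtain ⟨t, ht, hne⟩ := Finset.exists_ne_zero_of_sum_ne_zero h
      -- Only points with κ-entry t < r κ are summed over; adding e_κ back stays below r, so the
      -- support condition survives.
      refine hT _ _ (add_le_add_left ?_ _) (hρ'supp κ i _ hne)
      intro l
      have ht := Finset.mem_range.1 ht
      by_cases hl : l = κ
      · subst hl
        simp
        omega
      · simp [hl]
    refine ⟨fun i r => g i r + g' i r, fun i r h => ?_, ?_⟩
    · by_contra hne
      have e1 : g i r = 0 := not_not.1 fun h => hne (hg i r h)
      have e2 : g' i r = 0 := not_not.1 fun h => hne (hg'supp i r h)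
      simp [e1, e2] at h
    -- the correction term has the required differential
    have key : ∀ i j : Fin n, i.val < k → j.val < k + 1 → ∀ r,
        ρ' i j r = (g' j r - g' j (r + Pi.single i 1)) - (g' i r - g' i (r + Pi.single j 1)) := by
      intro i j hi hj r
      have hiκ : i ≠ κ := by
        rintro rfl
        simp [κ] at hi
      by_cases hjk : j.val < k
      · have hjκ : j ≠ κ := by
          rintro rfl
          simp [κ] at hjk
        rw [hρ'zero i j hi hjk]
        simp only [g', hi, hjk, if_true]
        rw [hIshift _ _ _ hiκ, hIshift _ _ _ hjκ]
        have e1 := hIsub (fun r => ρ' κ j r - ρ' κ j (r + Pi.single i 1))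
          (fun r => ρ' κ i r - ρ' κ i (r + Pi.single j 1)) r
        have e2 := hIsub (ρ' κ j) (fun r => ρ' κ j (r + Pi.single i 1)) r
        have e3 := hIsub (ρ' κ i) (fun r => ρ' κ i (r + Pi.single j 1)) r
        have : (fun r => ρ' κ j r - ρ' κ j (r + Pi.single i 1) -
            (ρ' κ i r - ρ' κ i (r + Pi.single j 1))) = fun _ => 0 := by
          ext r
          have h := hρ'closed κ i j r
          rw [hρ'zero i j hi hjk, hρ'zero i j hi hjk, hρ'anti j κ, hρ'anti j κ] at h
          linear_combination -h
        rw [this] at e1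
        have e0 : I (fun _ => 0) r = 0 := by simp [I]
        linear_combination e1 + e2 - e3 - e0
      · have hj : j = κ := Fin.ext (by simp [κ]; omega)
        subst hj
        simp only [g', hi, hjk, if_true, if_false]
        rw [hI, hρ'anti]
        ring
    have key' : ∀ i j : Fin n, i.val < k + 1 → j.val < k + 1 → ∀ r,
        ρ' i j r = (g' j r - g' j (r + Pi.single i 1)) - (g' i r - g' i (r + Pi.single j 1)) := by
      intro i j hi hj r
      by_cases hik : i.val < k
      · exact key i j hik hj r
      by_cases hjk : j.val < k
      · rw [hρ'anti, key j i hjk hi r]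
        ring
      · have : i = j := Fin.ext (by omega)
        subst this
        have h := hρ'anti i i r
        have : ρ' i i r = 0 := by linear_combination h / 2
        rw [this]
        ring
    intro i j hi hj r
    have := key' i j hi hj r
    simp only [ρ'] at this
    linear_combination this

/-- Vanishing of the second cohomology with supports, when the antisymmetrization of the cocycle
vanishes. -/
theorem exists_cochain_one_of_symmetric (β : (Fin n → ℕ) → ℂ) (hβ₀ : β 0 = 1)
    (hβ : ∀ p q, β (p + q) = β p * β q) (S : (Fin n → ℕ) → Prop) (hS : ∀ p q, p ≤ q → S p → S q)
    (F : (Fin n → ℕ) → (Fin n → ℕ) → ℂ)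
    (zero_left : ∀ q, F 0 q = 0) (zero_right : ∀ p, F p 0 = 0)
    (supp : ∀ p q, F p q ≠ 0 → S (p + q))
    (cocycle : ∀ p q r, F q r - F (p + q) r + F p (q + r) - β r * F p q = 0)
    (hsymm : ∀ i j, F (Pi.single i 1) (Pi.single j 1) = F (Pi.single j 1) (Pi.single i 1)) :
    ∃ G : (Fin n → ℕ) → ℂ, G 0 = 0 ∧ (∀ p, G p ≠ 0 → S p) ∧
      ∀ p q, F p q = G q - G (p + q) + β q * G p := by
  let K : (Fin n → ℕ) → AddSubgroup ℂ := fun p =>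
    { carrier := {a | a ≠ 0 → S p}
      zero_mem' := fun h => absurd rfl h
      add_mem' := fun {a b} ha hb h => by
        by_cases ha0 : a = 0
        · exact hb fun hb0 => h (by rw [ha0, hb0, add_zero])
        · exact ha ha0
      neg_mem' := fun {a} ha h => ha (neg_ne_zero.1 h) }
  -- The lifts with zero second component commute exactly when F is symmetric on the generators.
  obtain ⟨ψ, h0, h1, h2⟩ := exists_cochain_of_commuting_lifts
    (fun q => AddMonoidHom.mulLeft (β q)) F K (fun p f _ => by simp [hβ₀])
    (fun p q f => by simp [hβ, mul_left_comm, mul_assoc]) zero_left zero_right cocycle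
    (fun p q f hf h => hS _ _ le_self_add (hf (right_ne_zero_of_mul h)))
    (fun p q f hf h => hS _ _ le_add_self (hf h)) (fun p q => supp p q) (fun _ => 0)
    (fun i => zero_mem _) (fun i j => by simp [hsymm i j])
  exact ⟨ψ, h0, fun p => h1 p, h2⟩

/-- Vanishing of the third cohomology with supports, when the support condition excludes the sums
of three basis vectors. -/
theorem exists_cochain_two_of_support (β : (Fin n → ℕ) → ℂ) (hβ₀ : β 0 = 1)
    (hβ : ∀ p q, β (p + q) = β p * β q) (S : (Fin n → ℕ) → Prop) (hS : ∀ p q, p ≤ q → S p → S q)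
    (F : (Fin n → ℕ) → (Fin n → ℕ) → (Fin n → ℕ) → ℂ)
    (zero_left : ∀ q r, F 0 q r = 0) (zero_mid : ∀ p r, F p 0 r = 0)
    (zero_right : ∀ p q, F p q 0 = 0) (supp : ∀ p q r, F p q r ≠ 0 → S (p + q + r))
    (cocycle : ∀ p q r s, F q r s - F (p + q) r s + F p (q + r) s - F p q (r + s)
      + β s * F p q r = 0)
    (hS₃ : ∀ i j k : Fin n, i ≠ j → i ≠ k → j ≠ k →
      ¬ S (Pi.single i 1 + Pi.single j 1 + Pi.single k 1)) :
    ∃ G : (Fin n → ℕ) → (Fin n → ℕ) → ℂ, (∀ q, G 0 q = 0) ∧ (∀ p, G p 0 = 0) ∧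
      (∀ p q, G p q ≠ 0 → S (p + q)) ∧
      ∀ p q r, F p q r = G q r - G (p + q) r + G p (q + r) - β r * G p q := by
  let K : (Fin n → ℕ) → AddSubgroup ((Fin n → ℕ) → ℂ) := fun p =>
    { carrier := {f | f 0 = 0 ∧ ∀ r, f r ≠ 0 → S (p + r)}
      zero_mem' := ⟨rfl, fun r h => absurd rfl h⟩
      add_mem' := fun {f g} hf hg => ⟨by simp [hf.1, hg.1], fun r h => by
        by_cases hf0 : f r = 0
        · exact hg.2 r fun hg0 => h (by simp [hf0, hg0])
        · exact hf.2 r hf0⟩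
      neg_mem' := fun {f} hf => ⟨by simp [hf.1], fun r h => hf.2 r (neg_ne_zero.1 h)⟩ }
  -- Dimension shift: with the last argument as a parameter, the three-cocycle becomes a two-cocycle
  -- with values in functions of that argument.
  let act : (Fin n → ℕ) → ((Fin n → ℕ) → ℂ) →+ ((Fin n → ℕ) → ℂ) := fun q =>
    { toFun := fun f r => f (q + r) - β r * f q
      map_zero' := by
        ext r
        simp
      map_add' := fun f g => by
        ext r
        simp only [Pi.add_apply]
        ring }
  have act_apply : ∀ q f r, act q f r = f (q + r) - β r * f q := fun _ _ _ => rfl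
  -- Commuting lifts exist once ρ is the difference differential of some g.
  let ρ : Fin n → Fin n → (Fin n → ℕ) → ℂ := fun i j r =>
    F (Pi.single i 1) (Pi.single j 1) r - F (Pi.single j 1) (Pi.single i 1) r
  -- This full antisymmetrization is the only obstruction to ρ being closed. It sits at e_i + e_j +
  -- e_k, which the support hypothesis excludes for distinct indices; for repeated ones it cancels.
  have hκ : ∀ i j k : Fin n, F (Pi.single i 1) (Pi.single j 1) (Pi.single k 1)
      - F (Pi.single j 1) (Pi.single i 1) (Pi.single k 1)
      + (F (Pi.single j 1) (Pi.single k 1) (Pi.single i 1)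
        - F (Pi.single k 1) (Pi.single j 1) (Pi.single i 1))
      + (F (Pi.single k 1) (Pi.single i 1) (Pi.single j 1)
        - F (Pi.single i 1) (Pi.single k 1) (Pi.single j 1)) = 0 := by
    intro i j k
    by_cases hij : i = j
    · subst hij
      ring
    by_cases hik : i = k
    · subst hik
      ring
    by_cases hjk : j = k
    · subst hjk
      ring
    have hz : ∀ p q r, p + q + r = Pi.single i 1 + Pi.single j 1 + Pi.single k 1 →
        F p q r = 0 := by
      intro p q r h
      by_contra hne
      have := supp p q r hne
      rw [h] at this
      exact hS₃ i j k hij hik hjk this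
    rw [hz _ _ _ rfl, hz _ _ _ (by abel), hz _ _ _ (by abel), hz _ _ _ (by abel),
      hz _ _ _ (by abel), hz _ _ _ (by abel)]
    ring
  obtain ⟨g, hgS, hgρ⟩ := exists_difference_primitive S hS ρ (fun i j r => by simp [ρ])
    (fun i j k r => by
      have c1 := cocycle (Pi.single i 1) (Pi.single j 1) (Pi.single k 1) r
      have c2 := cocycle (Pi.single j 1) (Pi.single k 1) (Pi.single i 1) r
      have c3 := cocycle (Pi.single k 1) (Pi.single i 1) (Pi.single j 1) r
      have c4 := cocycle (Pi.single j 1) (Pi.single i 1) (Pi.single k 1) r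
      have c5 := cocycle (Pi.single k 1) (Pi.single j 1) (Pi.single i 1) r
      have c6 := cocycle (Pi.single i 1) (Pi.single k 1) (Pi.single j 1) r
      have hk := hκ i j k
      simp only [ρ]
      rw [add_comm (Pi.single j 1) (Pi.single i 1)] at c4
      rw [add_comm (Pi.single k 1) (Pi.single j 1), add_comm (Pi.single j 1) (Pi.single i 1)] at c5
      rw [add_comm (Pi.single i 1) (Pi.single k 1), add_comm (Pi.single k 1) (Pi.single j 1)] at c6
      rw [add_comm (Pi.single k 1) (Pi.single i 1)] at c2
      rw [add_comm r (Pi.single i 1), add_comm r (Pi.single j 1), add_comm r (Pi.single k 1)]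
      rw [add_comm (Pi.single k 1) (Pi.single i 1)] at c3 c6
      linear_combination c1 + c2 + c3 - c4 - c5 - c6 - β r * hk)
    (fun i j r h => by
      by_contra hne
      have hz : ∀ p q, p + q + r = r + Pi.single i 1 + Pi.single j 1 → F p q r = 0 := by
        intro p q h
        by_contra hF
        have := supp p q r hF
        rw [h] at this
        exact hne this
      simp only [ρ] at h
      rw [hz _ _ (by abel), hz _ _ (by abel)] at h
      simp at h)
  have hρ0 : ∀ i j, ρ i j 0 = 0 := fun i j => by simp [ρ, zero_right]
  obtain ⟨ψ, h0, h1, h2⟩ := exists_cochain_of_commuting_lifts act F K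
    (fun p f hf => by
      ext r
      rw [act_apply, hf.1]
      simp)
    (fun p q f => by
      ext r
      simp only [act_apply, hβ, add_assoc]
      ring)
    (fun q => by
      ext r
      exact zero_left q r)
    (fun p => by
      ext r
      exact zero_mid p r)
    (fun p q r => by
      ext s
      simp only [Pi.sub_apply, Pi.add_apply, act_apply, Pi.zero_apply]
      linear_combination cocycle p q r s)
    (fun p q f hf => ⟨by simp [act_apply, hβ₀], fun r h => by
      rw [act_apply] at h
      by_cases h1 : f (q + r) = 0
      · have h2 : f q ≠ 0 := by
          rintro h2
          simp [h1, h2] at h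
        exact hS _ _ le_self_add (hf.2 q h2)
      · rw [add_assoc]
        exact hf.2 _ h1⟩)
    (fun p q f hf => ⟨hf.1, fun r h => hS (q + r) _ (by rw [add_assoc]; exact le_add_self)
      (hf.2 r h)⟩)
    (fun p q => ⟨zero_right p q, fun r h => supp p q r h⟩)
    -- The subtracted term makes the lift vanish at r = 0, as membership in `K` requires; since ρ
    -- vanishes at 0, commutation is not affected.
    (fun i r => g i r - β r * g i 0)
    (fun i => ⟨by simp [hβ₀], fun r h => by
      by_cases h1 : g i r = 0
      · have h2 : g i 0 ≠ 0 := by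
          rintro h2
          simp [h1, h2] at h
        have := hgS i 0 h2
        rw [zero_add] at this
        exact hS _ _ le_self_add this
      · rw [add_comm]
        exact hgS i r h1⟩)
    (fun i j => by
      ext r
      simp only [Pi.sub_apply, Pi.add_apply, act_apply, hβ]
      have e1 := hgρ i j r
      have e2 := hgρ i j 0
      rw [hρ0, zero_add, zero_add] at e2
      simp only [ρ] at e1
      rw [add_comm (Pi.single j 1) r, add_comm (Pi.single i 1) r]
      linear_combination -e1 + β r * e2)
  refine ⟨ψ, fun q => congrFun h0 q, fun p => (h1 p).1, fun p q => (h1 p).2 q, fun p q r => ?_⟩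
  have := congrFun (h2 p q) r
  simp only [Pi.sub_apply, Pi.add_apply, act_apply] at this
  linear_combination this

/-- Vanishing of the second cohomology with supports for a nontrivial character. -/
theorem exists_cochain_one_of_character (β : (Fin n → ℕ) → ℂ) (S : (Fin n → ℕ) → Prop)
    {x : Fin n → ℕ} (hx : β x ≠ 1)
    (hSx : ∀ p, S (p + x) → S p) (F : (Fin n → ℕ) → (Fin n → ℕ) → ℂ)
    (zero_left : ∀ q, F 0 q = 0) (zero_right : ∀ p, F p 0 = 0)
    (supp : ∀ p q, F p q ≠ 0 → S (p + q))
    (cocycle : ∀ p q r, F q r - F (p + q) r + F p (q + r) - β r * F p q = 0) :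
    ∃ G : (Fin n → ℕ) → ℂ, G 0 = 0 ∧ (∀ p, G p ≠ 0 → S p) ∧
      ∀ p q, F p q = G q - G (p + q) + β q * G p := by
  have hne : 1 - β x ≠ 0 := sub_ne_zero.2 (Ne.symm hx)
  -- Inserting x in every slot with alternating signs is a homotopy between multiplication by 1 − β
  -- x and zero. The hypothesis `hSx` removes the inserted x from the support condition.
  refine ⟨fun p => (F x p - F p x) / (1 - β x), by simp [zero_left, zero_right], ?_, ?_⟩
  · intro p h
    by_cases h1 : F x p = 0
    · refine hSx p (supp p x fun h2 => h ?_)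
      simp [h1, h2]
    · have := supp x p h1
      rw [add_comm] at this
      exact hSx p this
  · intro p q
    have c1 := cocycle x p q
    have c2 := cocycle p x q
    have c3 := cocycle p q x
    rw [add_comm x p] at c1
    rw [add_comm x q] at c2
    field_simp
    linear_combination c1 - c2 + c3

/-- Vanishing of the third cohomology with supports for a nontrivial character. -/
theorem exists_cochain_two_of_character (β : (Fin n → ℕ) → ℂ) (S : (Fin n → ℕ) → Prop)
    {x : Fin n → ℕ} (hx : β x ≠ 1)
    (hSx : ∀ p, S (p + x) → S p) (F : (Fin n → ℕ) → (Fin n → ℕ) → (Fin n → ℕ) → ℂ)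
    (zero_left : ∀ q r, F 0 q r = 0) (zero_mid : ∀ p r, F p 0 r = 0)
    (zero_right : ∀ p q, F p q 0 = 0) (supp : ∀ p q r, F p q r ≠ 0 → S (p + q + r))
    (cocycle : ∀ p q r s, F q r s - F (p + q) r s + F p (q + r) s - F p q (r + s)
      + β s * F p q r = 0) :
    ∃ G : (Fin n → ℕ) → (Fin n → ℕ) → ℂ, (∀ q, G 0 q = 0) ∧ (∀ p, G p 0 = 0) ∧
      (∀ p q, G p q ≠ 0 → S (p + q)) ∧
      ∀ p q r, F p q r = G q r - G (p + q) r + G p (q + r) - β r * G p q := by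
  have hne : 1 - β x ≠ 0 := sub_ne_zero.2 (Ne.symm hx)
  refine ⟨fun p q => (F x p q - F p x q + F p q x) / (1 - β x),
    by simp [zero_left, zero_mid], by simp [zero_mid, zero_right], ?_, ?_⟩
  · intro p q h
    apply hSx
    by_contra hcon
    have hz : ∀ a b c, a + b + c = p + q + x → F a b c = 0 := by
      intro a b c habc
      by_contra hF
      have := supp a b c hF
      rw [habc] at this
      exact hcon this
    simp only at h
    rw [hz x p q (by abel), hz p x q (by abel), hz p q x rfl] at h
    simp at h
  · intro p q r
    have c1 := cocycle x p q r
    have c2 := cocycle p x q r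
    have c3 := cocycle p q x r
    have c4 := cocycle p q r x
    rw [add_comm x p] at c1
    rw [add_comm x q] at c2
    rw [add_comm x r] at c3
    field_simp
    linear_combination c1 - c2 + c3 - c4

end Cohomology

/-! ### Weight systems and the induced filtrations -/

section WeightSystem

variable {n : ℕ}

/-- The integral vector underlying an exponent vector. -/
def intVec (p : Fin n → ℕ) : Fin n → ℤ := fun i => (p i : ℤ)

@[simp] theorem intVec_apply (p : Fin n → ℕ) (i : Fin n) : intVec p i = (p i : ℤ) := rfl

@[simp] theorem intVec_add (p q : Fin n → ℕ) : intVec (p + q) = intVec p + intVec q := by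
  ext i
  simp

@[simp] theorem intVec_zero : intVec (0 : Fin n → ℕ) = 0 := by
  ext i
  simp

@[simp] theorem intVec_single (i : Fin n) :
    intVec (Pi.single i 1 : Fin n → ℕ) = Pi.single i 1 := by
  ext j
  by_cases h : j = i
  · subst h
    simp
  · simp [h]

theorem intVec_nonneg (p : Fin n → ℕ) : 0 ≤ intVec p := fun i => by simp

theorem intVec_injective : Function.Injective (intVec : (Fin n → ℕ) → Fin n → ℤ) := by
  intro p q h
  ext i
  have := congrFun h i
  simpa using this

/-- The exponent vector underlying a nonnegative integral vector. -/
def natVec (v : Fin n → ℤ) : Fin n → ℕ := fun i => (v i).toNat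

theorem intVec_natVec {v : Fin n → ℤ} (hv : 0 ≤ v) : intVec (natVec v) = v := by
  ext i
  simpa [natVec] using hv i

@[simp] theorem natVec_intVec (p : Fin n → ℕ) : natVec (intVec p) = p := by
  ext i
  simp [natVec]

/-- A family of weights, graded by levels, which is closed under addition. -/
structure WeightSystem (n : ℕ) where
  level : ℕ → Set (Fin n → ℤ)
  zero_mem : 0 ∈ level 0
  add_mem : ∀ {u v : Fin n → ℤ} {k m : ℕ}, u ∈ level k → v ∈ level m → u + v ∈ level (k + m)
  sum_eq_zero : ∀ {w : Fin n → ℤ} {m : ℕ}, w ∈ level m → ∑ i, w i = 0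
  height : (Fin n → ℤ) →+ ℝ
  height_eq : ∀ {w : Fin n → ℤ} {m : ℕ}, w ∈ level m → height w = m

namespace WeightSystem

variable (W : WeightSystem n)

theorem level_unique {w : Fin n → ℤ} {k m : ℕ} (hk : w ∈ W.level k) (hm : w ∈ W.level m) :
    k = m := by
  have := (W.height_eq hk).symm.trans (W.height_eq hm)
  exact_mod_cast this

/-- A bound for the heights of the basis vectors. -/
noncomputable def heightBound : ℝ := ∑ i, |W.height (Pi.single i 1)|

/-- The largest level that can possibly occur above a given exponent vector. -/
noncomputable def depth (p : Fin n → ℕ) : ℕ :=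
  ⌊∑ i, (p i : ℝ) * (W.heightBound - W.height (Pi.single i 1))⌋₊

theorem height_le_heightBound (i : Fin n) : W.height (Pi.single i 1) ≤ W.heightBound :=
  (le_abs_self _).trans
    (Finset.single_le_sum (f := fun i => |W.height (Pi.single i 1)|) (fun _ _ => abs_nonneg _)
      (Finset.mem_univ i))

theorem height_eq_sum (v : Fin n → ℤ) : W.height v = ∑ i, (v i : ℝ) * W.height (Pi.single i 1) := by
  have h : v = ∑ i, v i • Pi.single i (1 : ℤ) := by
    ext j
    simp [Finset.sum_apply, Pi.single_apply]
  conv_lhs => rw [h, map_sum]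
  exact Finset.sum_congr rfl fun i _ => by rw [map_zsmul, zsmul_eq_mul]

theorem depth_mono {p q : Fin n → ℕ} (h : p ≤ q) : W.depth p ≤ W.depth q := by
  apply Nat.floor_le_floor
  refine Finset.sum_le_sum fun i _ => ?_
  refine mul_le_mul_of_nonneg_right ?_ (sub_nonneg.2 (W.height_le_heightBound i))
  exact_mod_cast h i

theorem sum_eq_of_sub_mem {p s : Fin n → ℕ} {k : ℕ} (h : intVec s - intVec p ∈ W.level k) :
    ∑ i, s i = ∑ i, p i := by
  have := W.sum_eq_zero h
  simp only [Pi.sub_apply, intVec_apply, Finset.sum_sub_distrib] at this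
  have h2 : ((∑ i, s i : ℕ) : ℤ) = ((∑ i, p i : ℕ) : ℤ) := by
    push_cast
    omega
  exact_mod_cast h2

/-- The sum under the floor is linear and nonnegative on exponent vectors. A weight of level k keeps
the total degree and raises the height by k, so it lowers this sum by exactly k. Hence only finitely
many levels occur above a monomial. -/
theorem depth_add_le {p s : Fin n → ℕ} {k : ℕ} (h : intVec s - intVec p ∈ W.level k) :
    W.depth s + k ≤ W.depth p := by
  have h1 := W.height_eq h
  have h2 : ((∑ i, s i : ℕ) : ℝ) = ((∑ i, p i : ℕ) : ℝ) := by rw [W.sum_eq_of_sub_mem h]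
  have h3 : ∑ i, (p i : ℝ) * (W.heightBound - W.height (Pi.single i 1)) =
      ∑ i, (s i : ℝ) * (W.heightBound - W.height (Pi.single i 1)) + k := by
    rw [map_sub, W.height_eq_sum (intVec s), W.height_eq_sum (intVec p)] at h1
    simp only [intVec_apply, Int.cast_natCast] at h1
    push_cast at h2
    simp only [mul_sub, Finset.sum_sub_distrib, ← Finset.sum_mul]
    rw [h2]
    linarith
  have hnn : 0 ≤ ∑ i, (s i : ℝ) * (W.heightBound - W.height (Pi.single i 1)) :=
    Finset.sum_nonneg fun i _ =>
      mul_nonneg (Nat.cast_nonneg _) (sub_nonneg.2 (W.height_le_heightBound i))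
  rw [depth, depth, h3, Nat.floor_add_natCast hnn]

/-! ### Filtrations by level and leading coefficients -/

section Filtration

variable (R : Type*) [CommRing R]

/-- The span of the monomials whose weight lies above `p` by a weight of level at least `m`. -/
def fil (p : Fin n → ℕ) (m : ℕ) : Submodule R ((Fin n → ℕ) →₀ R) :=
  Finsupp.supported R R {s | ∃ k, m ≤ k ∧ intVec s - intVec p ∈ W.level k}

variable {R}

theorem single_mem_fil {p s : Fin n → ℕ} {k m : ℕ} (hk : m ≤ k)
    (h : intVec s - intVec p ∈ W.level k) (a : R) : Finsupp.single s a ∈ W.fil R p m :=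
  Finsupp.single_mem_supported R a ⟨k, hk, h⟩

theorem single_self_mem_fil (p : Fin n → ℕ) (a : R) : Finsupp.single p a ∈ W.fil R p 0 :=
  W.single_mem_fil le_rfl (by simpa using W.zero_mem) a

theorem eq_zero_or_of_mem_fil {p : Fin n → ℕ} {m : ℕ} {x : (Fin n → ℕ) →₀ R}
    (hx : x ∈ W.fil R p m) (s : Fin n → ℕ) :
    x s = 0 ∨ ∃ k, m ≤ k ∧ intVec s - intVec p ∈ W.level k := by
  by_cases h : x s = 0
  · exact Or.inl h
  · exact Or.inr ((Finsupp.mem_supported R x).1 hx (Finsupp.mem_support_iff.2 h))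

theorem map_mem_of_mem_fil {N : Type*} [AddCommGroup N] [Module R N]
    (f : ((Fin n → ℕ) →₀ R) →ₗ[R] N) (K : Submodule R N) {p : Fin n → ℕ} {m : ℕ}
    (h : ∀ s k, m ≤ k → intVec s - intVec p ∈ W.level k → f (Finsupp.single s 1) ∈ K)
    {x : (Fin n → ℕ) →₀ R} (hx : x ∈ W.fil R p m) : f x ∈ K := by
  have hs : x = x.sum fun s a => a • Finsupp.single s (1 : R) := by
    conv_lhs => rw [← Finsupp.sum_single x]
    simp
  rw [hs, Finsupp.sum, map_sum]
  refine Submodule.sum_mem _ fun s hs => ?_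
  rw [map_smul]
  obtain ⟨k, hk, hk'⟩ := (Finsupp.mem_supported R x).1 hx hs
  exact K.smul_mem _ (h s k hk hk')

theorem fil_le {p s : Fin n → ℕ} {k m a : ℕ} (h : intVec s - intVec p ∈ W.level k)
    (ha : a ≤ k + m) : W.fil R s m ≤ W.fil R p a := by
  refine Finsupp.supported_mono ?_
  rintro t ⟨l, hl, ht⟩
  refine ⟨k + l, by omega, ?_⟩
  have := W.add_mem h ht
  rwa [show intVec s - intVec p + (intVec t - intVec s) = intVec t - intVec p by abel] at this

theorem fil_anti (p : Fin n → ℕ) {a m : ℕ} (ha : a ≤ m) : W.fil R p m ≤ W.fil R p a :=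
  W.fil_le (by simpa using W.zero_mem) (by omega)

theorem fil_eq_bot {p : Fin n → ℕ} {m : ℕ} (h : W.depth p < m) : W.fil R p m = ⊥ := by
  rw [fil, show {s | ∃ k, m ≤ k ∧ intVec s - intVec p ∈ W.level k} = ∅ from ?_,
    Finsupp.supported_empty]
  ext s
  simp only [Set.mem_ofPred_eq, Set.mem_empty_iff_false, iff_false, not_exists, not_and]
  intro k hk hs
  have := W.depth_add_le hs
  omega

variable (R) in
/-- The coefficient at an integral vector. -/
noncomputable def coef (v : Fin n → ℤ) : ((Fin n → ℕ) →₀ R) →ₗ[R] R :=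
  open Classical in if 0 ≤ v then Finsupp.lapply (natVec v) else 0

theorem coef_intVec (s : Fin n → ℕ) (x : (Fin n → ℕ) →₀ R) : coef R (intVec s) x = x s := by
  simp [coef, intVec_nonneg]

theorem coef_of_not_nonneg {v : Fin n → ℤ} (hv : ¬ 0 ≤ v) (x : (Fin n → ℕ) →₀ R) :
    coef R v x = 0 := by
  simp [coef, hv]

theorem coef_single (v : Fin n → ℤ) (s : Fin n → ℕ) (a : R) [Decidable (intVec s = v)] :
    coef R v (Finsupp.single s a) = if intVec s = v then a else 0 := by
  by_cases hv : 0 ≤ v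
  · obtain ⟨t, rfl⟩ : ∃ t, v = intVec t := ⟨natVec v, (intVec_natVec hv).symm⟩
    classical
    rw [coef_intVec, Finsupp.single_apply]
    simp only [intVec_injective.eq_iff]
  · rw [coef_of_not_nonneg hv, if_neg]
    rintro rfl
    exact hv (intVec_nonneg s)

/-- The height determines the level of a weight, so coefficients of level k do not see terms of
larger level. All comparisons of leading terms rest on this. -/
theorem coef_eq_zero {p : Fin n → ℕ} {k m : ℕ} (hkm : k < m) {w : Fin n → ℤ} (hw : w ∈ W.level k)
    {x : (Fin n → ℕ) →₀ R} (hx : x ∈ W.fil R p m) : coef R (intVec p + w) x = 0 := by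
  classical
  refine (Submodule.mem_bot R).1 (W.map_mem_of_mem_fil _ ⊥ (fun s l hl hs => ?_) hx)
  rw [coef_single, if_neg]
  · exact Submodule.zero_mem _
  · intro h
    rw [h, add_sub_cancel_left] at hs
    have := W.level_unique hw hs
    omega

theorem mem_fil_succ {p : Fin n → ℕ} {m : ℕ} {x : (Fin n → ℕ) →₀ R} (hx : x ∈ W.fil R p m)
    (h : ∀ w ∈ W.level m, coef R (intVec p + w) x = 0) : x ∈ W.fil R p (m + 1) := by
  rw [fil, Finsupp.mem_supported]
  intro s hs
  obtain ⟨k, hk, hk'⟩ := (Finsupp.mem_supported R x).1 hx hs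
  refine ⟨k, ?_, hk'⟩
  by_contra hlt
  have : k = m := by omega
  subst this
  have := h _ hk'
  rw [add_sub_cancel, coef_intVec] at this
  exact Finsupp.mem_support_iff.1 hs this

/-- There are elements with prescribed coefficients of a given level. -/
theorem exists_mem_fil_coef (p : Fin n → ℕ) (m : ℕ) (c : (Fin n → ℤ) → R)
    (hc : ∀ w, c w ≠ 0 → 0 ≤ intVec p + w) :
    ∃ x ∈ W.fil R p m, ∀ w ∈ W.level m, coef R (intVec p + w) x = c w := by
  classical
  let f : (Fin n → ℕ) → R := fun s =>
    if intVec s - intVec p ∈ W.level m then c (intVec s - intVec p) else 0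
  -- Weights preserve the total degree, which confines the support to a finite box.
  have hf : ∀ s, f s ≠ 0 → s ∈ Finset.Iic (fun _ : Fin n => ∑ i, p i) := by
    intro s hs
    have hs' : intVec s - intVec p ∈ W.level m := by
      by_contra h
      simp [f, h] at hs
    rw [Finset.mem_Iic]
    intro i
    rw [← W.sum_eq_of_sub_mem hs']
    exact Finset.single_le_sum (f := s) (fun _ _ => Nat.zero_le _) (Finset.mem_univ i)
  refine ⟨Finsupp.onFinset _ f hf, ?_, fun w hw => ?_⟩
  · rw [fil, Finsupp.mem_supported]
    intro s hs
    refine ⟨m, le_rfl, ?_⟩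
    by_contra h
    have : f s ≠ 0 := by simpa using hs
    simp [f, h] at this
  · by_cases hv : 0 ≤ intVec p + w
    · rw [← intVec_natVec hv, coef_intVec, Finsupp.onFinset_apply]
      simp [f, intVec_natVec hv, hw]
    · rw [coef_of_not_nonneg hv]
      by_contra h
      exact hv (hc w (Ne.symm h))

/-- A family of vectors which is unitriangular with respect to the filtration is linearly
independent. -/
theorem linearCombination_injective (v : (Fin n → ℕ) → (Fin n → ℕ) →₀ R)
    (hv : ∀ p, v p - Finsupp.single p 1 ∈ W.fil R p 1) :
    Function.Injective (Finsupp.linearCombination R v) := by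
  rw [injective_iff_map_eq_zero]
  intro x hx
  by_contra hne
  -- At a support point p of maximal depth only `v p` contributes to the coefficient of p, because
  -- any other `v s` reaching p would need s of larger depth.
  obtain ⟨p, hp, hmax⟩ := Finset.exists_max_image x.support W.depth
    (Finsupp.support_nonempty_iff.2 hne)
  have h1 : Finsupp.linearCombination R v x p = 0 := by
    rw [hx]
    rfl
  rw [Finsupp.linearCombination_apply, Finsupp.sum, Finsupp.finsetSum_apply,
    Finset.sum_eq_single_of_mem p hp] at h1
  · have h2 : v p p = 1 := by
      rcases W.eq_zero_or_of_mem_fil (hv p) p with h | ⟨k, hk, h⟩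
      · rw [Finsupp.sub_apply, Finsupp.single_eq_same] at h
        exact sub_eq_zero.1 h
      · rw [sub_self] at h
        have := W.level_unique h W.zero_mem
        omega
    rw [Finsupp.smul_apply, h2, smul_eq_mul, mul_one] at h1
    exact Finsupp.mem_support_iff.1 hp h1
  · intro s hs hsp
    have h2 : v s p = 0 := by
      rcases W.eq_zero_or_of_mem_fil (hv s) p with h | ⟨k, hk, h⟩
      · rw [Finsupp.sub_apply, Finsupp.single_eq_of_ne hsp.symm] at h
        exact sub_eq_zero.1 h
      · have h3 := W.depth_add_le h
        have h4 := hmax s hs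
        exfalso
        omega
    rw [Finsupp.smul_apply, h2, smul_zero]

end Filtration

end WeightSystem

end WeightSystem

/-! ### The bicharacter of a skew polynomial ring -/

section Twist

variable {n : ℕ} (L : Matrix (Fin n) (Fin n) ℂ)

/-- The bilinear exponent of the bicharacter relating products of sorted monomials to sorted
monomials. -/
noncomputable def twist (u v : Fin n → ℤ) : ℂ :=
  ∑ i, ∑ j, if j < i then L i j * u i * v j else 0

theorem twist_add_left (u u' v : Fin n → ℤ) : twist L (u + u') v = twist L u v + twist L u' v := by
  simp only [twist, ← Finset.sum_add_distrib]
  refine Finset.sum_congr rfl fun i _ => Finset.sum_congr rfl fun j _ => ?_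
  split_ifs
  · simp only [Pi.add_apply]
    push_cast
    ring
  · simp

theorem twist_add_right (u v v' : Fin n → ℤ) : twist L u (v + v') = twist L u v + twist L u v' := by
  simp only [twist, ← Finset.sum_add_distrib]
  refine Finset.sum_congr rfl fun i _ => Finset.sum_congr rfl fun j _ => ?_
  split_ifs
  · simp only [Pi.add_apply]
    push_cast
    ring
  · simp

@[simp] theorem twist_zero_left (v : Fin n → ℤ) : twist L 0 v = 0 := by
  simp [twist]

@[simp] theorem twist_zero_right (u : Fin n → ℤ) : twist L u 0 = 0 := by
  simp [twist]

theorem twist_single_single (i j : Fin n) :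
    twist L (Pi.single i 1) (Pi.single j 1) = if j < i then L i j else 0 := by
  rw [twist, Finset.sum_eq_single i, Finset.sum_eq_single j]
  · simp
  · intro k _ hk
    simp [hk]
  · simp
  · intro k _ hk
    simp [hk]
  · simp

/-- The character by which the commutation relations act on a monomial of weight `w`. -/
noncomputable def twistChar (w : Fin n → ℤ) (r : Fin n → ℕ) : ℂ :=
  Complex.exp (twist L w (intVec r) - twist L (intVec r) w)

theorem twistChar_zero (w : Fin n → ℤ) : twistChar L w 0 = 1 := by
  simp [twistChar]

theorem twistChar_add (w : Fin n → ℤ) (p q : Fin n → ℕ) :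
    twistChar L w (p + q) = twistChar L w p * twistChar L w q := by
  rw [twistChar, twistChar, twistChar, ← Complex.exp_add]
  congr 1
  rw [intVec_add, twist_add_left, twist_add_right]
  ring

/-- A weight is rigid if it carries no cohomology in the degrees that matter for deformations. -/
def IsRigid (w : Fin n → ℤ) : Prop :=
  (∃ i, 0 ≤ w i ∧ twistChar L w (Pi.single i 1) ≠ 1) ∨
    ((∀ i j : Fin n, i ≠ j → ¬ 0 ≤ intVec (Pi.single i 1 + Pi.single j 1) + w) ∧
      ∀ i j k : Fin n, i ≠ j → i ≠ k → j ≠ k →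
        ¬ 0 ≤ intVec (Pi.single i 1 + Pi.single j 1 + Pi.single k 1) + w)

theorem nonneg_add_of_le {w : Fin n → ℤ} {p q : Fin n → ℕ} (h : p ≤ q) (hp : 0 ≤ intVec p + w) :
    0 ≤ intVec q + w := by
  intro i
  have h1 := hp i
  have h2 := h i
  simp only [Pi.zero_apply, Pi.add_apply, intVec_apply] at h1 ⊢
  have h3 : (p i : ℤ) ≤ q i := by exact_mod_cast h2
  linarith

/-- Supplies the support hypothesis of the character homotopies: at an index with w_i ≥ 0 no help
from e_i is needed. -/
theorem nonneg_add_of_add_single {w : Fin n → ℤ} {p : Fin n → ℕ} {i : Fin n} (hi : 0 ≤ w i)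
    (hp : 0 ≤ intVec (p + Pi.single i 1) + w) : 0 ≤ intVec p + w := by
  intro k
  have h1 := hp k
  by_cases hk : k = i
  · subst hk
    simp only [Pi.zero_apply, Pi.add_apply, intVec_apply]
    omega
  · simpa [hk] using h1

/-- The two alternatives in `IsRigid` are the two mechanisms of vanishing: a nontrivial character,
or a support too small to carry a class. -/
theorem IsRigid.exists_cochain_two {L : Matrix (Fin n) (Fin n) ℂ} {w : Fin n → ℤ}
    (hw : IsRigid L w) (F : (Fin n → ℕ) → (Fin n → ℕ) → (Fin n → ℕ) → ℂ)
    (zero_left : ∀ q r, F 0 q r = 0) (zero_mid : ∀ p r, F p 0 r = 0)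
    (zero_right : ∀ p q, F p q 0 = 0) (supp : ∀ p q r, F p q r ≠ 0 → 0 ≤ intVec (p + q + r) + w)
    (cocycle : ∀ p q r s, F q r s - F (p + q) r s + F p (q + r) s - F p q (r + s)
      + twistChar L w s * F p q r = 0) :
    ∃ G : (Fin n → ℕ) → (Fin n → ℕ) → ℂ, (∀ q, G 0 q = 0) ∧ (∀ p, G p 0 = 0) ∧
      (∀ p q, G p q ≠ 0 → 0 ≤ intVec (p + q) + w) ∧
      ∀ p q r, F p q r = G q r - G (p + q) r + G p (q + r) - twistChar L w r * G p q := by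
  rcases hw with ⟨i, hi, hχ⟩ | ⟨_, h3⟩
  · exact exists_cochain_two_of_character (twistChar L w) (fun p => 0 ≤ intVec p + w) hχ
      (fun p hp => nonneg_add_of_add_single hi hp) F zero_left zero_mid zero_right supp cocycle
  · exact exists_cochain_two_of_support (twistChar L w) (twistChar_zero L w) (twistChar_add L w)
      (fun p => 0 ≤ intVec p + w) (fun p q h hp => nonneg_add_of_le h hp) F zero_left zero_mid
      zero_right supp cocycle h3

theorem IsRigid.exists_cochain_one {L : Matrix (Fin n) (Fin n) ℂ} {w : Fin n → ℤ}
    (hw : IsRigid L w) (F : (Fin n → ℕ) → (Fin n → ℕ) → ℂ)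
    (zero_left : ∀ q, F 0 q = 0) (zero_right : ∀ p, F p 0 = 0)
    (supp : ∀ p q, F p q ≠ 0 → 0 ≤ intVec (p + q) + w)
    (cocycle : ∀ p q r, F q r - F (p + q) r + F p (q + r) - twistChar L w r * F p q = 0) :
    ∃ G : (Fin n → ℕ) → ℂ, G 0 = 0 ∧ (∀ p, G p ≠ 0 → 0 ≤ intVec p + w) ∧
      ∀ p q, F p q = G q - G (p + q) + twistChar L w q * G p := by
  rcases hw with ⟨i, hi, hχ⟩ | ⟨h2, _⟩
  · exact exists_cochain_one_of_character (twistChar L w) (fun p => 0 ≤ intVec p + w) hχ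
      (fun p hp => nonneg_add_of_add_single hi hp) F zero_left zero_right supp cocycle
  · refine exists_cochain_one_of_symmetric (twistChar L w) (twistChar_zero L w)
      (twistChar_add L w) (fun p => 0 ≤ intVec p + w) (fun p q h hp => nonneg_add_of_le h hp) F
      zero_left zero_right supp cocycle fun i j => ?_
    by_cases hij : i = j
    · rw [hij]
    · rw [not_not.1 (mt (supp _ _) (h2 i j hij)),
        not_not.1 (mt (supp _ _) (h2 j i (Ne.symm hij)))]

end Twist

/-! ### Products on the space of sorted monomials -/

namespace WeightSystem

variable {n : ℕ} (W : WeightSystem n)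

/-! ### Filtered linear and bilinear maps -/

section Linear

variable {R : Type*} [CommRing R]

theorem apply_mem_fil {f : ((Fin n → ℕ) →₀ R) →ₗ[R] ((Fin n → ℕ) →₀ R)} {r : Fin n → ℕ} {c : ℕ}
    (h : ∀ s, f (Finsupp.single s 1) ∈ W.fil R (s + r) c) {p : Fin n → ℕ} {a : ℕ}
    {x : (Fin n → ℕ) →₀ R} (hx : x ∈ W.fil R p a) : f x ∈ W.fil R (p + r) (a + c) := by
  refine W.map_mem_of_mem_fil f _ (fun s k hk hs => ?_) hx
  refine W.fil_le (k := k) ?_ (by omega) (h s)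
  rwa [intVec_add, intVec_add, add_sub_add_right_eq_sub]

theorem apply_apply_mem_fil
    {C : ((Fin n → ℕ) →₀ R) →ₗ[R] ((Fin n → ℕ) →₀ R) →ₗ[R] ((Fin n → ℕ) →₀ R)} {c : ℕ}
    (h : ∀ p q, C (Finsupp.single p 1) (Finsupp.single q 1) ∈ W.fil R (p + q) c)
    {p q : Fin n → ℕ} {a b : ℕ} {x y : (Fin n → ℕ) →₀ R} (hx : x ∈ W.fil R p a)
    (hy : y ∈ W.fil R q b) : C x y ∈ W.fil R (p + q) (a + b + c) := by
  have h1 : ∀ s, C.flip y (Finsupp.single s 1) ∈ W.fil R (s + q) (b + c) := by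
    intro s
    rw [LinearMap.flip_apply, add_comm s q]
    exact W.apply_mem_fil (fun t => by rw [add_comm t s]; exact h s t) hy
  have := W.apply_mem_fil h1 hx
  rwa [LinearMap.flip_apply, ← add_assoc] at this

/-- The leading coefficients of the value of a filtered map only depend on the leading term of
the argument. -/
theorem coef_apply_of_leading {f : ((Fin n → ℕ) →₀ R) →ₗ[R] ((Fin n → ℕ) →₀ R)}
    {r : Fin n → ℕ} {m : ℕ}
    (h : ∀ s, f (Finsupp.single s 1) ∈ W.fil R (s + r) m) {p : Fin n → ℕ}
    {x : (Fin n → ℕ) →₀ R} {a : R} (hx : x - a • Finsupp.single p 1 ∈ W.fil R p 1)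
    {w : Fin n → ℤ} (hw : w ∈ W.level m) :
    coef R (intVec (p + r) + w) (f x) =
      a * coef R (intVec (p + r) + w) (f (Finsupp.single p 1)) := by
  have h1 := W.coef_eq_zero (by omega) hw (W.apply_mem_fil h hx)
  rw [map_sub, map_sub, map_smul, map_smul, sub_eq_zero] at h1
  exact h1

end Linear

end WeightSystem

/-- The space of sorted monomials. -/
abbrev MonoSpace (n : ℕ) : Type := (Fin n → ℕ) →₀ ℂ

/-- Bilinear operations on the space of sorted monomials. -/
abbrev MonoProduct (n : ℕ) : Type := MonoSpace n →ₗ[ℂ] MonoSpace n →ₗ[ℂ] MonoSpace n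

/-- The bilinear operation with given values on monomials. -/
noncomputable def monoProduct {n : ℕ} (c : (Fin n → ℕ) → (Fin n → ℕ) → MonoSpace n) :
    MonoProduct n :=
  Finsupp.linearCombination ℂ fun p => Finsupp.linearCombination ℂ (c p)

@[simp] theorem monoProduct_single {n : ℕ} (c : (Fin n → ℕ) → (Fin n → ℕ) → MonoSpace n)
    (p q : Fin n → ℕ) : monoProduct c (Finsupp.single p 1) (Finsupp.single q 1) = c p q := by
  simp [monoProduct]

namespace WeightSystem

variable {n : ℕ} (W : WeightSystem n) (L : Matrix (Fin n) (Fin n) ℂ)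

/-- The product of a skew polynomial ring on sorted monomials. -/
noncomputable def skewProduct : MonoProduct n :=
  monoProduct fun p q => Finsupp.single (p + q) (Complex.exp (twist L (intVec p) (intVec q)))

theorem skewProduct_single (p q : Fin n → ℕ) :
    skewProduct L (Finsupp.single p 1) (Finsupp.single q 1) =
      Complex.exp (twist L (intVec p) (intVec q)) • Finsupp.single (p + q) 1 := by
  simp [skewProduct]

theorem coef_skewProduct_left (p : Fin n → ℕ) (v : Fin n → ℤ) (y : MonoSpace n) :
    coef ℂ (intVec p + v) (skewProduct L (Finsupp.single p 1) y) =
      Complex.exp (twist L (intVec p) v) * coef ℂ v y := by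
  classical
  induction y using Finsupp.induction_linear with
  | zero => simp
  | add x y hx hy => simp only [map_add, hx, hy, mul_add]
  | single q a =>
    rw [← mul_one a, ← smul_eq_mul, ← Finsupp.smul_single, map_smul, map_smul, map_smul,
      skewProduct_single, map_smul, coef_single, coef_single]
    simp only [intVec_add, add_right_inj]
    by_cases h : intVec q = v
    · subst h
      simp
      ring
    · simp [h]

theorem coef_skewProduct_right (q : Fin n → ℕ) (v : Fin n → ℤ) (x : MonoSpace n) :
    coef ℂ (v + intVec q) (skewProduct L x (Finsupp.single q 1)) =
      Complex.exp (twist L v (intVec q)) * coef ℂ v x := by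
  classical
  induction x using Finsupp.induction_linear with
  | zero => simp
  | add x y hx hy => simp only [map_add, LinearMap.add_apply, hx, hy, mul_add]
  | single p a =>
    rw [← mul_one a, ← smul_eq_mul, ← Finsupp.smul_single, map_smul, LinearMap.smul_apply,
      map_smul, map_smul, skewProduct_single, map_smul, coef_single, coef_single]
    simp only [intVec_add, add_left_inj]
    by_cases h : intVec p = v
    · subst h
      simp
      ring
    · simp [h]

/-- A unital filtered deformation of the product of a skew polynomial ring. -/
structure IsStar (B : MonoProduct n) : Prop where
  leading : ∀ p q, B (Finsupp.single p 1) (Finsupp.single q 1)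
    - Complex.exp (twist L (intVec p) (intVec q)) • Finsupp.single (p + q) 1 ∈ W.fil ℂ (p + q) 1
  one_mul : ∀ x, B (Finsupp.single 0 1) x = x
  mul_one : ∀ x, B x (Finsupp.single 0 1) = x

/-- The associator of a bilinear operation. -/
noncomputable def assoc (B : MonoProduct n) (x y z : MonoSpace n) : MonoSpace n :=
  B (B x y) z - B x (B y z)

/-- A formal identity for every bilinear operation; its leading part makes the obstruction a
cocycle. -/
theorem assoc_pentagon (B : MonoProduct n) (x y z t : MonoSpace n) :
    B x (assoc B y z t) - assoc B (B x y) z t + assoc B x (B y z) t - assoc B x y (B z t)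
      + B (assoc B x y z) t = 0 := by
  simp only [assoc, map_sub, LinearMap.sub_apply]
  abel

variable {W L} {B : MonoProduct n}

namespace IsStar

theorem mem_fil (hB : IsStar W L B) (p q : Fin n → ℕ) :
    B (Finsupp.single p 1) (Finsupp.single q 1) ∈ W.fil ℂ (p + q) 0 := by
  have h := (W.fil ℂ (p + q) 0).add_mem (W.fil_anti _ (Nat.zero_le _) (hB.leading p q))
    (Submodule.smul_mem _ (Complex.exp (twist L (intVec p) (intVec q)))
      (W.single_self_mem_fil (p + q) (1 : ℂ)))
  rwa [sub_add_cancel] at h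

theorem sub_skewProduct_mem (hB : IsStar W L B) (p q : Fin n → ℕ) :
    (B - skewProduct L) (Finsupp.single p 1) (Finsupp.single q 1) ∈ W.fil ℂ (p + q) 1 := by
  rw [LinearMap.sub_apply, LinearMap.sub_apply, skewProduct_single]
  exact hB.leading p q

theorem mul_mem_fil (hB : IsStar W L B) {p q : Fin n → ℕ} {a c : ℕ} {x y : MonoSpace n}
    (hx : x ∈ W.fil ℂ p a) (hy : y ∈ W.fil ℂ q c) : B x y ∈ W.fil ℂ (p + q) (a + c) :=
  W.apply_apply_mem_fil (c := 0) hB.mem_fil hx hy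

/-- On leading terms `B` may be replaced by the skew product, for which multiplication by a monomial
only rescales coefficients. -/
theorem coef_left (hB : IsStar W L B) {p q : Fin n → ℕ} {m : ℕ} {y : MonoSpace n}
    (hy : y ∈ W.fil ℂ q m) {w : Fin n → ℤ} (hw : w ∈ W.level m) :
    coef ℂ (intVec (p + q) + w) (B (Finsupp.single p 1) y) =
      Complex.exp (twist L (intVec p) (intVec q + w)) * coef ℂ (intVec q + w) y := by
  have h := W.coef_eq_zero (show m < 0 + m + 1 by omega) hw
    (W.apply_apply_mem_fil hB.sub_skewProduct_mem (W.single_self_mem_fil p 1) hy)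
  rw [LinearMap.sub_apply, LinearMap.sub_apply, map_sub, sub_eq_zero] at h
  rw [h, intVec_add, add_assoc, coef_skewProduct_left]

theorem coef_right (hB : IsStar W L B) {p q : Fin n → ℕ} {m : ℕ} {x : MonoSpace n}
    (hx : x ∈ W.fil ℂ p m) {w : Fin n → ℤ} (hw : w ∈ W.level m) :
    coef ℂ (intVec (p + q) + w) (B x (Finsupp.single q 1)) =
      Complex.exp (twist L (intVec p + w) (intVec q)) * coef ℂ (intVec p + w) x := by
  have h := W.coef_eq_zero (show m < m + 0 + 1 by omega) hw
    (W.apply_apply_mem_fil hB.sub_skewProduct_mem hx (W.single_self_mem_fil q 1))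
  rw [LinearMap.sub_apply, LinearMap.sub_apply, map_sub, sub_eq_zero] at h
  rw [h, intVec_add, add_right_comm, coef_skewProduct_right]

/-- The pentagon identity, read at the first level where the associator may be nonzero; there each
inner product of monomials may be replaced by its leading monomial. Division by the exponential of
`twist₃` turns it into the cocycle identity. -/
theorem coef_assoc_cocycle (hB : IsStar W L B) {m : ℕ}
    (hA : ∀ p q r, assoc B (Finsupp.single p 1) (Finsupp.single q 1) (Finsupp.single r 1) ∈
      W.fil ℂ (p + q + r) m) {w : Fin n → ℤ} (hw : w ∈ W.level m) (p q r s : Fin n → ℕ) :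
    Complex.exp (twist L (intVec p) (intVec (q + r + s) + w)) * coef ℂ (intVec (q + r + s) + w)
        (assoc B (Finsupp.single q 1) (Finsupp.single r 1) (Finsupp.single s 1))
      - Complex.exp (twist L (intVec p) (intVec q)) * coef ℂ (intVec (p + q + r + s) + w)
        (assoc B (Finsupp.single (p + q) 1) (Finsupp.single r 1) (Finsupp.single s 1))
      + Complex.exp (twist L (intVec q) (intVec r)) * coef ℂ (intVec (p + q + r + s) + w)
        (assoc B (Finsupp.single p 1) (Finsupp.single (q + r) 1) (Finsupp.single s 1))
      - Complex.exp (twist L (intVec r) (intVec s)) * coef ℂ (intVec (p + q + r + s) + w)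
        (assoc B (Finsupp.single p 1) (Finsupp.single q 1) (Finsupp.single (r + s) 1))
      + Complex.exp (twist L (intVec (p + q + r) + w) (intVec s)) *
        coef ℂ (intVec (p + q + r) + w)
        (assoc B (Finsupp.single p 1) (Finsupp.single q 1) (Finsupp.single r 1)) = 0 := by
  have h := congrArg (coef ℂ (intVec (p + q + r + s) + w))
    (assoc_pentagon B (Finsupp.single p 1) (Finsupp.single q 1) (Finsupp.single r 1)
      (Finsupp.single s 1))
  have e1 := hB.coef_left (p := p) (hA q r s) hw
  have e5 := hB.coef_right (q := s) (hA p q r) hw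
  have e2 := W.coef_apply_of_leading
    (f := (B.flip (Finsupp.single s 1)).comp (B.flip (Finsupp.single r 1))
      - B.flip (B (Finsupp.single r 1) (Finsupp.single s 1)))
    (r := r + s) (fun t => by
      rw [← add_assoc]
      exact hA t r s) (hB.leading p q) hw
  have e3 := W.coef_apply_of_leading
    (f := (B.flip (Finsupp.single s 1)).comp (B (Finsupp.single p 1))
      - (B (Finsupp.single p 1)).comp (B.flip (Finsupp.single s 1)))
    (r := p + s) (fun t => by
      rw [show t + (p + s) = p + t + s by abel]
      exact hA p t s) (hB.leading q r) hw
  have e4 := W.coef_apply_of_leading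
    (f := B (B (Finsupp.single p 1) (Finsupp.single q 1))
      - (B (Finsupp.single p 1)).comp (B (Finsupp.single q 1)))
    (r := p + q) (fun t => by
      rw [add_comm t]
      exact hA p q t) (hB.leading r s) hw
  rw [← add_assoc] at e2
  rw [show q + r + (p + s) = p + q + r + s by abel] at e3
  rw [show r + s + (p + q) = p + q + r + s by abel] at e4
  change coef ℂ _ (assoc B (B _ _) _ _) = _ * coef ℂ _ (assoc B _ _ _) at e2
  change coef ℂ _ (assoc B _ (B _ _) _) = _ * coef ℂ _ (assoc B _ _ _) at e3
  change coef ℂ _ (assoc B _ _ (B _ _)) = _ * coef ℂ _ (assoc B _ _ _) at e4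
  rw [show p + (q + r + s) = p + q + r + s by abel] at e1
  simp only [map_add, map_sub, map_zero] at h
  rw [e1, e2, e3, e4, e5] at h
  exact h

end IsStar

end WeightSystem

/-! ### Construction of associative filtered deformations -/

section Product

variable {n : ℕ}

theorem monoProduct_zero_left {c : (Fin n → ℕ) → (Fin n → ℕ) → MonoSpace n} {p : Fin n → ℕ}
    (h : ∀ q, c p q = 0) (x : MonoSpace n) : monoProduct c (Finsupp.single p 1) x = 0 := by
  induction x using Finsupp.induction_linear with
  | zero => simp
  | add x y hx hy => rw [map_add, hx, hy, add_zero]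
  | single q a =>
    rw [← mul_one a, ← smul_eq_mul, ← Finsupp.smul_single, map_smul, monoProduct_single, h,
      smul_zero]

theorem monoProduct_zero_right {c : (Fin n → ℕ) → (Fin n → ℕ) → MonoSpace n} {q : Fin n → ℕ}
    (h : ∀ p, c p q = 0) (x : MonoSpace n) : monoProduct c x (Finsupp.single q 1) = 0 := by
  induction x using Finsupp.induction_linear with
  | zero => simp
  | add x y hx hy => rw [map_add, LinearMap.add_apply, hx, hy, add_zero]
  | single p a =>
    rw [← mul_one a, ← smul_eq_mul, ← Finsupp.smul_single, map_smul, LinearMap.smul_apply,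
      monoProduct_single, h, smul_zero]

end Product

namespace WeightSystem

variable {n : ℕ} {W : WeightSystem n} {L : Matrix (Fin n) (Fin n) ℂ}

theorem assoc_eq_zero {B : MonoProduct n}
    (h : ∀ p q r, assoc B (Finsupp.single p 1) (Finsupp.single q 1) (Finsupp.single r 1) = 0)
    (x y z : MonoSpace n) : assoc B x y z = 0 := by
  have h3 : ∀ p q z, assoc B (Finsupp.single p 1) (Finsupp.single q 1) z = 0 := by
    intro p q z
    have : B (B (Finsupp.single p 1) (Finsupp.single q 1))
        - (B (Finsupp.single p 1)).comp (B (Finsupp.single q 1)) = 0 := by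
      ext r : 2
      simpa [assoc] using h p q r
    exact LinearMap.congr_fun this z
  have h2 : ∀ p y z, assoc B (Finsupp.single p 1) y z = 0 := by
    intro p y z
    have : (B.flip z).comp (B (Finsupp.single p 1)) - (B (Finsupp.single p 1)).comp (B.flip z)
        = 0 := by
      ext q : 2
      simpa [assoc] using h3 p q z
    exact LinearMap.congr_fun this y
  have : (B.flip z).comp (B.flip y) - B.flip (B y z) = 0 := by
    ext p : 2
    simpa [assoc] using h2 p y z
  exact LinearMap.congr_fun this x

/-- The normalizing exponent of the coefficients of a trilinear operation. -/
noncomputable def twist₃ (L : Matrix (Fin n) (Fin n) ℂ) (w : Fin n → ℤ) (p q r : Fin n → ℕ) : ℂ :=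
  twist L (intVec p) (intVec q) + twist L (intVec (p + q)) (intVec r)
    + twist L (intVec (p + q + r)) w

/-- The normalizing exponent of the coefficients of a bilinear operation. -/
noncomputable def twist₂ (L : Matrix (Fin n) (Fin n) ℂ) (w : Fin n → ℤ) (p q : Fin n → ℕ) : ℂ :=
  twist L (intVec p) (intVec q) + twist L (intVec (p + q)) w

namespace IsStar

variable {B : MonoProduct n}

/-- If the obstruction is a coboundary then the product can be corrected to the next order. -/
theorem exists_correction (hB : IsStar W L B) {m : ℕ} (hm : 1 ≤ m)
    (hA : ∀ p q r, assoc B (Finsupp.single p 1) (Finsupp.single q 1) (Finsupp.single r 1) ∈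
      W.fil ℂ (p + q + r) m)
    (c : (Fin n → ℤ) → (Fin n → ℕ) → (Fin n → ℕ) → ℂ) (zero_left : ∀ w q, c w 0 q = 0)
    (zero_right : ∀ w p, c w p 0 = 0) (supp : ∀ w p q, c w p q ≠ 0 → 0 ≤ intVec (p + q) + w)
    (heq : ∀ w ∈ W.level m, ∀ p q r, coef ℂ (intVec (p + q + r) + w)
      (assoc B (Finsupp.single p 1) (Finsupp.single q 1) (Finsupp.single r 1)) =
        Complex.exp (twist₃ L w p q r) *
          (c w q r - c w (p + q) r + c w p (q + r) - twistChar L w r * c w p q)) :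
    ∃ B' : MonoProduct n, IsStar W L B' ∧
      (∀ p q, (B' - B) (Finsupp.single p 1) (Finsupp.single q 1) ∈ W.fil ℂ (p + q) m) ∧
      (∀ w ∈ W.level m, ∀ p q, coef ℂ (intVec (p + q) + w)
        ((B' - B) (Finsupp.single p 1) (Finsupp.single q 1)) =
          Complex.exp (twist₂ L w p q) * c w p q) ∧
      ∀ p q r, assoc B' (Finsupp.single p 1) (Finsupp.single q 1) (Finsupp.single r 1) ∈
        W.fil ℂ (p + q + r) (m + 1) := by
  -- The correction is taken to be zero when an argument is 1, so that the unit is kept.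
  have hex : ∀ p q : Fin n → ℕ, ∃ x ∈ W.fil ℂ (p + q) m, (∀ w ∈ W.level m,
      coef ℂ (intVec (p + q) + w) x = Complex.exp (twist₂ L w p q) * c w p q) ∧
      (p = 0 ∨ q = 0 → x = 0) := by
    intro p q
    by_cases h : p = 0 ∨ q = 0
    · refine ⟨0, Submodule.zero_mem _, fun w _ => ?_, fun _ => rfl⟩
      rcases h with rfl | rfl
      · simp [zero_left]
      · simp [zero_right]
    · obtain ⟨x, hx, hx'⟩ := W.exists_mem_fil_coef (p + q) m
        (fun w => Complex.exp (twist₂ L w p q) * c w p q) (fun w hw => by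
          exact supp w p q (right_ne_zero_of_mul hw))
      exact ⟨x, hx, hx', fun h' => absurd h' h⟩
  choose g hg hgc hg0 using hex
  obtain ⟨K, hK⟩ : ∃ K : MonoProduct n, K = monoProduct g := ⟨_, rfl⟩
  have hKs : ∀ p q, K (Finsupp.single p 1) (Finsupp.single q 1) = g p q := by
    intro p q
    rw [hK, monoProduct_single]
  have hKm : ∀ p q, K (Finsupp.single p 1) (Finsupp.single q 1) ∈ W.fil ℂ (p + q) m := by
    intro p q
    rw [hKs]
    exact hg p q
  have hKc : ∀ w ∈ W.level m, ∀ p q, coef ℂ (intVec (p + q) + w)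
      (K (Finsupp.single p 1) (Finsupp.single q 1)) = Complex.exp (twist₂ L w p q) * c w p q := by
    intro w hw p q
    rw [hKs]
    exact hgc p q w hw
  refine ⟨B + K, ⟨fun p q => ?_, fun x => ?_, fun x => ?_⟩, fun p q => ?_, fun w hw p q => ?_,
    fun p q r => ?_⟩
  · have h := Submodule.add_mem _ (hB.leading p q) (W.fil_anti _ hm (hKm p q))
    rw [sub_add_eq_add_sub] at h
    exact h
  · rw [LinearMap.add_apply, LinearMap.add_apply, hB.one_mul, hK,
      monoProduct_zero_left fun q => hg0 0 q (Or.inl rfl), add_zero]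
  · rw [LinearMap.add_apply, LinearMap.add_apply, hB.mul_one, hK,
      monoProduct_zero_right fun p => hg0 p 0 (Or.inr rfl), add_zero]
  · rw [add_sub_cancel_left]
    exact hKm p q
  · rw [add_sub_cancel_left]
    exact hKc w hw p q
  · have s1 : ∀ p : Fin n → ℕ, Finsupp.single p (1 : ℂ) ∈ W.fil ℂ p 0 :=
      fun p => W.single_self_mem_fil p 1
    have m1 := hB.mul_mem_fil (hKm p q) (s1 r)
    have m2 := W.apply_apply_mem_fil hKm (hB.mem_fil p q) (s1 r)
    have m3 := hB.mul_mem_fil (s1 p) (hKm q r)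
    have m4 := W.apply_apply_mem_fil hKm (s1 p) (hB.mem_fil q r)
    have m5 := W.apply_apply_mem_fil hKm (hKm p q) (s1 r)
    have m6 := W.apply_apply_mem_fil hKm (s1 p) (hKm q r)
    have c1 := fun w (hw : w ∈ W.level m) => hB.coef_right (q := r) (hKm p q) hw
    have c3 := fun w (hw : w ∈ W.level m) => hB.coef_left (p := p) (hKm q r) hw
    have c2 := fun w (hw : w ∈ W.level m) => W.coef_apply_of_leading
      (f := K.flip (Finsupp.single r 1)) (r := r) (fun t => hKm t r) (hB.leading p q) hw
    have c4 := fun w (hw : w ∈ W.level m) => W.coef_apply_of_leading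
      (f := K (Finsupp.single p 1)) (r := p) (fun t => by
        rw [add_comm]
        exact hKm p t) (hB.leading q r) hw
    simp only [LinearMap.flip_apply] at c2
    simp only [← add_assoc] at m3 m4 m6 c3
    simp only [zero_add, add_zero, show q + r + p = p + q + r by abel] at m1 m2 m3 m4 m5 m6 c4
    -- The terms linear in K form, up to the twist, minus the coboundary of c at level m and cancel
    -- the associator there; the quadratic terms have level 2m ≥ m + 1.
    have hexp : assoc (B + K) (Finsupp.single p 1) (Finsupp.single q 1) (Finsupp.single r 1) =
        assoc B (Finsupp.single p 1) (Finsupp.single q 1) (Finsupp.single r 1)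
        + B (K (Finsupp.single p 1) (Finsupp.single q 1)) (Finsupp.single r 1)
        + K (B (Finsupp.single p 1) (Finsupp.single q 1)) (Finsupp.single r 1)
        - B (Finsupp.single p 1) (K (Finsupp.single q 1) (Finsupp.single r 1))
        - K (Finsupp.single p 1) (B (Finsupp.single q 1) (Finsupp.single r 1))
        + (K (K (Finsupp.single p 1) (Finsupp.single q 1)) (Finsupp.single r 1)
        - K (Finsupp.single p 1) (K (Finsupp.single q 1) (Finsupp.single r 1))) := by
      simp only [assoc, LinearMap.add_apply, map_add]
      abel
    rw [hexp]
    have hKK := Submodule.sub_mem _ m5 m6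
    refine Submodule.add_mem _ (W.mem_fil_succ ?_ fun w hw => ?_) (W.fil_anti _ (by omega) hKK)
    · exact Submodule.sub_mem _ (Submodule.sub_mem _ (Submodule.add_mem _
        (Submodule.add_mem _ (hA p q r) m1) m2) m3) m4
    · simp only [map_sub, map_add]
      have k2 := hKc w hw (p + q) r
      have k4 := hKc w hw p (q + r)
      have k1 := hKc w hw p q
      have k3 := hKc w hw q r
      simp only [← add_assoc] at k4
      rw [heq w hw, c1 w hw, c2 w hw, c3 w hw, c4 w hw, k1, k2, k3, k4]
      simp only [← mul_assoc]
      rw [show Complex.exp (twist L (intVec (p + q) + w) (intVec r)) *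
          Complex.exp (twist₂ L w p q) = Complex.exp (twist₃ L w p q r) * twistChar L w r from ?_,
        show Complex.exp (twist L (intVec p) (intVec q)) * Complex.exp (twist₂ L w (p + q) r) =
          Complex.exp (twist₃ L w p q r) from ?_,
        show Complex.exp (twist L (intVec p) (intVec (q + r) + w)) *
          Complex.exp (twist₂ L w q r) = Complex.exp (twist₃ L w p q r) from ?_,
        show Complex.exp (twist L (intVec q) (intVec r)) * Complex.exp (twist₂ L w p (q + r)) =
          Complex.exp (twist₃ L w p q r) from ?_]
      · ring
      all_goals
        simp only [twistChar, ← Complex.exp_add]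
        congr 1
        simp only [twist₂, twist₃, intVec_add, twist_add_left, twist_add_right]
        ring

/-- If all weights of the given level are rigid then an associative product up to that level can
be corrected to the next level. -/
theorem exists_correction_of_isRigid (hB : IsStar W L B) {m : ℕ} (hm : 1 ≤ m)
    (hA : ∀ p q r, assoc B (Finsupp.single p 1) (Finsupp.single q 1) (Finsupp.single r 1) ∈
      W.fil ℂ (p + q + r) m) (hrig : ∀ w ∈ W.level m, IsRigid L w) :
    ∃ B' : MonoProduct n, IsStar W L B' ∧
      (∀ p q, (B' - B) (Finsupp.single p 1) (Finsupp.single q 1) ∈ W.fil ℂ (p + q) m) ∧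
      ∀ p q r, assoc B' (Finsupp.single p 1) (Finsupp.single q 1) (Finsupp.single r 1) ∈
        W.fil ℂ (p + q + r) (m + 1) := by
  have hex : ∀ w : Fin n → ℤ, ∃ c : (Fin n → ℕ) → (Fin n → ℕ) → ℂ, (∀ q, c 0 q = 0) ∧
      (∀ p, c p 0 = 0) ∧ (∀ p q, c p q ≠ 0 → 0 ≤ intVec (p + q) + w) ∧
      (w ∈ W.level m → ∀ p q r, coef ℂ (intVec (p + q + r) + w)
        (assoc B (Finsupp.single p 1) (Finsupp.single q 1) (Finsupp.single r 1)) =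
        Complex.exp (twist₃ L w p q r) *
          (c q r - c (p + q) r + c p (q + r) - twistChar L w r * c p q)) := by
    intro w
    by_cases hw : w ∈ W.level m
    · obtain ⟨c, h1, h2, h3, h4⟩ := (hrig w hw).exists_cochain_two
        (fun p q r => Complex.exp (-twist₃ L w p q r) * coef ℂ (intVec (p + q + r) + w)
          (assoc B (Finsupp.single p 1) (Finsupp.single q 1) (Finsupp.single r 1)))
        (fun q r => by simp [assoc, hB.one_mul]) (fun p r => by simp [assoc, hB.one_mul, hB.mul_one])
        (fun p q => by simp [assoc, hB.mul_one]) (fun p q r hne => by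
          by_contra h
          rw [coef_of_not_nonneg h, mul_zero] at hne
          exact hne rfl) (fun p q r s => by
          have h := congrArg (fun z => Complex.exp (-(twist₃ L w p q (r + s) +
            twist L (intVec r) (intVec s))) * z) (hB.coef_assoc_cocycle hA hw p q r s)
          simp only [mul_zero, mul_sub, mul_add, ← mul_assoc, ← Complex.exp_add] at h
          rw [← h]
          simp only [twistChar, ← mul_assoc, ← Complex.exp_add]
          congr 1
          · congr 1
            · congr 1
              · congr 1
                all_goals
                  congr 2
                  simp only [twist₃, intVec_add, twist_add_left, twist_add_right]
                  ring
              · congr 2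
                · simp only [twist₃, intVec_add, twist_add_left, twist_add_right]
                  ring
                · rw [show p + (q + r) + s = p + q + r + s by abel]
            · congr 2
              · simp only [twist₃, intVec_add, twist_add_left, twist_add_right]
                ring
              · rw [show p + q + (r + s) = p + q + r + s by abel]
          · congr 2
            simp only [twist₃, intVec_add, twist_add_left, twist_add_right]
            ring)
      refine ⟨c, h1, h2, h3, fun _ p q r => ?_⟩
      rw [← h4, ← mul_assoc, ← Complex.exp_add, add_neg_cancel, Complex.exp_zero, _root_.one_mul]
    · exact ⟨fun _ _ => 0, fun _ => rfl, fun _ => rfl, fun _ _ h => absurd rfl h,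
        fun h => absurd h hw⟩
  choose c h1 h2 h3 h4 using hex
  obtain ⟨B', hB', hd, -, hA'⟩ := hB.exists_correction hm hA c h1 h2 h3 h4
  exact ⟨B', hB', hd, hA'⟩

end IsStar

variable (W L) in
theorem isStar_skewProduct : IsStar W L (skewProduct L) where
  leading p q := by
    rw [skewProduct_single, sub_self]
    exact Submodule.zero_mem _
  one_mul x := by
    have : skewProduct L (Finsupp.single 0 1) = LinearMap.id := by
      ext q : 2
      simp [skewProduct_single]
    rw [this, LinearMap.id_apply]
  mul_one x := by
    have : (skewProduct L).flip (Finsupp.single 0 1) = LinearMap.id := by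
      ext q : 2
      simp [skewProduct_single]
    rw [← LinearMap.flip_apply, this, LinearMap.id_apply]

theorem assoc_skewProduct (p q r : Fin n → ℕ) :
    assoc (skewProduct L) (Finsupp.single p 1) (Finsupp.single q 1) (Finsupp.single r 1) = 0 := by
  simp only [assoc, skewProduct_single, map_smul, LinearMap.smul_apply, smul_smul,
    ← Complex.exp_add, intVec_add, twist_add_left, twist_add_right]
  rw [add_assoc p q r, sub_eq_zero]
  congr 2
  ring

/-- An associative filtered deformation with prescribed first order terms. -/
theorem exists_isStar (hrig : ∀ m, 2 ≤ m → ∀ w ∈ W.level m, IsRigid L w)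
    (c : (Fin n → ℤ) → (Fin n → ℕ) → (Fin n → ℕ) → ℂ) (zero_left : ∀ w q, c w 0 q = 0)
    (zero_right : ∀ w p, c w p 0 = 0) (supp : ∀ w p q, c w p q ≠ 0 → 0 ≤ intVec (p + q) + w)
    (cocycle : ∀ w ∈ W.level 1, ∀ p q r,
      c w q r - c w (p + q) r + c w p (q + r) - twistChar L w r * c w p q = 0) :
    ∃ B : MonoProduct n, IsStar W L B ∧ (∀ x y z, assoc B x y z = 0) ∧
      ∀ w ∈ W.level 1, ∀ p q, coef ℂ (intVec (p + q) + w)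
        (B (Finsupp.single p 1) (Finsupp.single q 1)) =
          Complex.exp (twist₂ L w p q) * c w p q := by
  -- Level one is prescribed, not solved for: the skew product is associative, so adding a cocycle
  -- there keeps the associator in level two.
  obtain ⟨B₀, hB₀, -, hc₀, hA₀⟩ := (isStar_skewProduct W L).exists_correction le_rfl
    (fun p q r => by
      rw [assoc_skewProduct]
      exact Submodule.zero_mem _) c zero_left zero_right supp (fun w hw p q r => by
      rw [assoc_skewProduct, cocycle w hw, mul_zero, map_zero])
  have hstep : ∀ (k : ℕ) (B : {B : MonoProduct n // IsStar W L B ∧ ∀ p q r,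
      assoc B (Finsupp.single p 1) (Finsupp.single q 1) (Finsupp.single r 1) ∈
        W.fil ℂ (p + q + r) (k + 2)}),
      ∃ B' : {B : MonoProduct n // IsStar W L B ∧ ∀ p q r,
        assoc B (Finsupp.single p 1) (Finsupp.single q 1) (Finsupp.single r 1) ∈
          W.fil ℂ (p + q + r) (k + 1 + 2)},
        ∀ p q, (B'.1 - B.1) (Finsupp.single p 1) (Finsupp.single q 1) ∈
          W.fil ℂ (p + q) (k + 2) := by
    rintro k ⟨B, hB, hA⟩
    obtain ⟨B', hB', hd, hA'⟩ := hB.exists_correction_of_isRigid (by omega) hA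
      (hrig (k + 2) (by omega))
    exact ⟨⟨B', hB', fun p q r => by simpa [add_right_comm] using hA' p q r⟩, hd⟩
  choose next hnext using hstep
  let f : (k : ℕ) → {B : MonoProduct n // IsStar W L B ∧ ∀ p q r,
      assoc B (Finsupp.single p 1) (Finsupp.single q 1) (Finsupp.single r 1) ∈
        W.fil ℂ (p + q + r) (k + 2)} := fun k => Nat.rec ⟨B₀, hB₀, hA₀⟩ next k
  have hf : ∀ k p q, ((f (k + 1)).1 - (f k).1) (Finsupp.single p 1) (Finsupp.single q 1) ∈
      W.fil ℂ (p + q) (k + 2) := fun k => hnext k (f k)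
  have hmono : ∀ k d p q, ((f (k + d)).1 - (f k).1) (Finsupp.single p 1) (Finsupp.single q 1) ∈
      W.fil ℂ (p + q) (k + 2) := by
    intro k d p q
    induction d with
    | zero => simp
    | succ d ih =>
      have h := Submodule.add_mem _ (W.fil_anti _ (by omega) (hf (k + d) p q)) ih
      rw [LinearMap.sub_apply, LinearMap.sub_apply, LinearMap.sub_apply, LinearMap.sub_apply,
        sub_add_sub_cancel] at h
      exact h
  -- Step k changes products only in levels from k + 2 on, so on each pair of monomials the
  -- recursion is stationary once k reaches the depth of their product. The limit is read off there.
  obtain ⟨B, hBdef⟩ : ∃ B : MonoProduct n, B = monoProduct fun p q =>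
    (f (W.depth (p + q))).1 (Finsupp.single p 1) (Finsupp.single q 1) := ⟨_, rfl⟩
  have hBs : ∀ p q, B (Finsupp.single p 1) (Finsupp.single q 1) =
      (f (W.depth (p + q))).1 (Finsupp.single p 1) (Finsupp.single q 1) := by
    intro p q
    rw [hBdef, monoProduct_single]
  have hstab : ∀ k p q, W.depth (p + q) ≤ k →
      (B - (f k).1) (Finsupp.single p 1) (Finsupp.single q 1) = 0 := by
    intro k p q hk
    have h := hmono (W.depth (p + q)) (k - W.depth (p + q)) p q
    rw [show W.depth (p + q) + (k - W.depth (p + q)) = k by omega, W.fil_eq_bot (by omega),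
      Submodule.mem_bot, LinearMap.sub_apply, LinearMap.sub_apply, sub_eq_zero] at h
    rw [LinearMap.sub_apply, LinearMap.sub_apply, hBs, h, sub_self]
  have hstab' : ∀ k p q, W.depth (p + q) ≤ k → ∀ x ∈ W.fil ℂ p 0, ∀ y ∈ W.fil ℂ q 0,
      B x y = (f k).1 x y := by
    intro k p q hk x hx y hy
    rw [← sub_eq_zero, ← LinearMap.sub_apply, ← LinearMap.sub_apply, ← LinearMap.flip_apply,
      ← Submodule.mem_bot ℂ]
    refine W.map_mem_of_mem_fil _ _ (fun s a _ hs => ?_) hx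
    rw [LinearMap.flip_apply]
    refine W.map_mem_of_mem_fil _ _ (fun t b _ ht => ?_) hy
    rw [Submodule.mem_bot]
    refine hstab k s t (le_trans ?_ hk)
    have h := W.add_mem hs ht
    rw [sub_add_sub_comm, ← intVec_add, ← intVec_add] at h
    have := W.depth_add_le h
    omega
  have hstar : IsStar W L B := by
    refine ⟨fun p q => ?_, fun x => ?_, fun x => ?_⟩
    · rw [hBs]
      exact (f _).2.1.leading p q
    · have : B (Finsupp.single 0 1) = LinearMap.id := by
        ext q : 2
        simp [hBs, (f _).2.1.one_mul]
      rw [this, LinearMap.id_apply]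
    · have : B.flip (Finsupp.single 0 1) = LinearMap.id := by
        ext q : 2
        simp [hBs, (f _).2.1.mul_one]
      rw [← LinearMap.flip_apply, this, LinearMap.id_apply]
  refine ⟨B, hstar, assoc_eq_zero fun p q r => ?_, fun w hw p q => ?_⟩
  · have hle : W.depth (p + q) ≤ W.depth (p + q + r) := W.depth_mono le_self_add
    have hle' : W.depth (q + r) ≤ W.depth (p + q + r) := by
      rw [add_assoc]
      exact W.depth_mono le_add_self
    have s1 : ∀ p : Fin n → ℕ, Finsupp.single p (1 : ℂ) ∈ W.fil ℂ p 0 :=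
      fun p => W.single_self_mem_fil p 1
    have h := (f (W.depth (p + q + r))).2.2 p q r
    rw [W.fil_eq_bot (by omega), Submodule.mem_bot] at h
    rw [← h, assoc, assoc, hstab' _ (p + q) r le_rfl _ (hstar.mem_fil p q) _ (s1 r),
      hstab' _ p (q + r) (le_of_eq (congrArg W.depth (add_assoc p q r).symm)) _ (s1 p) _ (hstar.mem_fil q r),
      hstab' _ p q hle _ (s1 p) _ (s1 q), hstab' _ q r hle' _ (s1 q) _ (s1 r)]
  · have h : ((f (W.depth (p + q))).1 - B₀) (Finsupp.single p 1) (Finsupp.single q 1) ∈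
        W.fil ℂ (p + q) 2 := by
      have h := hmono 0 (W.depth (p + q)) p q
      have h0 : ∀ k, k = W.depth (p + q) → ((f k).1 - B₀) (Finsupp.single p 1)
          (Finsupp.single q 1) ∈ W.fil ℂ (p + q) 2 →
          ((f (W.depth (p + q))).1 - B₀) (Finsupp.single p 1) (Finsupp.single q 1) ∈
            W.fil ℂ (p + q) 2 := by
        rintro k rfl hk
        exact hk
      exact h0 _ (zero_add _) h
    have h1 := W.coef_eq_zero (by omega) hw h
    rw [LinearMap.sub_apply, LinearMap.sub_apply, ← hBs, map_sub, sub_eq_zero] at h1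
    rw [h1, ← hc₀ w hw p q]
    rw [LinearMap.sub_apply, LinearMap.sub_apply, map_sub, skewProduct_single, map_smul]
    classical
    rw [coef_single, if_neg, smul_zero, sub_zero]
    intro h2
    rw [left_eq_add] at h2
    rw [h2] at hw
    have := W.level_unique hw W.zero_mem
    omega

end WeightSystem

/-! ### First order deformations attached to smoothable edges -/

section FirstOrder

variable {n : ℕ} {L b : Matrix (Fin n) (Fin n) ℂ} {G : SimpleGraph (Fin n)}

/-- Antisymmetry of `L` glues the two triangular halves of the bicharacter into the full matrix. -/
theorem twist_sub_twist (halt : IsAlternating L) (w v : Fin n → ℤ) :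
    twist L w v - twist L v w = -∑ k, (v k : ℂ) * L.mulVec (weightVec w) k := by
  have h1 : twist L w v = ∑ k, ∑ l, if k < l then L l k * w l * v k else 0 := by
    rw [twist, Finset.sum_comm]
  rw [h1, twist, ← Finset.sum_sub_distrib, ← Finset.sum_neg_distrib]
  refine Finset.sum_congr rfl fun k _ => ?_
  rw [← Finset.sum_sub_distrib, Matrix.mulVec, dotProduct, Finset.mul_sum,
    ← Finset.sum_neg_distrib]
  refine Finset.sum_congr rfl fun l _ => ?_
  rw [weightVec_apply]
  rcases lt_trichotomy k l with h | h | h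
  · rw [if_pos h, if_neg h.asymm, halt l k]
    ring
  · subst h
    have : L k k = 0 := by
      have := halt k k
      linear_combination this / 2
    simp [this]
  · rw [if_neg h.asymm, if_pos h]
    ring

theorem twistChar_eq (halt : IsAlternating L) (w : Fin n → ℤ) (r : Fin n → ℕ) :
    twistChar L w r = Complex.exp (-∑ k, (r k : ℂ) * L.mulVec (weightVec w) k) := by
  rw [twistChar, twist_sub_twist halt]
  simp

/-- Together with `prod_entrywiseExp_zpow` this identifies triviality of the character at e_i with
the Hochschild equation at i. -/
theorem twistChar_single (halt : IsAlternating L) (w : Fin n → ℤ) (i : Fin n) :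
    twistChar L w (Pi.single i 1) = Complex.exp (-L.mulVec (weightVec w) i) := by
  rw [twistChar_eq halt, Finset.sum_eq_single i]
  · simp
  · intro k _ hk
    simp [hk]
  · simp

theorem prod_entrywiseExp_zpow (w : Fin n → ℤ) (i : Fin n) :
    ∏ j, entrywiseExp L i j ^ w j = Complex.exp (L.mulVec (weightVec w) i) := by
  rw [Matrix.mulVec, dotProduct, Complex.exp_sum]
  refine Finset.prod_congr rfl fun j _ => ?_
  rw [entrywiseExp, ← Complex.exp_int_mul, weightVec_apply, mul_comm]

/-- A weight with exactly two negative entries equal to `-1` which acts trivially on all other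
variables supports a first order deformation. -/
theorem exists_first_order_cochain (halt : IsAlternating L) {i j : Fin n} (hij : i ≠ j)
    {w : Fin n → ℤ} (hi : w i = -1) (hj : w j = -1) (hnn : ∀ k, k ≠ i → k ≠ j → 0 ≤ w k)
    (hχ : ∀ k, k ≠ i → k ≠ j → L.mulVec (weightVec w) k = 0) (a : ℂ) :
    ∃ c : (Fin n → ℕ) → (Fin n → ℕ) → ℂ, (∀ q, c 0 q = 0) ∧ (∀ p, c p 0 = 0) ∧
      (∀ p q, c p q ≠ 0 → 0 ≤ intVec (p + q) + w) ∧
      (∀ p q r, c q r - c (p + q) r + c p (q + r) - twistChar L w r * c p q = 0) ∧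
      c (Pi.single i 1) (Pi.single j 1) = a ∧ c (Pi.single j 1) (Pi.single i 1) = 0 := by
  obtain ⟨u, hu⟩ : ∃ u, u = twistChar L w (Pi.single i 1) := ⟨_, rfl⟩
  obtain ⟨v, hv⟩ : ∃ v, v = twistChar L w (Pi.single j 1) := ⟨_, rfl⟩
  have hβ : ∀ r, twistChar L w r = u ^ r i * v ^ r j := by
    intro r
    rw [hu, hv, twistChar_single halt, twistChar_single halt, ← Complex.exp_nat_mul,
      ← Complex.exp_nat_mul, ← Complex.exp_add, twistChar_eq halt,
      ← Finset.add_sum_erase _ _ (Finset.mem_univ i),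
      ← Finset.add_sum_erase _ _ (Finset.mem_erase.2 ⟨hij.symm, Finset.mem_univ j⟩),
      Finset.sum_eq_zero]
    · congr 1
      ring
    · intro k hk
      simp only [Finset.mem_erase, Finset.mem_univ, and_true] at hk
      rw [hχ k hk.2 hk.1, mul_zero]
  have hgeom : ∀ (z : ℂ) (s t : ℕ), ∑ k ∈ Finset.range (s + t), z ^ k =
      ∑ k ∈ Finset.range t, z ^ k + z ^ t * ∑ k ∈ Finset.range s, z ^ k := by
    intro z s t
    rw [add_comm s t, Finset.sum_range_add, Finset.mul_sum]
    congr 1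
    exact Finset.sum_congr rfl fun k _ => pow_add z t k
  -- A cup product of the crossed homomorphisms p ↦ 1 + … + u^(p_i − 1) and q ↦ 1 + … + v^(q_j − 1);
  -- `hgeom` is the crossed homomorphism rule. It vanishes unless p_i and q_j are positive, which
  -- compensates the two entries −1 of w.
  refine ⟨fun p q => a * (∑ k ∈ Finset.range (p i), u ^ k) * u ^ q i *
    ∑ k ∈ Finset.range (q j), v ^ k, fun q => by simp, fun p => by simp, fun p q hne => ?_,
    fun p q r => ?_, by simp [hij], by simp [hij]⟩
  · have h1 : p i ≠ 0 := by
      intro h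
      simp [h] at hne
    have h2 : q j ≠ 0 := by
      intro h
      simp [h] at hne
    intro k
    simp only [Pi.zero_apply, Pi.add_apply, intVec_apply]
    push_cast
    by_cases hk : k = i
    · subst hk
      omega
    · by_cases hk' : k = j
      · subst hk'
        omega
      · have := hnn k hk hk'
        omega
  · simp only [Pi.add_apply, hβ, hgeom, pow_add]
    ring

end FirstOrder

/-! ### The weight system of a smoothable forest and its rigidity -/

section SmoothSystem

variable {n : ℕ} {L b : Matrix (Fin n) (Fin n) ℂ} {G : SimpleGraph (Fin n)}

theorem exists_height_weightSums (hb : IsBiresidue L b) (hG : G.IsAcyclic) :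
    ∃ φ : (Fin n → ℤ) →+ ℝ, ∀ (w : Fin n → ℤ) (m : ℕ), w ∈ weightSums b G m → φ w = m := by
  obtain ⟨φ, hφ⟩ := exists_height hb hG fun _ => 1
  refine ⟨Complex.reCLM.toLinearMap.toAddMonoidHom.comp φ, ?_⟩
  rintro w m ⟨s, hs, rfl⟩
  have : φ (∑ t, s t) = m := by
    rw [map_sum, Finset.sum_congr rfl (g := fun _ => 1)]
    · simp
    · intro t _
      obtain ⟨i, j, hij, h⟩ := hs t
      exact hφ i j _ hij h
  change (φ (∑ t, s t)).re = m
  simp only [this, Complex.natCast_re]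

/-- The weight system generated by the smoothable weights of the edges of a forest. -/
noncomputable def smoothSystem (hb : IsBiresidue L b) (hG : G.IsAcyclic) : WeightSystem n where
  level := weightSums b G
  zero_mem := zero_mem_weightSums
  add_mem hu hv := add_mem_weightSums hu hv
  sum_eq_zero hw := sum_eq_zero_of_mem_weightSums hb hw
  height := (exists_height_weightSums hb hG).choose
  height_eq hw := (exists_height_weightSums hb hG).choose_spec _ _ hw

/-- If the character is trivial wherever w ≥ 0 and all entries are at least −1, genericity makes w
Poisson-contributing and the flow argument excludes two and three basis vectors. An entry below −1
excludes them directly, since distinct basis vectors add at most one. Genericity enters the proof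
only here. -/
theorem isRigid_of_mem_weightSums (halt : IsAlternating L) (hgen : IsGeneric L)
    (hb : IsBiresidue L b) (hG : G.IsAcyclic) {m : ℕ} (hm : 2 ≤ m) {w : Fin n → ℤ}
    (hw : w ∈ weightSums b G m) : IsRigid L w := by
  by_cases h : ∃ i, 0 ≤ w i ∧ twistChar L w (Pi.single i 1) ≠ 1
  · exact Or.inl h
  · push Not at h
    right
    by_cases hge : ∀ i, -1 ≤ w i
    · have hP : IsPoissonContributing L w := by
        refine hgen.2 w ⟨hge, sum_eq_zero_of_mem_weightSums hb hw⟩ ⟨hge, fun i hi => ?_⟩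
        have := h i hi
        rw [twistChar_single halt, Complex.exp_neg] at this
        rw [prod_entrywiseExp_zpow]
        exact inv_eq_one.1 this
      have key := not_nonneg_of_isPoissonContributing hb hG hm hw hP
      refine ⟨fun i j _ hnn => ?_, fun i j k _ _ _ hnn => ?_⟩
      · obtain ⟨t, hti, htj, -, ht⟩ := key i j j
        have := hnn t
        simp [hti, htj] at this
        omega
      · obtain ⟨t, hti, htj, htk, ht⟩ := key i j k
        have := hnn t
        simp [hti, htj, htk] at this
        omega
    · push Not at hge
      obtain ⟨t, ht⟩ := hge
      refine ⟨fun i j hij hnn => ?_, fun i j k hij hik hjk hnn => ?_⟩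
      · have := hnn t
        simp only [Pi.zero_apply, Pi.add_apply, intVec_apply, Pi.single_apply] at this
        split_ifs at this <;> push_cast at this <;> omega
      · have := hnn t
        simp only [Pi.zero_apply, Pi.add_apply, intVec_apply, Pi.single_apply] at this
        split_ifs at this <;> push_cast at this <;> omega

/-- Both entries −1 need compensation, so θ is visible only in the commutator of the end points of
its edge. -/
theorem IsSmoothableWeight.eq_of_nonneg {i j : Fin n} (hij : i ≠ j) {θ : Fin n → ℤ}
    (h : IsSmoothableWeight b i j θ) {x y : Fin n}
    (hnn : 0 ≤ intVec (Pi.single x 1 + Pi.single y 1) + θ) :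
    (x = i ∧ y = j) ∨ (x = j ∧ y = i) := by
  have h1 := hnn i
  have h2 := hnn j
  simp only [Pi.zero_apply, Pi.add_apply, intVec_apply, Pi.single_apply, h.1, h.2.1] at h1 h2
  by_cases hxi : x = i
  · subst hxi
    by_cases hyj : y = j
    · exact Or.inl ⟨rfl, hyj⟩
    · simp [hij.symm, Ne.symm hyj] at h2
  · by_cases hyi : y = i
    · subst hyi
      by_cases hxj : x = j
      · exact Or.inr ⟨hxj, rfl⟩
      · simp [hij.symm, Ne.symm hxj] at h2
    · simp [Ne.symm hxi, Ne.symm hyi] at h1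

open WeightSystem in
/-- For all choices of constants on the edges of a forest there is an associative product with
these first order terms. -/
theorem exists_star_of_edgeConstants (halt : IsAlternating L) (hgen : IsGeneric L)
    (hb : IsBiresidue L b) (hG : G.IsAcyclic) (γ : Sym2 (Fin n) → ℂ) :
    ∃ B : MonoProduct n, IsStar (smoothSystem hb hG) L B ∧ (∀ x y z, assoc B x y z = 0) ∧
      ∀ i j θ, G.Adj i j → IsSmoothableWeight b i j θ → ∀ x y, x < y →
        0 ≤ intVec (Pi.single x 1 + Pi.single y 1) + θ →
        coef ℂ (intVec (Pi.single x 1 + Pi.single y 1) + θ)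
          (B (Finsupp.single (Pi.single y 1) 1) (Finsupp.single (Pi.single x 1) 1)
            - entrywiseExp L y x •
              B (Finsupp.single (Pi.single x 1) 1) (Finsupp.single (Pi.single y 1) 1)) =
          γ s(i, j) := by
  have hex : ∀ θ : Fin n → ℤ, ∃ c : (Fin n → ℕ) → (Fin n → ℕ) → ℂ, (∀ q, c 0 q = 0) ∧
      (∀ p, c p 0 = 0) ∧ (∀ p q, c p q ≠ 0 → 0 ≤ intVec (p + q) + θ) ∧
      (θ ∈ weightSums b G 1 →
        ∀ p q r, c q r - c (p + q) r + c p (q + r) - twistChar L θ r * c p q = 0) ∧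
      ∀ i j, i < j → G.Adj i j → IsSmoothableWeight b i j θ →
        c (Pi.single j 1) (Pi.single i 1) - c (Pi.single i 1) (Pi.single j 1) =
          Complex.exp (-L j i - twist L (intVec (Pi.single i 1 + Pi.single j 1)) θ)
            * γ s(i, j) := by
    intro θ
    by_cases h : ∃ i j, i < j ∧ G.Adj i j ∧ IsSmoothableWeight b i j θ
    · obtain ⟨i, j, hij, hadj, hθ⟩ := h
      obtain ⟨c, h1, h2, h3, h4, h5, h6⟩ := exists_first_order_cochain halt hij.ne hθ.1 hθ.2.1
        (fun k hi hj => hθ.nonneg hi hj) (fun k hi hj => by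
          by_contra hne
          rcases (hθ.mulVec_apply_ne_zero_iff hb hij.ne k).1 hne with h | h
          · exact hi h
          · exact hj h)
        -- The exponential undoes the normalization by `twist₂` (see `t1` and `t2` below). The sign
        -- is there because the constant is placed at (e_i, e_j) with i < j, the subtracted term of
        -- the commutator.
        (-(Complex.exp (-L j i - twist L (intVec (Pi.single i 1 + Pi.single j 1)) θ)
            * γ s(i, j)))
      refine ⟨c, h1, h2, h3, fun _ => h4, fun i' j' hij' hadj' hθ' => ?_⟩
      -- The negative entries of θ recover its edge.
      have hi : i = i' ∨ i = j' := hθ'.eq_or_of_neg (by rw [hθ.1]; omega)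
      have hj : j = i' ∨ j = j' := hθ'.eq_or_of_neg (by rw [hθ.2.1]; omega)
      have : i' = i ∧ j' = j := by
        rcases hi with hi | hi <;> rcases hj with hj | hj <;> constructor <;> omega
      obtain ⟨rfl, rfl⟩ := this
      rw [h5, h6, zero_sub, neg_neg]
    · refine ⟨fun _ _ => 0, fun _ => rfl, fun _ => rfl, fun _ _ h => absurd rfl h,
        fun _ _ _ _ => by simp, fun i j hij hadj hθ => absurd ⟨i, j, hij, hadj, hθ⟩ h⟩
  choose c h1 h2 h3 h4 h5 using hex
  obtain ⟨B, hB, hassoc, hc⟩ := exists_isStar (W := smoothSystem hb hG)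
    (fun m hm w hw => isRigid_of_mem_weightSums halt hgen hb hG hm hw) c h1 h2 h3 h4
  refine ⟨B, hB, hassoc, ?_⟩
  have key : ∀ i j θ, i < j → G.Adj i j → IsSmoothableWeight b i j θ →
      coef ℂ (intVec (Pi.single i 1 + Pi.single j 1) + θ)
          (B (Finsupp.single (Pi.single j 1) 1) (Finsupp.single (Pi.single i 1) 1)
            - entrywiseExp L j i •
              B (Finsupp.single (Pi.single i 1) 1) (Finsupp.single (Pi.single j 1) 1)) =
          γ s(i, j) := by
    intro i j θ hij hadj hθ
    have hw : θ ∈ weightSums b G 1 := mem_weightSums_one.2 ⟨i, j, hadj, hθ⟩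
    have e1 := hc θ hw (Pi.single j 1) (Pi.single i 1)
    have e2 := hc θ hw (Pi.single i 1) (Pi.single j 1)
    rw [add_comm (Pi.single j 1)] at e1
    have e3 := h5 θ i j hij hadj hθ
    have t1 : twist₂ L θ (Pi.single j 1) (Pi.single i 1) =
        L j i + twist L (intVec (Pi.single i 1 + Pi.single j 1)) θ := by
      rw [twist₂, intVec_single, intVec_single, twist_single_single, if_pos hij,
        add_comm (Pi.single j 1)]
    have t2 : twist₂ L θ (Pi.single i 1) (Pi.single j 1) =
        twist L (intVec (Pi.single i 1 + Pi.single j 1)) θ := by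
      rw [twist₂, intVec_single, intVec_single, twist_single_single, if_neg hij.asymm, zero_add]
    rw [map_sub, map_smul, e1, e2, t1, t2, smul_eq_mul, entrywiseExp, ← mul_assoc,
      ← Complex.exp_add, ← mul_sub, e3, ← mul_assoc, ← Complex.exp_add]
    rw [show L j i + twist L (intVec (Pi.single i 1 + Pi.single j 1)) θ +
      (-L j i - twist L (intVec (Pi.single i 1 + Pi.single j 1)) θ) = 0 by ring,
      Complex.exp_zero, _root_.one_mul]
  intro i j θ hadj hθ x y hxy hnn
  rcases hθ.eq_of_nonneg hadj.ne hnn with ⟨rfl, rfl⟩ | ⟨rfl, rfl⟩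
  · exact key _ _ θ hxy hadj hθ
  · rw [Sym2.eq_swap]
    exact key _ _ θ hxy hadj.symm (hθ.symm hb)

end SmoothSystem

/-! ### Comparison of associative filtered deformations -/

namespace WeightSystem

variable {n : ℕ} {W : WeightSystem n} {L : Matrix (Fin n) (Fin n) ℂ} {B B' : MonoProduct n}

/-- The failure of a linear map to be multiplicative. -/
noncomputable def mulDefect (B B' : MonoProduct n) (Φ : MonoSpace n →ₗ[ℂ] MonoSpace n) :
    MonoProduct n :=
  B.compr₂ Φ - B'.compl₁₂ Φ Φ

theorem mulDefect_apply (Φ : MonoSpace n →ₗ[ℂ] MonoSpace n) (x y : MonoSpace n) :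
    mulDefect B B' Φ x y = Φ (B x y) - B' (Φ x) (Φ y) := rfl

/-- Associativity of both products is all that is used, and Φ is an arbitrary linear map. The
leading part makes the defect a two-cocycle. -/
theorem mulDefect_cocycle (hB : ∀ x y z, assoc B x y z = 0) (hB' : ∀ x y z, assoc B' x y z = 0)
    (Φ : MonoSpace n →ₗ[ℂ] MonoSpace n) (x y z : MonoSpace n) :
    mulDefect B B' Φ (B x y) z - mulDefect B B' Φ x (B y z) + B' (mulDefect B B' Φ x y) (Φ z)
      - B' (Φ x) (mulDefect B B' Φ y z) = 0 := by
  have h1 := sub_eq_zero.1 (hB x y z)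
  have h2 := sub_eq_zero.1 (hB' (Φ x) (Φ y) (Φ z))
  simp only [mulDefect_apply, map_sub, LinearMap.sub_apply]
  rw [h1, h2]
  abel

/-- A linear map is unitriangular if it preserves the leading terms of all monomials. -/
structure IsUnitriangular (W : WeightSystem n) (Φ : MonoSpace n →ₗ[ℂ] MonoSpace n) : Prop where
  sub_mem : ∀ p, Φ (Finsupp.single p 1) - Finsupp.single p 1 ∈ W.fil ℂ p 1
  map_one : Φ (Finsupp.single 0 1) = Finsupp.single 0 1

theorem IsUnitriangular.mem_fil {Φ : MonoSpace n →ₗ[ℂ] MonoSpace n} (hΦ : IsUnitriangular W Φ)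
    (p : Fin n → ℕ) : Φ (Finsupp.single p 1) ∈ W.fil ℂ p 0 := by
  have h := Submodule.add_mem _ (W.fil_anti _ (Nat.zero_le _) (hΦ.sub_mem p))
    (W.single_self_mem_fil p (1 : ℂ))
  rwa [sub_add_cancel] at h

theorem coef_mulDefect_cocycle (hB : IsStar W L B) (hB' : IsStar W L B')
    (hBa : ∀ x y z, assoc B x y z = 0) (hBa' : ∀ x y z, assoc B' x y z = 0)
    {Φ : MonoSpace n →ₗ[ℂ] MonoSpace n} (hΦ : IsUnitriangular W Φ) {m : ℕ}
    (hD : ∀ p q, mulDefect B B' Φ (Finsupp.single p 1) (Finsupp.single q 1) ∈ W.fil ℂ (p + q) m)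
    {w : Fin n → ℤ} (hw : w ∈ W.level m) (p q r : Fin n → ℕ) :
    Complex.exp (twist L (intVec p) (intVec q)) * coef ℂ (intVec (p + q + r) + w)
        (mulDefect B B' Φ (Finsupp.single (p + q) 1) (Finsupp.single r 1))
      - Complex.exp (twist L (intVec q) (intVec r)) * coef ℂ (intVec (p + q + r) + w)
        (mulDefect B B' Φ (Finsupp.single p 1) (Finsupp.single (q + r) 1))
      + Complex.exp (twist L (intVec (p + q) + w) (intVec r)) * coef ℂ (intVec (p + q) + w)
        (mulDefect B B' Φ (Finsupp.single p 1) (Finsupp.single q 1))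
      - Complex.exp (twist L (intVec p) (intVec (q + r) + w)) * coef ℂ (intVec (q + r) + w)
        (mulDefect B B' Φ (Finsupp.single q 1) (Finsupp.single r 1)) = 0 := by
  have h := congrArg (coef ℂ (intVec (p + q + r) + w)) (mulDefect_cocycle hBa hBa' Φ
    (Finsupp.single p 1) (Finsupp.single q 1) (Finsupp.single r 1))
  have e1 := W.coef_apply_of_leading (f := (mulDefect B B' Φ).flip (Finsupp.single r 1)) (r := r)
    (fun t => hD t r) (hB.leading p q) hw
  have e2 := W.coef_apply_of_leading (f := mulDefect B B' Φ (Finsupp.single p 1)) (r := p)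
    (fun t => by
      rw [add_comm]
      exact hD p t) (hB.leading q r) hw
  have e3 := W.coef_eq_zero (show m < m + 1 by omega) hw
    (hB'.mul_mem_fil (hD p q) (hΦ.sub_mem r))
  have e4 := W.coef_eq_zero (show m < 1 + m by omega) hw
    (hB'.mul_mem_fil (hΦ.sub_mem p) (hD q r))
  have e5 := hB'.coef_right (q := r) (hD p q) hw
  have e6 := hB'.coef_left (p := p) (hD q r) hw
  rw [map_sub, map_sub, sub_eq_zero] at e3
  rw [map_sub, LinearMap.sub_apply, map_sub, sub_eq_zero] at e4
  rw [show q + r + p = p + q + r by abel] at e2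
  rw [← add_assoc] at e4 e6
  simp only [LinearMap.flip_apply] at e1
  simp only [map_add, map_sub, map_zero] at h
  rw [e1, e2, e3, e4, e5, e6] at h
  exact h

/-- Adding to Φ a map ψ of level m changes the defect at level m by a coboundary; the term quadratic
in ψ has level 2m ≥ m + 1. A primitive of the normalized defect therefore removes its level m part.
-/
theorem exists_unitriangular_correction (hB : IsStar W L B) (hB' : IsStar W L B')
    {Φ : MonoSpace n →ₗ[ℂ] MonoSpace n} (hΦ : IsUnitriangular W Φ) {m : ℕ} (hm : 1 ≤ m)
    (hD : ∀ p q, mulDefect B B' Φ (Finsupp.single p 1) (Finsupp.single q 1) ∈ W.fil ℂ (p + q) m)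
    (c : (Fin n → ℤ) → (Fin n → ℕ) → ℂ) (zero : ∀ w, c w 0 = 0)
    (supp : ∀ w p, c w p ≠ 0 → 0 ≤ intVec p + w)
    (heq : ∀ w ∈ W.level m, ∀ p q, coef ℂ (intVec (p + q) + w)
      (mulDefect B B' Φ (Finsupp.single p 1) (Finsupp.single q 1)) =
        Complex.exp (twist₂ L w p q) * (c w q - c w (p + q) + twistChar L w q * c w p)) :
    ∃ Φ' : MonoSpace n →ₗ[ℂ] MonoSpace n, IsUnitriangular W Φ' ∧
      ∀ p q, mulDefect B B' Φ' (Finsupp.single p 1) (Finsupp.single q 1) ∈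
        W.fil ℂ (p + q) (m + 1) := by
  have hex : ∀ p : Fin n → ℕ, ∃ x ∈ W.fil ℂ p m, (∀ w ∈ W.level m,
      coef ℂ (intVec p + w) x = Complex.exp (twist L (intVec p) w) * c w p) ∧
      (p = 0 → x = 0) := by
    intro p
    by_cases h : p = 0
    · refine ⟨0, Submodule.zero_mem _, fun w _ => ?_, fun _ => rfl⟩
      rw [h, zero, mul_zero, map_zero]
    · obtain ⟨x, hx, hx'⟩ := W.exists_mem_fil_coef p m
        (fun w => Complex.exp (twist L (intVec p) w) * c w p) (fun w hw => by
          exact supp w p (right_ne_zero_of_mul hw))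
      exact ⟨x, hx, hx', fun h' => absurd h' h⟩
  choose g hg hgc hg0 using hex
  obtain ⟨ψ, hψ⟩ : ∃ ψ : MonoSpace n →ₗ[ℂ] MonoSpace n, ∀ p, ψ (Finsupp.single p 1) = g p :=
    ⟨Finsupp.linearCombination ℂ g, fun p => by simp⟩
  have hψm : ∀ p, ψ (Finsupp.single p 1) ∈ W.fil ℂ p m := fun p => by
    rw [hψ]
    exact hg p
  have hψc : ∀ w ∈ W.level m, ∀ p, coef ℂ (intVec p + w) (ψ (Finsupp.single p 1)) =
      Complex.exp (twist L (intVec p) w) * c w p := fun w hw p => by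
    rw [hψ]
    exact hgc p w hw
  refine ⟨Φ + ψ, ⟨fun p => ?_, ?_⟩, fun p q => ?_⟩
  · rw [LinearMap.add_apply, add_sub_right_comm]
    exact Submodule.add_mem _ (hΦ.sub_mem p) (W.fil_anti _ hm (hψm p))
  · rw [LinearMap.add_apply, hΦ.map_one, hψ, hg0 0 rfl, add_zero]
  · have hψm' : ∀ t, ψ (Finsupp.single t 1) ∈ W.fil ℂ (t + 0) m := fun t => by
      rw [add_zero]
      exact hψm t
    have m1 := W.apply_mem_fil hψm' (hB.mem_fil p q)
    have m2 := hB'.mul_mem_fil (hψm p) (hΦ.mem_fil q)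
    have m3 := hB'.mul_mem_fil (hΦ.mem_fil p) (hψm q)
    have m4 := hB'.mul_mem_fil (hψm p) (hψm q)
    rw [zero_add] at m1 m3
    rw [add_zero] at m1 m2
    have hexp : mulDefect B B' (Φ + ψ) (Finsupp.single p 1) (Finsupp.single q 1) =
        mulDefect B B' Φ (Finsupp.single p 1) (Finsupp.single q 1)
        + ψ (B (Finsupp.single p 1) (Finsupp.single q 1))
        - B' (ψ (Finsupp.single p 1)) (Φ (Finsupp.single q 1))
        - B' (Φ (Finsupp.single p 1)) (ψ (Finsupp.single q 1))
        - B' (ψ (Finsupp.single p 1)) (ψ (Finsupp.single q 1)) := by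
      simp only [mulDefect_apply, LinearMap.add_apply, map_add]
      abel
    rw [hexp]
    refine Submodule.sub_mem _ (W.mem_fil_succ ?_ fun w hw => ?_) (W.fil_anti _ (by omega) m4)
    · exact Submodule.sub_mem _ (Submodule.sub_mem _ (Submodule.add_mem _ (hD p q) m1) m2) m3
    · have c1 := W.coef_apply_of_leading hψm' (hB.leading p q) hw
      have c2 := W.coef_eq_zero (show m < m + 1 by omega) hw
        (hB'.mul_mem_fil (hψm p) (hΦ.sub_mem q))
      have c3 := W.coef_eq_zero (show m < 1 + m by omega) hw
        (hB'.mul_mem_fil (hΦ.sub_mem p) (hψm q))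
      rw [map_sub, map_sub, sub_eq_zero] at c2
      rw [map_sub, LinearMap.sub_apply, map_sub, sub_eq_zero] at c3
      rw [add_zero] at c1
      have k1 := hψc w hw (p + q)
      have k2 := hψc w hw p
      have k3 := hψc w hw q
      simp only [map_sub, map_add]
      rw [heq w hw, c1, c2, c3, hB'.coef_right (hψm p) hw, hB'.coef_left (hψm q) hw, k1, k2, k3]
      simp only [← mul_assoc]
      rw [show Complex.exp (twist L (intVec p + w) (intVec q)) *
          Complex.exp (twist L (intVec p) w) =
            Complex.exp (twist₂ L w p q) * twistChar L w q from ?_,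
        show Complex.exp (twist L (intVec p) (intVec q)) *
          Complex.exp (twist L (intVec (p + q)) w) = Complex.exp (twist₂ L w p q) from ?_,
        show Complex.exp (twist L (intVec p) (intVec q + w)) *
          Complex.exp (twist L (intVec q) w) = Complex.exp (twist₂ L w p q) from ?_]
      · ring
      · simp only [← Complex.exp_add]
        congr 1
        simp only [twist₂, intVec_add, twist_add_left, twist_add_right]
        ring
      · rw [twist₂, ← Complex.exp_add]
      · simp only [twistChar, ← Complex.exp_add]
        congr 1
        simp only [twist₂, intVec_add, twist_add_left]
        ring

/-- Reduces the correction to the vanishing of one class, which symmetry provides at level one and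
rigidity above. The formula for F is passed to the hypothesis because level one needs to know the
cocycle itself. -/
theorem exists_unitriangular_correction_of_cohomology (hB : IsStar W L B) (hB' : IsStar W L B')
    (hBa : ∀ x y z, assoc B x y z = 0) (hBa' : ∀ x y z, assoc B' x y z = 0)
    {Φ : MonoSpace n →ₗ[ℂ] MonoSpace n} (hΦ : IsUnitriangular W Φ) {m : ℕ} (hm : 1 ≤ m)
    (hD : ∀ p q, mulDefect B B' Φ (Finsupp.single p 1) (Finsupp.single q 1) ∈ W.fil ℂ (p + q) m)
    (hvan : ∀ w ∈ W.level m, ∀ F : (Fin n → ℕ) → (Fin n → ℕ) → ℂ,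
      (∀ p q, F p q = Complex.exp (-twist₂ L w p q) * coef ℂ (intVec (p + q) + w)
        (mulDefect B B' Φ (Finsupp.single p 1) (Finsupp.single q 1))) →
      (∀ q, F 0 q = 0) → (∀ p, F p 0 = 0) → (∀ p q, F p q ≠ 0 → 0 ≤ intVec (p + q) + w) →
      (∀ p q r, F q r - F (p + q) r + F p (q + r) - twistChar L w r * F p q = 0) →
      ∃ c : (Fin n → ℕ) → ℂ, c 0 = 0 ∧ (∀ p, c p ≠ 0 → 0 ≤ intVec p + w) ∧
        ∀ p q, F p q = c q - c (p + q) + twistChar L w q * c p) :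
    ∃ Φ' : MonoSpace n →ₗ[ℂ] MonoSpace n, IsUnitriangular W Φ' ∧
      ∀ p q, mulDefect B B' Φ' (Finsupp.single p 1) (Finsupp.single q 1) ∈
        W.fil ℂ (p + q) (m + 1) := by
  have hex : ∀ w : Fin n → ℤ, ∃ c : (Fin n → ℕ) → ℂ, c 0 = 0 ∧
      (∀ p, c p ≠ 0 → 0 ≤ intVec p + w) ∧
      (w ∈ W.level m → ∀ p q, coef ℂ (intVec (p + q) + w)
        (mulDefect B B' Φ (Finsupp.single p 1) (Finsupp.single q 1)) =
        Complex.exp (twist₂ L w p q) * (c q - c (p + q) + twistChar L w q * c p)) := by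
    intro w
    by_cases hw : w ∈ W.level m
    · obtain ⟨c, h1, h2, h3⟩ := hvan w hw _ (fun p q => rfl)
        (fun q => by simp [mulDefect_apply, hB.one_mul, hΦ.map_one, hB'.one_mul])
        (fun p => by simp [mulDefect_apply, hB.mul_one, hΦ.map_one, hB'.mul_one])
        (fun p q hne => by
          by_contra h
          rw [coef_of_not_nonneg h, mul_zero] at hne
          exact hne rfl) (fun p q r => by
          have h := congrArg (fun z => -Complex.exp (-(twist L (intVec p) (intVec q)
            + twist₂ L w (p + q) r)) * z)
            (coef_mulDefect_cocycle hB hB' hBa hBa' hΦ hD hw p q r)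
          simp only [mul_zero, mul_sub, mul_add, neg_mul, ← mul_assoc, ← Complex.exp_add] at h
          rw [← h]
          simp only [twistChar, ← mul_assoc, ← Complex.exp_add]
          have e1 : -twist₂ L w q r = -(twist L (intVec p) (intVec q) + twist₂ L w (p + q) r) +
              twist L (intVec p) (intVec (q + r) + w) := by
            simp only [twist₂, intVec_add, twist_add_left, twist_add_right]
            ring
          have e2 : -twist₂ L w (p + q) r = -(twist L (intVec p) (intVec q)
              + twist₂ L w (p + q) r) + twist L (intVec p) (intVec q) := by
            ring
          have e3 : -twist₂ L w p (q + r) = -(twist L (intVec p) (intVec q)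
              + twist₂ L w (p + q) r) + twist L (intVec q) (intVec r) := by
            simp only [twist₂, intVec_add, twist_add_left, twist_add_right]
            ring
          have e4 : twist L w (intVec r) - twist L (intVec r) w + -twist₂ L w p q =
              -(twist L (intVec p) (intVec q) + twist₂ L w (p + q) r)
                + twist L (intVec (p + q) + w) (intVec r) := by
            simp only [twist₂, intVec_add, twist_add_left]
            ring
          rw [e4, ← e1, ← e2, ← e3, show p + (q + r) = p + q + r by abel]
          ring)
      refine ⟨c, h1, h2, fun _ p q => ?_⟩
      rw [← h3, ← mul_assoc, ← Complex.exp_add, add_neg_cancel, Complex.exp_zero, _root_.one_mul]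
    · exact ⟨fun _ => 0, rfl, fun _ h => absurd rfl h, fun h => absurd h hw⟩
  choose c h1 h2 h3 using hex
  exact exists_unitriangular_correction hB hB' hΦ hm hD c h1 h2 h3

/-- Two associative filtered deformations with the same first order commutators are isomorphic up
to arbitrarily high order. -/
theorem exists_unitriangular (hrig : ∀ m, 2 ≤ m → ∀ w ∈ W.level m, IsRigid L w)
    (hB : IsStar W L B) (hB' : IsStar W L B')
    (hBa : ∀ x y z, assoc B x y z = 0) (hBa' : ∀ x y z, assoc B' x y z = 0)
    (hcomm : ∀ w ∈ W.level 1, ∀ i j : Fin n, i < j →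
      coef ℂ (intVec (Pi.single i 1 + Pi.single j 1) + w)
          (B (Finsupp.single (Pi.single j 1) 1) (Finsupp.single (Pi.single i 1) 1)
            - entrywiseExp L j i •
              B (Finsupp.single (Pi.single i 1) 1) (Finsupp.single (Pi.single j 1) 1)) =
      coef ℂ (intVec (Pi.single i 1 + Pi.single j 1) + w)
          (B' (Finsupp.single (Pi.single j 1) 1) (Finsupp.single (Pi.single i 1) 1)
            - entrywiseExp L j i •
              B' (Finsupp.single (Pi.single i 1) 1) (Finsupp.single (Pi.single j 1) 1)))
    (m : ℕ) :
    ∃ Φ : MonoSpace n →ₗ[ℂ] MonoSpace n, IsUnitriangular W Φ ∧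
      ∀ p q, mulDefect B B' Φ (Finsupp.single p 1) (Finsupp.single q 1) ∈ W.fil ℂ (p + q) m := by
  have hstart : ∃ Φ : MonoSpace n →ₗ[ℂ] MonoSpace n, IsUnitriangular W Φ ∧
      ∀ p q, mulDefect B B' Φ (Finsupp.single p 1) (Finsupp.single q 1) ∈ W.fil ℂ (p + q) 2 := by
    -- The identity already agrees with both leading terms. Level one weights need not be rigid, but
    -- equality of the commutators makes the defect symmetric on the generators, which suffices.
    refine exists_unitriangular_correction_of_cohomology (Φ := LinearMap.id) (m := 1) hB hB' hBa hBa'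
      ⟨fun p => ?_, rfl⟩ le_rfl (fun p q => ?_) ?_
    · rw [LinearMap.id_apply, sub_self]
      exact Submodule.zero_mem _
    · have := Submodule.sub_mem _ (hB.leading p q) (hB'.leading p q)
      rwa [sub_sub_sub_cancel_right] at this
    · intro w hw F hF h1 h2 h3 h4
      refine exists_cochain_one_of_symmetric (twistChar L w) (twistChar_zero L w)
        (twistChar_add L w) (fun p => 0 ≤ intVec p + w) (fun p q h hp => nonneg_add_of_le h hp) F
        h1 h2 h3 h4 ?_
      have key : ∀ i j : Fin n, i < j → F (Pi.single i 1) (Pi.single j 1) =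
          F (Pi.single j 1) (Pi.single i 1) := by
        intro i j hij
        have h := hcomm w hw i j hij
        have t1 : twist₂ L w (Pi.single j 1) (Pi.single i 1) =
            L j i + twist L (intVec (Pi.single i 1 + Pi.single j 1)) w := by
          rw [twist₂, intVec_single, intVec_single, twist_single_single, if_pos hij,
            add_comm (Pi.single j 1)]
        have t2 : twist₂ L w (Pi.single i 1) (Pi.single j 1) =
            twist L (intVec (Pi.single i 1 + Pi.single j 1)) w := by
          rw [twist₂, intVec_single, intVec_single, twist_single_single, if_neg hij.asymm,
            zero_add]
        have hexp : Complex.exp (-twist L (intVec (Pi.single i 1 + Pi.single j 1)) w) =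
            Complex.exp (-(L j i + twist L (intVec (Pi.single i 1 + Pi.single j 1)) w))
              * entrywiseExp L j i := by
          rw [entrywiseExp, ← Complex.exp_add]
          congr 1
          ring
        rw [hF, hF, t1, t2, hexp, mul_assoc, add_comm (Pi.single j 1)]
        congr 1
        simp only [mulDefect_apply, LinearMap.id_apply, map_sub, map_smul, smul_eq_mul] at h ⊢
        linear_combination -h
      intro i j
      rcases lt_trichotomy i j with h | h | h
      · exact key i j h
      · rw [h]
      · exact (key j i h).symm
  induction m with
  | zero =>
    obtain ⟨Φ, hΦ, hD⟩ := hstart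
    exact ⟨Φ, hΦ, fun p q => W.fil_anti _ (by omega) (hD p q)⟩
  | succ m ih =>
    by_cases hm : m ≤ 1
    · obtain ⟨Φ, hΦ, hD⟩ := hstart
      exact ⟨Φ, hΦ, fun p q => W.fil_anti _ (by omega) (hD p q)⟩
    · obtain ⟨Φ, hΦ, hD⟩ := ih
      exact exists_unitriangular_correction_of_cohomology hB hB' hBa hBa' hΦ (by omega) hD
        fun w hw F _ h1 h2 h3 h4 => (hrig m (by omega) w hw).exists_cochain_one F h1 h2 h3 h4

end WeightSystem

/-! ### Words and sorted words -/

section Words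

variable {n : ℕ}

/-- The exponent vector of a word. -/
def expo (l : List (Fin n)) : Fin n → ℕ := fun i => l.count i

@[simp] theorem expo_nil : expo ([] : List (Fin n)) = 0 := by
  ext i
  simp [expo]

theorem expo_cons (i : Fin n) (l : List (Fin n)) : expo (i :: l) = Pi.single i 1 + expo l := by
  ext k
  simp only [expo, List.count_cons, Pi.add_apply, Pi.single_apply, beq_iff_eq]
  rw [add_comm]
  simp only [eq_comm]

theorem expo_append (l l' : List (Fin n)) : expo (l ++ l') = expo l + expo l' := by
  ext k
  simp [expo]

theorem expo_ne_zero_iff {l : List (Fin n)} {k : Fin n} : expo l k ≠ 0 ↔ k ∈ l := by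
  simp [expo, List.count_eq_zero]

/-- The multiset of letters with given multiplicities. -/
def letters (p : Fin n → ℕ) : Multiset (Fin n) := ∑ i, p i • {i}

theorem count_letters (p : Fin n → ℕ) (k : Fin n) : (letters p).count k = p k := by
  rw [letters, Multiset.count_sum', Finset.sum_eq_single k]
  · simp
  · intro i _ hi
    simp [hi.symm]
  · simp

theorem letters_single_add (i : Fin n) (p : Fin n → ℕ) :
    letters (Pi.single i 1 + p) = i ::ₘ letters p := by
  ext k
  rw [count_letters, Multiset.count_cons, count_letters, Pi.add_apply, Pi.single_apply, add_comm]

theorem mem_letters {p : Fin n → ℕ} {k : Fin n} : k ∈ letters p ↔ p k ≠ 0 := by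
  rw [← Multiset.count_ne_zero, count_letters]

/-- The sorted word with given exponents. -/
def sortedList (p : Fin n → ℕ) : List (Fin n) := (letters p).sort

@[simp] theorem expo_sortedList (p : Fin n → ℕ) : expo (sortedList p) = p := by
  ext k
  rw [expo, ← Multiset.coe_count, sortedList, Multiset.sort_eq, count_letters]

theorem sortedList_zero : sortedList (0 : Fin n → ℕ) = [] := by
  simp [sortedList, letters]

theorem sortedList_single_add {i : Fin n} {p : Fin n → ℕ} (h : ∀ k, p k ≠ 0 → i ≤ k) :
    sortedList (Pi.single i 1 + p) = i :: sortedList p := by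
  rw [sortedList, letters_single_add, Multiset.sort_cons]
  · rfl
  · exact fun k hk => h k (mem_letters.1 hk)

theorem sortedList_single (i : Fin n) : sortedList (Pi.single i 1) = [i] := by
  rw [← add_zero (Pi.single i 1), sortedList_single_add (by simp), sortedList_zero]

theorem sortedList_single_add_single {i j : Fin n} (h : i ≤ j) :
    sortedList (Pi.single i 1 + Pi.single j 1) = [i, j] := by
  rw [sortedList_single_add, sortedList_single]
  intro k hk
  by_cases hkj : k = j
  · rwa [hkj]
  · simp [hkj] at hk

theorem exists_eq_single_add {p : Fin n → ℕ} (hp : p ≠ 0) :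
    ∃ (j : Fin n) (p' : Fin n → ℕ), p = Pi.single j 1 + p' ∧ ∀ k, p k ≠ 0 → j ≤ k := by
  classical
  obtain ⟨k, hk⟩ : ∃ k, p k ≠ 0 := by
    by_contra h
    push Not at h
    exact hp (funext h)
  obtain ⟨j, hj, hmin⟩ := Finset.exists_min_image (Finset.univ.filter fun k => p k ≠ 0) id
    ⟨k, by simp [hk]⟩
  simp only [Finset.mem_filter, Finset.mem_univ, true_and, id] at hj hmin
  refine ⟨j, p - Pi.single j 1, ?_, hmin⟩
  ext i
  by_cases hi : i = j
  · subst hi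
    simp
    omega
  · simp [hi]

variable (L : Matrix (Fin n) (Fin n) ℂ)

theorem twist_single_left_eq_zero {i : Fin n} {p : Fin n → ℕ} (h : ∀ k, p k ≠ 0 → i ≤ k) :
    twist L (Pi.single i 1) (intVec p) = 0 := by
  refine Finset.sum_eq_zero fun a _ => Finset.sum_eq_zero fun k _ => ?_
  split_ifs with hk
  · by_cases ha : a = i
    · subst ha
      have : p k = 0 := by
        by_contra hne
        exact absurd (h k hne) (not_le.2 hk)
      simp [this]
    · simp [ha]
  · rfl

/-- The exponent of the scalar arising from sorting a word. -/
noncomputable def listTwist : List (Fin n) → ℂ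
  | [] => 0
  | i :: l => twist L (Pi.single i 1) (intVec (expo l)) + listTwist l

theorem listTwist_append (l l' : List (Fin n)) :
    listTwist L (l ++ l') =
      listTwist L l + listTwist L l' + twist L (intVec (expo l)) (intVec (expo l')) := by
  induction l with
  | nil => simp [listTwist]
  | cons i l ih =>
    rw [List.cons_append, listTwist, listTwist, ih, expo_append, expo_cons, intVec_add, intVec_add,
      twist_add_left, twist_add_right, intVec_single]
    ring

theorem listTwist_eq_zero_of_pairwise {l : List (Fin n)} (h : l.Pairwise (· ≤ ·)) :
    listTwist L l = 0 := by
  induction l with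
  | nil => rfl
  | cons i l ih =>
    rw [List.pairwise_cons] at h
    rw [listTwist, ih h.2, twist_single_left_eq_zero, add_zero]
    exact fun k hk => h.1 k (expo_ne_zero_iff.1 hk)

theorem listTwist_sortedList (p : Fin n → ℕ) : listTwist L (sortedList p) = 0 :=
  listTwist_eq_zero_of_pairwise L (Multiset.pairwise_sort _ _)

end Words

/-! ### Words as noncommutative monomials -/

section WordMonomial

variable {n : ℕ} (R : Type*) [CommRing R]

theorem wordMonomial_nil : wordMonomial R ([] : List (Fin n)) = 1 := rfl

theorem wordMonomial_cons (i : Fin n) (l : List (Fin n)) :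
    wordMonomial R (i :: l) = FreeAlgebra.ι R i * wordMonomial R l := by
  simp [wordMonomial]

theorem wordMonomial_append (l l' : List (Fin n)) :
    wordMonomial R (l ++ l') = wordMonomial R l * wordMonomial R l' := by
  simp [wordMonomial]

theorem wordMonomial_singleton (i : Fin n) : wordMonomial R [i] = FreeAlgebra.ι R i := by
  simp [wordMonomial]

theorem wordMonomial_pair (i j : Fin n) :
    wordMonomial R [i, j] = FreeAlgebra.ι R i * FreeAlgebra.ι R j := by
  simp [wordMonomial]

theorem span_range_wordMonomial :
    Submodule.span R (Set.range (wordMonomial R : List (Fin n) → FreeAlgebra R (Fin n))) = ⊤ := by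
  rw [eq_top_iff]
  rintro f -
  induction f using FreeAlgebra.induction with
  | grade0 r =>
    rw [Algebra.algebraMap_eq_smul_one]
    exact Submodule.smul_mem _ _ (Submodule.subset_span ⟨[], rfl⟩)
  | grade1 i => exact Submodule.subset_span ⟨[i], wordMonomial_singleton R i⟩
  | add f g hf hg => exact Submodule.add_mem _ hf hg
  | mul f g hf hg =>
    have h := Submodule.mul_mem_mul hf hg
    rw [Submodule.span_mul_span] at h
    refine Submodule.span_mono ?_ h
    rintro _ ⟨_, ⟨l, rfl⟩, _, ⟨l', rfl⟩, rfl⟩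
    exact ⟨l ++ l', wordMonomial_append R l l'⟩

/-- The linear map sending the basis vectors to the sorted words. -/
noncomputable def sortedSection :
    ((Fin n → ℕ) →₀ R) →ₗ[R] FreeAlgebra R (Fin n) :=
  Finsupp.linearCombination R fun p => wordMonomial R (sortedList p)

@[simp] theorem sortedSection_single (p : Fin n → ℕ) :
    sortedSection R (Finsupp.single p 1) = wordMonomial R (sortedList p) := by
  simp [sortedSection]

variable {R}

/-- The submodule underlying a two-sided ideal of a free algebra. -/
def idealSubmodule (J : TwoSidedIdeal (FreeAlgebra R (Fin n))) :
    Submodule R (FreeAlgebra R (Fin n)) :=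
  (TwoSidedIdeal.asIdeal J).restrictScalars R

@[simp] theorem mem_idealSubmodule {J : TwoSidedIdeal (FreeAlgebra R (Fin n))}
    {f : FreeAlgebra R (Fin n)} : f ∈ idealSubmodule J ↔ f ∈ J := Iff.rfl

theorem TwoSidedIdeal.smul_mem_freeAlgebra {J : TwoSidedIdeal (FreeAlgebra R (Fin n))}
    {f : FreeAlgebra R (Fin n)} (r : R) (hf : f ∈ J) : r • f ∈ J :=
  (idealSubmodule J).smul_mem r hf

end WordMonomial

/-! ### Quadratic relations -/

section Relations

variable {n : ℕ} (R : Type*) [CommRing R] [Algebra ℂ R] (L : Matrix (Fin n) (Fin n) ℂ)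
  (c : Fin n → Fin n → Fin n → Fin n → R)

/-- A deformed commutation relation. -/
noncomputable def quadRelation (x y : Fin n) : FreeAlgebra R (Fin n) :=
  -(FreeAlgebra.ι R y * FreeAlgebra.ι R x)
    + algebraMap ℂ R (entrywiseExp L y x) • (FreeAlgebra.ι R x * FreeAlgebra.ι R y)
    + ∑ k, ∑ l, c y x k l • (FreeAlgebra.ι R k * FreeAlgebra.ι R l)

/-- The ideal generated by deformed commutation relations. -/
noncomputable def quadIdeal : TwoSidedIdeal (FreeAlgebra R (Fin n)) :=
  TwoSidedIdeal.span {f | ∃ x y, x < y ∧ f = quadRelation R L c x y}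

theorem quadRelation_mem_quadIdeal {x y : Fin n} (h : x < y) :
    quadRelation R L c x y ∈ quadIdeal R L c :=
  TwoSidedIdeal.subset_span ⟨x, y, h, rfl⟩

variable {R}

/-- The coefficients of the deformed relations are of positive level and involve only sorted
words. -/
def IsTriangular (W : WeightSystem n) (c : Fin n → Fin n → Fin n → Fin n → R) : Prop :=
  ∀ x y k l, x < y → c y x k l ≠ 0 → k ≤ l ∧ ∃ m, 1 ≤ m ∧ quadWeight x y k l ∈ W.level m

end Relations

/-! ### Sorted words modulo an ideal, filtered by level -/

section Cover

variable {n : ℕ} {R : Type*} [CommRing R]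

namespace WeightSystem

variable (W : WeightSystem n)

/-- The span of an ideal and of the sorted words above a given exponent vector. -/
noncomputable def cover (J : TwoSidedIdeal (FreeAlgebra R (Fin n))) (p : Fin n → ℕ) (m : ℕ) :
    Submodule R (FreeAlgebra R (Fin n)) :=
  idealSubmodule J ⊔ (W.fil R p m).map (sortedSection R)

variable {W}

theorem cover_le (J : TwoSidedIdeal (FreeAlgebra R (Fin n))) {p s : Fin n → ℕ} {k m a : ℕ}
    (h : intVec s - intVec p ∈ W.level k) (ha : a ≤ k + m) : W.cover J s m ≤ W.cover J p a :=
  sup_le_sup_left (Submodule.map_mono (W.fil_le h ha)) _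

theorem mem_cover_of_mem {J : TwoSidedIdeal (FreeAlgebra R (Fin n))} {f : FreeAlgebra R (Fin n)}
    (hf : f ∈ J) (p : Fin n → ℕ) (m : ℕ) : f ∈ W.cover J p m :=
  Submodule.mem_sup_left hf

theorem sorted_mem_cover (J : TwoSidedIdeal (FreeAlgebra R (Fin n))) (p : Fin n → ℕ) :
    wordMonomial R (sortedList p) ∈ W.cover J p 0 :=
  Submodule.mem_sup_right ⟨Finsupp.single p 1, W.single_self_mem_fil p 1,
    sortedSection_single R p⟩

/-- The ideal absorbs multiplication, so only sorted words matter. The hypothesis is restricted to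
those above p so that an induction on depth can supply it. -/
theorem mul_mem_cover {J : TwoSidedIdeal (FreeAlgebra R (Fin n))} {i : Fin n} {p : Fin n → ℕ}
    {m : ℕ} (h : ∀ s k, m ≤ k → intVec s - intVec p ∈ W.level k →
      FreeAlgebra.ι R i * wordMonomial R (sortedList s) ∈ W.cover J (Pi.single i 1 + s) 0)
    {f : FreeAlgebra R (Fin n)} (hf : f ∈ W.cover J p m) :
    FreeAlgebra.ι R i * f ∈ W.cover J (Pi.single i 1 + p) m := by
  obtain ⟨g, hg, _, ⟨x, hx, rfl⟩, rfl⟩ := Submodule.mem_sup.1 hf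
  rw [mul_add]
  refine Submodule.add_mem _ (mem_cover_of_mem (J.mul_mem_left _ _ hg) _ _) ?_
  change ((LinearMap.mulLeft R (FreeAlgebra.ι R i)).comp (sortedSection R)) x ∈ _
  refine W.map_mem_of_mem_fil _ _ (fun s k hk hs => ?_) hx
  rw [LinearMap.comp_apply, sortedSection_single, LinearMap.mulLeft_apply]
  refine cover_le J (k := k) (m := 0) ?_ (by omega) (h s k hk hs)
  rwa [intVec_add, intVec_add, add_sub_add_left_eq_sub]

theorem intVec_sub_eq_quadWeight (x y k l : Fin n) (p : Fin n → ℕ) :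
    intVec (Pi.single k 1 + (Pi.single l 1 + p)) - intVec (Pi.single y 1 + (Pi.single x 1 + p)) =
      quadWeight x y k l := by
  simp only [quadWeight, intVec_add, intVec_single]
  abel

end WeightSystem

end Cover

/-! ### Straightening words by the relations -/

section Straightening

namespace WeightSystem

variable {n : ℕ} {W : WeightSystem n} {R : Type*} [CommRing R] [Algebra ℂ R]
  {L : Matrix (Fin n) (Fin n) ℂ} {c : Fin n → Fin n → Fin n → Fin n → R}
  {J : TwoSidedIdeal (FreeAlgebra R (Fin n))}

theorem sub_mem_of_mul_sorted {i : Fin n} {p : Fin n → ℕ}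
    (h : FreeAlgebra.ι R i * wordMonomial R (sortedList p)
      - algebraMap ℂ R (Complex.exp (twist L (Pi.single i 1) (intVec p))) •
        wordMonomial R (sortedList (Pi.single i 1 + p)) ∈ W.cover J (Pi.single i 1 + p) 1) :
    FreeAlgebra.ι R i * wordMonomial R (sortedList p) ∈ W.cover J (Pi.single i 1 + p) 0 := by
  have h1 : W.cover J (Pi.single i 1 + p) 1 ≤ W.cover J (Pi.single i 1 + p) 0 :=
    cover_le J (k := 0) (by simpa using W.zero_mem) (by omega)
  have h2 := Submodule.add_mem _ (h1 h) (Submodule.smul_mem _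
    (algebraMap ℂ R (Complex.exp (twist L (Pi.single i 1) (intVec p))))
    (sorted_mem_cover J (Pi.single i 1 + p)))
  rwa [sub_add_cancel] at h2

/-- Modulo the relations, left multiplication by a variable maps sorted words to multiples of
sorted words, up to terms of higher level. -/
theorem mul_sorted_mem_cover (hc : IsTriangular W c) (hJ : ∀ x y, x < y → quadRelation R L c x y ∈ J)
    (i : Fin n) (p : Fin n → ℕ) :
    FreeAlgebra.ι R i * wordMonomial R (sortedList p)
      - algebraMap ℂ R (Complex.exp (twist L (Pi.single i 1) (intVec p))) •
        wordMonomial R (sortedList (Pi.single i 1 + p)) ∈ W.cover J (Pi.single i 1 + p) 1 := by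
  -- Double induction on the degree of p and the depth of e_i + p. Exchanging x_i with a smaller
  -- first letter x_j leaves a product with a word of smaller degree, and the correction terms have
  -- higher level, hence smaller depth.
  suffices H : ∀ N D (i : Fin n) (p : Fin n → ℕ), ∑ k, p k = N → W.depth (Pi.single i 1 + p) = D →
      FreeAlgebra.ι R i * wordMonomial R (sortedList p)
        - algebraMap ℂ R (Complex.exp (twist L (Pi.single i 1) (intVec p))) •
          wordMonomial R (sortedList (Pi.single i 1 + p)) ∈ W.cover J (Pi.single i 1 + p) 1 from
    H _ _ i p rfl rfl
  clear i p
  intro N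
  induction N using Nat.strong_induction_on with
  | _ N ihN =>
  intro D
  induction D using Nat.strong_induction_on with
  | _ D ihD =>
  intro i p hN hD
  by_cases hmin : ∀ k, p k ≠ 0 → i ≤ k
  · rw [sortedList_single_add hmin, wordMonomial_cons, twist_single_left_eq_zero L hmin,
      Complex.exp_zero, map_one, one_smul, sub_self]
    exact Submodule.zero_mem _
  · have hp : p ≠ 0 := by
      rintro rfl
      exact hmin fun k hk => absurd rfl hk
    obtain ⟨j, p', rfl, hj⟩ := exists_eq_single_add hp
    have hji : j < i := by
      by_contra h
      exact hmin fun k hk => (not_lt.1 h).trans (hj k hk)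
    have hj' : ∀ k, p' k ≠ 0 → j ≤ k := fun k hk => hj k (by
      simp only [Pi.add_apply]
      omega)
    have hj'' : ∀ k, (Pi.single i 1 + p' : Fin n → ℕ) k ≠ 0 → j ≤ k := by
      intro k hk
      by_cases hki : k = i
      · exact hki ▸ hji.le
      · exact hj' k (by simpa [hki] using hk)
    have hN' : ∑ k, p' k + 1 = N := by
      rw [← hN]
      simp [Finset.sum_add_distrib, add_comm]
    have hsum : ∀ a : Fin n, ∑ k, (Pi.single a 1 + p' : Fin n → ℕ) k = N := by
      intro a
      rw [← hN']
      simp [Finset.sum_add_distrib, add_comm]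
    have hweak : ∀ (a : Fin n) (s : Fin n → ℕ), ∑ k, s k = N → W.depth (Pi.single a 1 + s) < D →
        FreeAlgebra.ι R a * wordMonomial R (sortedList s) ∈ W.cover J (Pi.single a 1 + s) 0 :=
      fun a s hs hd => sub_mem_of_mul_sorted (ihD _ hd a s hs rfl)
    have key : FreeAlgebra.ι R i * wordMonomial R (sortedList (Pi.single j 1 + p'))
        - algebraMap ℂ R (Complex.exp (twist L (Pi.single i 1) (intVec (Pi.single j 1 + p')))) •
          wordMonomial R (sortedList (Pi.single i 1 + (Pi.single j 1 + p'))) =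
        -(quadRelation R L c j i * wordMonomial R (sortedList p'))
        + algebraMap ℂ R (entrywiseExp L i j) • (FreeAlgebra.ι R j *
          (FreeAlgebra.ι R i * wordMonomial R (sortedList p')
            - algebraMap ℂ R (Complex.exp (twist L (Pi.single i 1) (intVec p'))) •
              wordMonomial R (sortedList (Pi.single i 1 + p'))))
        + ∑ k, ∑ l, c i j k l •
          (FreeAlgebra.ι R k * (FreeAlgebra.ι R l * wordMonomial R (sortedList p'))) := by
      have e1 : Complex.exp (twist L (Pi.single i 1) (intVec (Pi.single j 1 + p'))) =
          entrywiseExp L i j * Complex.exp (twist L (Pi.single i 1) (intVec p')) := by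
        rw [intVec_add, intVec_single, twist_add_right, twist_single_single, if_pos hji,
          Complex.exp_add]
        rfl
      rw [add_left_comm (Pi.single i 1), sortedList_single_add hj'', sortedList_single_add hj', e1]
      simp only [wordMonomial_cons, quadRelation, add_mul, neg_mul, mul_sub, smul_sub,
        mul_smul_comm, smul_mul_assoc, smul_smul, map_mul, Finset.sum_mul, mul_assoc]
      abel
    rw [key]
    refine Submodule.add_mem _ (Submodule.add_mem _ ?_ ?_) ?_
    · exact Submodule.neg_mem _ (mem_cover_of_mem (J.mul_mem_right _ _ (hJ j i hji)) _ _)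
    · refine Submodule.smul_mem _ _ ?_
      rw [add_left_comm (Pi.single i 1)] at hD ⊢
      refine mul_mem_cover (fun s k hk hs => ?_) (ihN _ (by omega) _ i p' rfl rfl)
      refine hweak j s ((W.sum_eq_of_sub_mem hs).trans (hsum i)) ?_
      have h1 : intVec (Pi.single j 1 + s) - intVec (Pi.single j 1 + (Pi.single i 1 + p')) ∈
          W.level k := by
        rwa [intVec_add, intVec_add, add_sub_add_left_eq_sub]
      have := W.depth_add_le h1
      omega
    · refine Submodule.sum_mem _ fun k _ => Submodule.sum_mem _ fun l _ => ?_
      by_cases hkl : c i j k l = 0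
      · rw [hkl, zero_smul]
        exact Submodule.zero_mem _
      · obtain ⟨-, m, hm, hlev⟩ := hc j i k l hji hkl
        rw [← intVec_sub_eq_quadWeight j i k l p'] at hlev
        refine Submodule.smul_mem _ _ (cover_le J hlev (m := 0) (by omega) ?_)
        refine mul_mem_cover (fun s a ha hs => ?_)
          (sub_mem_of_mul_sorted (ihN _ (by omega) _ l p' rfl rfl))
        refine hweak k s ((W.sum_eq_of_sub_mem hs).trans (hsum l)) ?_
        have h1 : intVec (Pi.single k 1 + s) - intVec (Pi.single k 1 + (Pi.single l 1 + p')) ∈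
            W.level a := by
          rwa [intVec_add, intVec_add, add_sub_add_left_eq_sub]
        have h2 := W.depth_add_le h1
        have h3 := W.depth_add_le hlev
        omega

/-- Modulo the relations, every word is a multiple of a sorted word, up to terms of higher
level. -/
theorem word_sub_sorted_mem_cover (hc : IsTriangular W c)
    (hJ : ∀ x y, x < y → quadRelation R L c x y ∈ J) (l : List (Fin n)) :
    wordMonomial R l - algebraMap ℂ R (Complex.exp (listTwist L l)) •
      wordMonomial R (sortedList (expo l)) ∈ W.cover J (expo l) 1 := by
  induction l with
  | nil =>
    rw [expo_nil, sortedList_zero, listTwist, Complex.exp_zero, map_one, one_smul, sub_self]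
    exact Submodule.zero_mem _
  | cons i l ih =>
    have key : wordMonomial R (i :: l) - algebraMap ℂ R (Complex.exp (listTwist L (i :: l))) •
        wordMonomial R (sortedList (expo (i :: l))) =
      FreeAlgebra.ι R i * (wordMonomial R l - algebraMap ℂ R (Complex.exp (listTwist L l)) •
        wordMonomial R (sortedList (expo l)))
      + algebraMap ℂ R (Complex.exp (listTwist L l)) •
        (FreeAlgebra.ι R i * wordMonomial R (sortedList (expo l))
          - algebraMap ℂ R (Complex.exp (twist L (Pi.single i 1) (intVec (expo l)))) •
            wordMonomial R (sortedList (Pi.single i 1 + expo l))) := by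
      rw [wordMonomial_cons, expo_cons, listTwist, mul_sub, smul_sub, mul_smul_comm, smul_smul,
        ← map_mul, ← Complex.exp_add, add_comm (listTwist L l)]
      abel
    rw [key, expo_cons]
    refine Submodule.add_mem _ ?_ (Submodule.smul_mem _ _ (mul_sorted_mem_cover hc hJ i _))
    exact mul_mem_cover (fun s _ _ _ => sub_mem_of_mul_sorted (mul_sorted_mem_cover hc hJ i s)) ih

theorem word_mem_cover (hc : IsTriangular W c)
    (hJ : ∀ x y, x < y → quadRelation R L c x y ∈ J) (l : List (Fin n)) :
    wordMonomial R l ∈ W.cover J (expo l) 0 := by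
  have h1 : W.cover J (expo l) 1 ≤ W.cover J (expo l) 0 :=
    cover_le J (k := 0) (by simpa using W.zero_mem) (by omega)
  have h2 := Submodule.add_mem _ (h1 (word_sub_sorted_mem_cover hc hJ l)) (Submodule.smul_mem _
    (algebraMap ℂ R (Complex.exp (listTwist L l))) (sorted_mem_cover J (expo l)))
  rwa [sub_add_cancel] at h2

/-- The spanning half of the Poincaré–Birkhoff–Witt property, valid for all triangular coefficients
without any flatness. -/
theorem exists_sub_sortedSection_mem (hc : IsTriangular W c)
    (hJ : ∀ x y, x < y → quadRelation R L c x y ∈ J) (f : FreeAlgebra R (Fin n)) :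
    ∃ x, f - sortedSection R x ∈ J := by
  have hf : f ∈ idealSubmodule J ⊔ LinearMap.range (sortedSection R) := by
    have h : f ∈ Submodule.span R (Set.range (wordMonomial R)) := by
      rw [span_range_wordMonomial]
      trivial
    refine Submodule.span_le.2 ?_ h
    rintro _ ⟨l, rfl⟩
    have hle : W.cover J (expo l) 0 ≤ idealSubmodule J ⊔ LinearMap.range (sortedSection R) :=
      sup_le_sup_left LinearMap.map_le_range _
    exact hle (word_mem_cover hc hJ l)
  obtain ⟨g, hg, _, ⟨x, rfl⟩, rfl⟩ := Submodule.mem_sup.1 hf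
  exact ⟨x, by simpa using hg⟩

end WeightSystem

end Straightening

/-! ### Normal forms -/

section NormalForm

variable {n : ℕ} {R : Type*} [CommRing R]

/-- The sorted words are linearly independent modulo an ideal. -/
def SortedIndependent (J : TwoSidedIdeal (FreeAlgebra R (Fin n))) : Prop :=
  ∀ x, sortedSection R x ∈ J → x = 0

/-- A linear normal form with respect to the basis of sorted words. -/
def IsNormalForm (J : TwoSidedIdeal (FreeAlgebra R (Fin n)))
    (κ : FreeAlgebra R (Fin n) →ₗ[R] ((Fin n → ℕ) →₀ R)) : Prop :=
  (∀ f, f - sortedSection R (κ f) ∈ J) ∧ (∀ x, κ (sortedSection R x) = x) ∧ ∀ f, κ f = 0 ↔ f ∈ J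

theorem SortedIndependent.exists_isNormalForm {J : TwoSidedIdeal (FreeAlgebra R (Fin n))}
    (hJ : SortedIndependent J) (hspan : ∀ f, ∃ x, f - sortedSection R x ∈ J) :
    ∃ κ, IsNormalForm J κ := by
  have huniq : ∀ x y, sortedSection R x - sortedSection R y ∈ J → x = y := fun x y h => by
    rw [← map_sub] at h
    exact sub_eq_zero.1 (hJ _ h)
  choose κ hκ using hspan
  have h2 : ∀ f g x, f - g ∈ J → g - sortedSection R x ∈ J → κ f = x := by
    intro f g x hfg hg
    refine huniq _ _ ?_
    have h := J.sub_mem (J.add_mem hfg hg) (hκ f)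
    rwa [show f - g + (g - sortedSection R x) - (f - sortedSection R (κ f)) =
      sortedSection R (κ f) - sortedSection R x by abel] at h
  refine ⟨{ toFun := κ, map_add' := fun f g => ?_, map_smul' := fun r f => ?_ }, hκ,
    fun x => ?_, fun f => ⟨fun h => ?_, fun h => ?_⟩⟩
  · refine h2 _ (f + g) _ (by rw [sub_self]; exact J.zero_mem) ?_
    rw [map_add, add_sub_add_comm]
    exact J.add_mem (hκ f) (hκ g)
  · refine h2 _ (r • f) _ (by rw [sub_self]; exact J.zero_mem) ?_
    rw [RingHom.id_apply, map_smul, ← smul_sub]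
    exact TwoSidedIdeal.smul_mem_freeAlgebra r (hκ f)
  · exact h2 _ _ _ (by rw [sub_self]; exact J.zero_mem) (by rw [sub_self]; exact J.zero_mem)
  · have := hκ f
    rw [LinearMap.coe_mk, AddHom.coe_mk] at h
    rwa [h, map_zero, sub_zero] at this
  · exact h2 f f 0 (by rw [sub_self]; exact J.zero_mem) (by rwa [map_zero, sub_zero])

theorem IsNormalForm.eq_of_sub_mem {J : TwoSidedIdeal (FreeAlgebra R (Fin n))}
    {κ : FreeAlgebra R (Fin n) →ₗ[R] ((Fin n → ℕ) →₀ R)} (hκ : IsNormalForm J κ)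
    {f g : FreeAlgebra R (Fin n)} (h : f - g ∈ J) : κ f = κ g := by
  rw [← sub_eq_zero, ← map_sub]
  exact (hκ.2.2 _).2 h

variable [Algebra ℂ R] {L : Matrix (Fin n) (Fin n) ℂ}
  {c : Fin n → Fin n → Fin n → Fin n → R} {W : WeightSystem n}
  {J : TwoSidedIdeal (FreeAlgebra R (Fin n))}
  {κ : FreeAlgebra R (Fin n) →ₗ[R] ((Fin n → ℕ) →₀ R)}

theorem IsNormalForm.word_sub_mem_fil (hκ : IsNormalForm J κ) (hc : IsTriangular W c)
    (hJ : ∀ x y, x < y → quadRelation R L c x y ∈ J) (l : List (Fin n)) :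
    κ (wordMonomial R l) - Finsupp.single (expo l) (algebraMap ℂ R (Complex.exp (listTwist L l))) ∈
      W.fil R (expo l) 1 := by
  obtain ⟨g, hg, _, ⟨y, hy, rfl⟩, h⟩ := Submodule.mem_sup.1
    (WeightSystem.word_sub_sorted_mem_cover hc hJ l)
  have h1 := congrArg κ h
  rw [map_add, (hκ.2.2 g).2 hg, zero_add, hκ.2.1, map_sub, map_smul, ← sortedSection_single,
    hκ.2.1, Finsupp.smul_single, smul_eq_mul, mul_one] at h1
  rwa [← h1]

theorem IsNormalForm.word_mem_fil (hκ : IsNormalForm J κ) (hc : IsTriangular W c)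
    (hJ : ∀ x y, x < y → quadRelation R L c x y ∈ J) (l : List (Fin n)) :
    κ (wordMonomial R l) ∈ W.fil R (expo l) 0 := by
  have h := Submodule.add_mem _ (W.fil_anti _ (Nat.zero_le _) (hκ.word_sub_mem_fil hc hJ l))
    (W.single_self_mem_fil (expo l) (algebraMap ℂ R (Complex.exp (listTwist L l))))
  rwa [sub_add_cancel] at h

end NormalForm

/-! ### Comparison of the associated graded ideals -/

section AssociatedGraded

variable {n : ℕ} {R : Type*} [CommRing R] {b : Matrix (Fin n) (Fin n) ℂ}
  {G : SimpleGraph (Fin n)}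

theorem word_mem_smoothFiltration {a : ℕ} {l : List (Fin n)} {m : ℕ} (hm : a ≤ m)
    {w : Fin n → ℤ} (hw : w ∈ weightSums b G m) (h : ∀ i, w i ≤ (expo l i : ℤ)) :
    wordMonomial R l ∈ smoothFiltration R b G a :=
  Submodule.subset_span ⟨l, rfl, m, hm, w, hw, h⟩

variable {L : Matrix (Fin n) (Fin n) ℂ} {hb : IsBiresidue L b} {hG : G.IsAcyclic}

/-- Links the two filtrations: if w ∈ `Θ_m` lies below p, then moving p by a weight of level j moves
w into `Θ_{m+j}`. -/
theorem sortedSection_mem_smoothFiltration {a m k d : ℕ} {p : Fin n → ℕ} (hm : a ≤ m)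
    {w : Fin n → ℤ} (hw : w ∈ weightSums b G m) (h : ∀ i, w i ≤ (p i : ℤ))
    {y : (Fin n → ℕ) →₀ R} (hy : y ∈ (smoothSystem hb hG).fil R p k) (hd : d ≤ a + k) :
    sortedSection R y ∈ smoothFiltration R b G d := by
  refine (smoothSystem hb hG).map_mem_of_mem_fil _ _ (fun s j hj hs => ?_) hy
  rw [sortedSection_single]
  have hs' : intVec s - intVec p ∈ weightSums b G j := hs
  refine word_mem_smoothFiltration (m := m + j) (by omega) (add_mem_weightSums hw hs') fun i => ?_
  have := h i
  simp only [expo_sortedList, Pi.add_apply, Pi.sub_apply, intVec_apply]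
  omega

variable [Algebra ℂ R] {c c' : Fin n → Fin n → Fin n → Fin n → R}
  {J J' : TwoSidedIdeal (FreeAlgebra R (Fin n))}
  {κ κ' : FreeAlgebra R (Fin n) →ₗ[R] ((Fin n → ℕ) →₀ R)}

theorem IsNormalForm.sortedSection_mem_smoothFiltration (hκ : IsNormalForm J κ)
    (hc : IsTriangular (smoothSystem hb hG) c)
    (hJ : ∀ x y, x < y → quadRelation R L c x y ∈ J) {a : ℕ} {f : FreeAlgebra R (Fin n)}
    (hf : f ∈ smoothFiltration R b G a) : sortedSection R (κ f) ∈ smoothFiltration R b G a := by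
  change ((sortedSection R).comp κ) f ∈ _
  rw [← Submodule.mem_comap]
  refine Submodule.span_le.2 ?_ hf
  rintro _ ⟨l, rfl, m, hm, w, hw, h⟩
  exact _root_.sortedSection_mem_smoothFiltration hm hw h (hκ.word_mem_fil hc hJ l) le_self_add

/-- Any two triangular systems over the same `L` straighten a word to the same leading term. -/
theorem IsNormalForm.sub_mem_smoothFiltration (hκ : IsNormalForm J κ)
    (hc : IsTriangular (smoothSystem hb hG) c)
    (hJ : ∀ x y, x < y → quadRelation R L c x y ∈ J) (hκ' : IsNormalForm J' κ')
    (hc' : IsTriangular (smoothSystem hb hG) c')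
    (hJ' : ∀ x y, x < y → quadRelation R L c' x y ∈ J') {a : ℕ} {f : FreeAlgebra R (Fin n)}
    (hf : f ∈ smoothFiltration R b G a) :
    sortedSection R (κ f) - sortedSection R (κ' f) ∈ smoothFiltration R b G (a + 1) := by
  change ((sortedSection R).comp κ - (sortedSection R).comp κ') f ∈ _
  rw [← Submodule.mem_comap]
  refine Submodule.span_le.2 ?_ hf
  rintro _ ⟨l, rfl, m, hm, w, hw, h⟩
  have h1 := Submodule.sub_mem _ (hκ.word_sub_mem_fil hc hJ l) (hκ'.word_sub_mem_fil hc' hJ' l)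
  rw [sub_sub_sub_cancel_right] at h1
  have h2 := _root_.sortedSection_mem_smoothFiltration hm hw h h1 le_rfl
  rwa [map_sub] at h2

/-- If f agrees modulo J with an element one step deeper, its J-normal form is one step deeper,
hence so is its J'-normal form. Subtracting the latter from f gives the required element of J'. -/
theorem IsNormalForm.sameAssociatedGraded (hκ : IsNormalForm J κ)
    (hc : IsTriangular (smoothSystem hb hG) c)
    (hJ : ∀ x y, x < y → quadRelation R L c x y ∈ J) (hκ' : IsNormalForm J' κ')
    (hc' : IsTriangular (smoothSystem hb hG) c')
    (hJ' : ∀ x y, x < y → quadRelation R L c' x y ∈ J') : SameAssociatedGraded b G J J' := by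
  have hanti : ∀ a, smoothFiltration R b G (a + 1) ≤ smoothFiltration R b G a := fun a =>
    Submodule.span_mono fun f ⟨l, hl, m, hm, h⟩ => ⟨l, hl, m, by omega, h⟩
  intro a f hf
  have hdiff := hκ.sub_mem_smoothFiltration hc hJ hκ' hc' hJ' hf
  constructor
  · rintro ⟨g, hg, hfg⟩
    have h1 := hκ.sortedSection_mem_smoothFiltration hc hJ hfg
    rw [map_sub, (hκ.2.2 g).2 hg, sub_zero] at h1
    refine ⟨f - sortedSection R (κ' f), hκ'.1 f, ?_⟩
    rw [sub_sub_cancel]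
    have := Submodule.sub_mem _ h1 hdiff
    rwa [sub_sub_cancel] at this
  · rintro ⟨g, hg, hfg⟩
    have h1 := hκ'.sortedSection_mem_smoothFiltration hc' hJ' hfg
    rw [map_sub, (hκ'.2.2 g).2 hg, sub_zero] at h1
    refine ⟨f - sortedSection R (κ f), hκ.1 f, ?_⟩
    rw [sub_sub_cancel]
    have := Submodule.add_mem _ hdiff h1
    rwa [sub_add_cancel] at this

end AssociatedGraded

/-! ### The ideals of the deformation problem -/

section Ideals

variable {n : ℕ} {R : Type*} [CommRing R] [Algebra ℂ R] {L : Matrix (Fin n) (Fin n) ℂ}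

theorem quadIdeal_zero_eq_toricIdeal (halt : IsAlternating L) :
    quadIdeal R L 0 = toricIdeal R (entrywiseExp L) := by
  have hrel : ∀ x y, quadRelation R L 0 x y = -(FreeAlgebra.ι R y * FreeAlgebra.ι R x
      - algebraMap ℂ R (entrywiseExp L y x) • (FreeAlgebra.ι R x * FreeAlgebra.ι R y)) := by
    intro x y
    simp only [quadRelation, Pi.zero_apply, zero_smul, Finset.sum_const_zero, add_zero]
    abel
  have hinv : ∀ i j, entrywiseExp L i j * entrywiseExp L j i = 1 := by
    intro i j
    rw [entrywiseExp, entrywiseExp, ← Complex.exp_add, halt i j, neg_add_cancel, Complex.exp_zero]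
  apply le_antisymm
  · refine TwoSidedIdeal.span_le.2 ?_
    rintro _ ⟨x, y, -, rfl⟩
    rw [hrel]
    exact TwoSidedIdeal.neg_mem _ (TwoSidedIdeal.subset_span ⟨y, x, rfl⟩)
  · refine TwoSidedIdeal.span_le.2 ?_
    rintro _ ⟨i, j, rfl⟩
    rcases lt_trichotomy i j with h | h | h
    · have h1 := quadRelation_mem_quadIdeal R L 0 h
      have h2 := TwoSidedIdeal.smul_mem_freeAlgebra (algebraMap ℂ R (entrywiseExp L i j)) h1
      rw [hrel, ← neg_sub, neg_neg, smul_sub, smul_smul, ← map_mul, hinv, map_one, one_smul] at h2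
      exact h2
    · have hd : L j j = 0 := by
        have := halt j j
        linear_combination this / 2
      subst h
      simp [entrywiseExp, hd]
    · have h1 := TwoSidedIdeal.neg_mem _ (quadRelation_mem_quadIdeal R L 0 h)
      rwa [hrel, neg_neg] at h1

theorem isTriangular_zero {S : Type*} [CommRing S] (W : WeightSystem n) :
    IsTriangular W (0 : Fin n → Fin n → Fin n → Fin n → S) :=
  fun _ _ _ _ _ h => absurd rfl h

variable (R) in
open Classical in
/-- The coefficients of the deformed relations. -/
noncomputable def deformedCoeff (b : Matrix (Fin n) (Fin n) ℂ) (G : SimpleGraph (Fin n)) (N : ℕ)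
    (C : Fin n → Fin n → Fin n → Fin n → ℂ) (e : R) (y x k l : Fin n) : R :=
  ∑ m ∈ Finset.Icc 1 N, if k ≤ l ∧ quadWeight x y k l ∈ weightSums b G m then
    e ^ m * algebraMap ℂ R (C y x k l) else 0

theorem deformedIdeal_eq_quadIdeal (b : Matrix (Fin n) (Fin n) ℂ) (G : SimpleGraph (Fin n))
    (N : ℕ) (C : Fin n → Fin n → Fin n → Fin n → ℂ) (e : R) :
    deformedIdeal R (entrywiseExp L) b G N C e =
      quadIdeal R L (deformedCoeff R b G N C e) := by
  have h : ∀ x y, deformedRelation R (entrywiseExp L) b G N C e x y =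
      quadRelation R L (deformedCoeff R b G N C e) x y := by
    intro x y
    rw [deformedRelation, quadRelation]
    congr 1
    simp only [deformedCoeff, Finset.sum_smul, Finset.smul_sum]
    rw [Finset.sum_comm]
    refine Finset.sum_congr rfl fun k _ => ?_
    rw [Finset.sum_comm]
    refine Finset.sum_congr rfl fun l _ => Finset.sum_congr rfl fun m _ => ?_
    split_ifs
    · rw [smul_smul]
    · rw [smul_zero, zero_smul]
  simp only [deformedIdeal, quadIdeal, h]

theorem exists_of_deformedCoeff_ne_zero {b : Matrix (Fin n) (Fin n) ℂ} {G : SimpleGraph (Fin n)}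
    {N : ℕ} {C : Fin n → Fin n → Fin n → Fin n → ℂ} {e : R} {x y k l : Fin n}
    (h : deformedCoeff R b G N C e y x k l ≠ 0) :
    k ≤ l ∧ ∃ m, 1 ≤ m ∧ m ≤ N ∧ quadWeight x y k l ∈ weightSums b G m := by
  obtain ⟨m, hm, hne⟩ := Finset.exists_ne_zero_of_sum_ne_zero h
  rw [Finset.mem_Icc] at hm
  split_ifs at hne with hkl
  · exact ⟨hkl.1, m, hm.1, hm.2, hkl.2⟩
  · exact absurd rfl hne

theorem isTriangular_deformedCoeff {b : Matrix (Fin n) (Fin n) ℂ} {G : SimpleGraph (Fin n)}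
    (hb : IsBiresidue L b) (hG : G.IsAcyclic) (N : ℕ) (C : Fin n → Fin n → Fin n → Fin n → ℂ)
    (e : R) : IsTriangular (smoothSystem hb hG) (deformedCoeff R b G N C e) := by
  intro x y k l _ hne
  obtain ⟨hkl, m, hm, -, hw⟩ := exists_of_deformedCoeff_ne_zero hne
  exact ⟨hkl, m, hm, hw⟩

/-- Levels are unique, so a single power of the parameter survives in the sum. -/
theorem deformedCoeff_eq {b : Matrix (Fin n) (Fin n) ℂ} {G : SimpleGraph (Fin n)}
    (hb : IsBiresidue L b) (hG : G.IsAcyclic) {N : ℕ} {C : Fin n → Fin n → Fin n → Fin n → ℂ}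
    {e : R} {x y k l : Fin n} {m : ℕ} (hm : m ∈ Finset.Icc 1 N) (hkl : k ≤ l)
    (hw : quadWeight x y k l ∈ weightSums b G m) :
    deformedCoeff R b G N C e y x k l = e ^ m * algebraMap ℂ R (C y x k l) := by
  rw [deformedCoeff, Finset.sum_eq_single_of_mem m hm, if_pos ⟨hkl, hw⟩]
  intro m' _ hne
  rw [if_neg]
  rintro ⟨-, hw'⟩
  exact hne ((smoothSystem hb hG).level_unique hw' hw)

end Ideals

/-! ### Triangular families -/

namespace WeightSystem

section Triangular

variable {n : ℕ} {W : WeightSystem n} {R : Type*} [CommRing R]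

/-- Successive approximation: subtracting ∑ x_s v_s from x raises the level by one, and beyond the
depth nothing remains. The last clause keeps track of the unchanged leading coefficients. -/
theorem exists_linearCombination_of_mem_fil {v : (Fin n → ℕ) → (Fin n → ℕ) →₀ R}
    (hv : ∀ p, v p - Finsupp.single p 1 ∈ W.fil R p 1) {p : Fin n → ℕ} {m : ℕ}
    {x : (Fin n → ℕ) →₀ R} (hx : x ∈ W.fil R p m) :
    ∃ y ∈ W.fil R p m, Finsupp.linearCombination R v y = x ∧ y - x ∈ W.fil R p (m + 1) := by
  obtain ⟨d, hd⟩ : ∃ d, W.depth p < m + d := ⟨W.depth p + 1, by omega⟩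
  induction d generalizing m x with
  | zero =>
    rw [W.fil_eq_bot (by omega), Submodule.mem_bot] at hx
    subst hx
    exact ⟨0, Submodule.zero_mem _, by simp, by simp⟩
  | succ d ih =>
    have h1 : x - Finsupp.linearCombination R v x ∈ W.fil R p (m + 1) := by
      rw [← neg_mem_iff, neg_sub]
      change (Finsupp.linearCombination R v - LinearMap.id : ((Fin n → ℕ) →₀ R) →ₗ[R] _) x ∈ _
      refine W.map_mem_of_mem_fil _ _ (fun s k hk hs => ?_) hx
      rw [LinearMap.sub_apply, LinearMap.id_apply, Finsupp.linearCombination_single, one_smul]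
      exact W.fil_le hs (by omega) (hv s)
    obtain ⟨y, hy, hxy, -⟩ := ih h1 (by omega)
    refine ⟨x + y, Submodule.add_mem _ hx (W.fil_anti _ (by omega) hy), ?_, ?_⟩
    · rw [map_add, hxy, add_sub_cancel]
    · rwa [add_sub_cancel_left]

end Triangular

/-! ### Degree two -/

section DegreeTwo

variable {n : ℕ}

theorem single_add_single_injective {a b k l : Fin n} (hab : a ≤ b) (hkl : k ≤ l)
    (h : (Pi.single k 1 + Pi.single l 1 : Fin n → ℕ) = Pi.single a 1 + Pi.single b 1) :
    k = a ∧ l = b := by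
  have h1 := congrArg sortedList h
  rw [sortedList_single_add_single hkl, sortedList_single_add_single hab] at h1
  simpa using h1

theorem exists_single_add_single {s : Fin n → ℕ} (hs : ∑ i, s i = 2) :
    ∃ k l, k ≤ l ∧ s = Pi.single k 1 + Pi.single l 1 := by
  have h0 : s ≠ 0 := by
    rintro rfl
    simp at hs
  obtain ⟨k, s', rfl, hk⟩ := exists_eq_single_add h0
  have hs' : ∑ i, s' i = 1 := by
    simpa [Finset.sum_add_distrib, add_comm] using hs
  have h1 : s' ≠ 0 := by
    rintro rfl
    simp at hs'
  obtain ⟨l, s'', rfl, hl⟩ := exists_eq_single_add h1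
  have hs'' : ∑ i, s'' i = 0 := by
    simpa [Finset.sum_add_distrib, add_comm] using hs'
  have h2 : s'' = 0 := by
    ext i
    exact Finset.sum_eq_zero_iff.1 hs'' i (Finset.mem_univ i)
  subst h2
  exact ⟨k, l, hk l (by simp), by simp⟩

theorem eq_sum_single_of_degree_two {R : Type*} [CommRing R] {z : (Fin n → ℕ) →₀ R}
    (hz : ∀ s, z s ≠ 0 → ∑ i, s i = 2) :
    z = ∑ k, ∑ l, if k ≤ l then
      Finsupp.single (Pi.single k 1 + Pi.single l 1) (z (Pi.single k 1 + Pi.single l 1)) else 0 := by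
  classical
  ext s
  simp only [Finsupp.finsetSum_apply]
  by_cases hs : z s = 0
  · rw [hs]
    symm
    refine Finset.sum_eq_zero fun k _ => Finset.sum_eq_zero fun l _ => ?_
    split_ifs
    · rw [Finsupp.single_apply]
      split_ifs with h
      · rw [h, hs]
      · rfl
    · rfl
  · obtain ⟨a, b, hab, rfl⟩ := exists_single_add_single (hz s hs)
    rw [Finset.sum_eq_single a, Finset.sum_eq_single b]
    · rw [if_pos hab, Finsupp.single_eq_same]
    · intro l _ hl
      split_ifs with h
      · rw [Finsupp.single_apply, if_neg]
        exact fun h' => hl (single_add_single_injective hab h h').2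
      · rfl
    · simp
    · intro k _ hk
      refine Finset.sum_eq_zero fun l _ => ?_
      split_ifs with h
      · rw [Finsupp.single_apply, if_neg]
        exact fun h' => hk (single_add_single_injective hab h h').1
      · rfl
    · simp

end DegreeTwo

/-! ### The operators of left multiplication -/

section Operators

variable {n : ℕ} {W : WeightSystem n} {L : Matrix (Fin n) (Fin n) ℂ} {B : MonoProduct n}

/-- The basis vector of a variable. -/
noncomputable def varVec (i : Fin n) : MonoSpace n := Finsupp.single (Pi.single i 1) 1

/-- Iterated left multiplication by the letters of a word. -/
noncomputable def wordOp (B : MonoProduct n) : List (Fin n) → MonoSpace n → MonoSpace n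
  | [], x => x
  | i :: l, x => B (varVec i) (wordOp B l x)

theorem wordOp_mem_fil (hB : IsStar W L B) (l : List (Fin n)) (r : Fin n → ℕ) :
    wordOp B l (Finsupp.single r 1) ∈ W.fil ℂ (expo l + r) 0 := by
  induction l with
  | nil =>
    rw [expo_nil, zero_add]
    exact W.single_self_mem_fil r 1
  | cons i l ih =>
    rw [expo_cons, add_assoc]
    exact hB.mul_mem_fil (W.single_self_mem_fil _ 1) ih

theorem wordOp_sub_mem_fil (hB : IsStar W L B) (l : List (Fin n)) :
    wordOp B l (Finsupp.single 0 1) - Complex.exp (listTwist L l) • Finsupp.single (expo l) 1 ∈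
      W.fil ℂ (expo l) 1 := by
  induction l with
  | nil =>
    rw [expo_nil, wordOp, listTwist, Complex.exp_zero, one_smul, sub_self]
    exact Submodule.zero_mem _
  | cons i l ih =>
    rw [expo_cons, wordOp]
    have h1 := hB.mul_mem_fil (W.single_self_mem_fil (Pi.single i 1) 1) ih
    have h2 := Submodule.smul_mem _ (Complex.exp (listTwist L l))
      (hB.leading (Pi.single i 1) (expo l))
    have h3 := Submodule.add_mem _ h1 h2
    rw [map_sub, map_smul, smul_sub, smul_smul, ← Complex.exp_add, sub_add_sub_cancel,
      intVec_single, add_comm (listTwist L l)] at h3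
    exact h3

theorem wordOp_sorted_sub_mem_fil (hB : IsStar W L B) (p : Fin n → ℕ) :
    wordOp B (sortedList p) (Finsupp.single 0 1) - Finsupp.single p 1 ∈ W.fil ℂ p 1 := by
  have h := wordOp_sub_mem_fil hB (sortedList p)
  rwa [listTwist_sortedList, Complex.exp_zero, one_smul, expo_sortedList] at h

/-- The commutators of the variables are linear combinations of sorted products. -/
theorem exists_commutator_coeff (hB : IsStar W L B) :
    ∃ C : Fin n → Fin n → Fin n → Fin n → ℂ,
      (∀ x y k l, C y x k l ≠ 0 →
        x < y ∧ k ≤ l ∧ ∃ m, 1 ≤ m ∧ quadWeight x y k l ∈ W.level m) ∧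
      (∀ x y, x < y → B (varVec y) (varVec x) - entrywiseExp L y x • B (varVec x) (varVec y) =
        ∑ k, ∑ l, C y x k l • B (varVec k) (varVec l)) ∧
      ∀ x y k l, x < y → k ≤ l → quadWeight x y k l ∈ W.level 1 →
        C y x k l = coef ℂ (intVec (Pi.single k 1 + Pi.single l 1))
          (B (varVec y) (varVec x) - entrywiseExp L y x • B (varVec x) (varVec y)) := by
  have hq : ∀ x y k l : Fin n, intVec (Pi.single k 1 + Pi.single l 1) -
      intVec (Pi.single x 1 + Pi.single y 1) = quadWeight x y k l := by
    intro x y k l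
    simp only [quadWeight, intVec_add, intVec_single]
    abel
  have hex : ∀ x y : Fin n, ∃ z : MonoSpace n, x < y →
      z ∈ W.fil ℂ (Pi.single x 1 + Pi.single y 1) 1 ∧
      Finsupp.linearCombination ℂ
        (fun p => wordOp B (sortedList p) (Finsupp.single 0 1)) z =
        B (varVec y) (varVec x) - entrywiseExp L y x • B (varVec x) (varVec y) ∧
      z - (B (varVec y) (varVec x) - entrywiseExp L y x • B (varVec x) (varVec y)) ∈
        W.fil ℂ (Pi.single x 1 + Pi.single y 1) 2 := by
    intro x y
    by_cases hxy : x < y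
    · have h1 := hB.leading (Pi.single y 1) (Pi.single x 1)
      have h2 := Submodule.smul_mem _ (entrywiseExp L y x)
        (hB.leading (Pi.single x 1) (Pi.single y 1))
      rw [intVec_single, intVec_single, twist_single_single, if_pos hxy,
        add_comm (Pi.single y 1)] at h1
      rw [intVec_single, intVec_single, twist_single_single, if_neg hxy.asymm, Complex.exp_zero,
        one_smul, smul_sub] at h2
      have h3 := Submodule.sub_mem _ h1 h2
      rw [entrywiseExp, sub_sub_sub_cancel_right] at h3
      -- The leading terms cancel in the commutator, since the bicharacter at (e_y, e_x) is q_yx.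
      -- What remains has level at least one and is expanded in sorted products taken with `B`.
      obtain ⟨z, hz⟩ := exists_linearCombination_of_mem_fil (wordOp_sorted_sub_mem_fil hB) h3
      exact ⟨z, fun _ => hz⟩
    · exact ⟨0, fun h => absurd h hxy⟩
  choose z hz using hex
  refine ⟨fun y x k l => if x < y ∧ k ≤ l then z x y (Pi.single k 1 + Pi.single l 1) else 0,
    fun x y k l hne => ?_, fun x y hxy => ?_, fun x y k l hxy hkl hw => ?_⟩
  · dsimp only at hne
    split_ifs at hne with h
    · rcases W.eq_zero_or_of_mem_fil (hz x y h.1).1 (Pi.single k 1 + Pi.single l 1) with h' | h'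
      · exact absurd h' hne
      · rw [hq] at h'
        exact ⟨h.1, h.2, h'⟩
    · exact absurd rfl hne
  · obtain ⟨h1, h2, -⟩ := hz x y hxy
    have h3 := eq_sum_single_of_degree_two (z := z x y) (fun s hs => by
      rcases W.eq_zero_or_of_mem_fil h1 s with h' | ⟨k, -, h'⟩
      · exact absurd h' hs
      · rw [W.sum_eq_of_sub_mem h']
        simp [Finset.sum_add_distrib])
    rw [← h2]
    conv_lhs => rw [h3]
    simp only [map_sum]
    refine Finset.sum_congr rfl fun k _ => Finset.sum_congr rfl fun l _ => ?_
    by_cases hkl : k ≤ l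
    · rw [if_pos hkl, if_pos ⟨hxy, hkl⟩, Finsupp.linearCombination_single,
        sortedList_single_add_single hkl, wordOp, wordOp, wordOp, hB.mul_one]
    · rw [if_neg hkl, if_neg fun h => hkl h.2, map_zero, zero_smul]
  · beta_reduce
    rw [if_pos ⟨hxy, hkl⟩]
    have h1 := W.coef_eq_zero (by omega) hw (hz x y hxy).2.2
    rw [← hq, add_sub_cancel, map_sub, sub_eq_zero, coef_intVec] at h1
    exact h1

end Operators

/-! ### Rees deformations -/

section Rees

variable {n : ℕ} (W : WeightSystem n) {R : Type*} [CommRing R] [Algebra ℂ R] (e : R)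

/-- The linear map which multiplies a monomial by the power of the parameter given by its level
above a fixed exponent vector. -/
noncomputable def rees (p : Fin n → ℕ) : MonoSpace n →ₗ[ℂ] ((Fin n → ℕ) →₀ R) :=
  Finsupp.linearCombination ℂ fun s =>
    -- The floor of the height is the level when s − p is a weight of the system; the value at other
    -- monomials is immaterial.
    Finsupp.single s (e ^ ⌊W.height (intVec s - intVec p)⌋₊)

variable {W}

theorem rees_single {p s : Fin n → ℕ} {k : ℕ} (h : intVec s - intVec p ∈ W.level k) :
    W.rees e p (Finsupp.single s 1) = e ^ k • Finsupp.single s 1 := by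
  rw [rees, Finsupp.linearCombination_single, one_smul, W.height_eq h, Nat.floor_natCast,
    Finsupp.smul_single, smul_eq_mul, mul_one]

theorem eq_of_mem_fil {N : Type*} [AddCommGroup N] [Module ℂ N] {f g : MonoSpace n →ₗ[ℂ] N}
    {p : Fin n → ℕ} (h : ∀ s k, intVec s - intVec p ∈ W.level k →
      f (Finsupp.single s 1) = g (Finsupp.single s 1)) {x : MonoSpace n}
    (hx : x ∈ W.fil ℂ p 0) : f x = g x := by
  rw [← sub_eq_zero, ← LinearMap.sub_apply, ← Submodule.mem_bot ℂ]
  refine W.map_mem_of_mem_fil _ _ (fun s k _ hs => ?_) hx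
  rw [Submodule.mem_bot, LinearMap.sub_apply, h s k hs, sub_self]

/-- Changing the base point by a weight of level k shifts every level by k. This is how the powers
of the parameter enter the relations. -/
theorem rees_eq_smul {p s : Fin n → ℕ} {k : ℕ} (h : intVec s - intVec p ∈ W.level k)
    {x : MonoSpace n} (hx : x ∈ W.fil ℂ s 0) : W.rees e p x = e ^ k • W.rees e s x := by
  change W.rees e p x = (e ^ k • W.rees e s) x
  refine eq_of_mem_fil (fun t m ht => ?_) hx
  have h1 := W.add_mem h ht
  rw [sub_add_sub_comm, add_comm (intVec s), add_sub_add_right_eq_sub] at h1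
  rw [rees_single e h1, LinearMap.smul_apply, rees_single e ht, smul_smul, pow_add]

theorem rees_mem_fil {p : Fin n → ℕ} {m : ℕ} {x : MonoSpace n} (hx : x ∈ W.fil ℂ p m) :
    W.rees e p x ∈ W.fil R p m := by
  change x ∈ ((W.fil R p m).restrictScalars ℂ).comap (W.rees e p)
  refine W.map_mem_of_mem_fil LinearMap.id _ (fun s k hk hs => ?_) hx
  rw [LinearMap.id_apply, Submodule.mem_comap, Submodule.restrictScalars_mem, rees_single e hs]
  exact Submodule.smul_mem _ _ (W.single_mem_fil hk hs 1)

variable (W) in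
/-- The operators of left multiplication by the variables in the Rees deformation. -/
noncomputable def reesOp (B : MonoProduct n) (i : Fin n) :
    ((Fin n → ℕ) →₀ R) →ₗ[R] ((Fin n → ℕ) →₀ R) :=
  Finsupp.linearCombination R fun r =>
    W.rees e (Pi.single i 1 + r) (B (varVec i) (Finsupp.single r 1))

variable {L : Matrix (Fin n) (Fin n) ℂ} {B : MonoProduct n}

theorem reesOp_rees (hB : IsStar W L B) (i : Fin n) {p : Fin n → ℕ} {x : MonoSpace n}
    (hx : x ∈ W.fil ℂ p 0) :
    W.reesOp e B i (W.rees e p x) = W.rees e (Pi.single i 1 + p) (B (varVec i) x) := by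
  change (((W.reesOp e B i).restrictScalars ℂ).comp (W.rees e p)) x =
    ((W.rees e (Pi.single i 1 + p)).comp (B (varVec i))) x
  refine eq_of_mem_fil (fun s k hs => ?_) hx
  rw [LinearMap.comp_apply, LinearMap.comp_apply, rees_single e hs,
    LinearMap.restrictScalars_apply, map_smul, reesOp, Finsupp.linearCombination_single, one_smul]
  refine (rees_eq_smul e ?_ (hB.mem_fil _ _)).symm
  rwa [intVec_add, intVec_add, add_sub_add_left_eq_sub]

variable (W) in
/-- The action of the free algebra on the Rees deformation. -/
noncomputable def reesAction (B : MonoProduct n) :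
    FreeAlgebra R (Fin n) →ₐ[R] Module.End R ((Fin n → ℕ) →₀ R) :=
  FreeAlgebra.lift R fun i => W.reesOp e B i

theorem reesAction_word (hB : IsStar W L B) (l : List (Fin n)) (r : Fin n → ℕ) :
    W.reesAction e B (wordMonomial R l) (Finsupp.single r 1) =
      W.rees e (expo l + r) (wordOp B l (Finsupp.single r 1)) := by
  induction l with
  | nil =>
    rw [wordMonomial_nil, map_one, Module.End.one_apply, expo_nil, zero_add, wordOp,
      rees_single e (k := 0) (by simpa using W.zero_mem), pow_zero, one_smul]
  | cons i l ih =>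
    rw [wordMonomial_cons, map_mul, Module.End.mul_apply, ih, expo_cons, add_assoc, wordOp,
      ← reesOp_rees e hB i (wordOp_mem_fil hB l r)]
    simp [reesAction]

/-- The Rees deformation of an associative product satisfies the homogenized relations. -/
theorem sortedIndependent_of_isStar (hB : IsStar W L B) (hBa : ∀ x y z, assoc B x y z = 0)
    {C : Fin n → Fin n → Fin n → Fin n → ℂ} {c : Fin n → Fin n → Fin n → Fin n → R}
    (hC : ∀ x y, x < y → B (varVec y) (varVec x) - entrywiseExp L y x • B (varVec x) (varVec y) =
        ∑ k, ∑ l, C y x k l • B (varVec k) (varVec l))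
    (hc : ∀ x y k l, x < y → (C y x k l = 0 ∧ c y x k l = 0) ∨
      ∃ m, quadWeight x y k l ∈ W.level m ∧ c y x k l = e ^ m * algebraMap ℂ R (C y x k l)) :
    SortedIndependent (quadIdeal R L c) := by
  -- Associativity of `B` turns a word of two letters into multiplication by the product of the
  -- letters, and the powers of e in c match the changes of base point. Hence each relation acts as
  -- the Rees image of an identity that holds for `B`.
  have hkill : quadIdeal R L c ≤ TwoSidedIdeal.ker (W.reesAction e B) := by
    refine TwoSidedIdeal.span_le.2 ?_
    rintro _ ⟨x, y, hxy, rfl⟩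
    rw [SetLike.mem_coe, TwoSidedIdeal.mem_ker]
    refine Finsupp.lhom_ext' fun r => LinearMap.ext_ring ?_
    rw [LinearMap.comp_apply, LinearMap.comp_apply, LinearMap.zero_apply, Finsupp.lsingle_apply]
    have hw : ∀ k l : Fin n, W.reesAction e B (FreeAlgebra.ι R k * FreeAlgebra.ι R l)
        (Finsupp.single r 1) = W.rees e (Pi.single k 1 + (Pi.single l 1 + r))
          (B (B (varVec k) (varVec l)) (Finsupp.single r 1)) := by
      intro k l
      rw [← wordMonomial_pair, reesAction_word e hB, wordOp, wordOp, wordOp,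
        sub_eq_zero.1 (hBa _ _ _), expo_cons, expo_cons, expo_nil, add_zero, add_assoc]
    have hterm : ∀ k l, c y x k l • W.reesAction e B (FreeAlgebra.ι R k * FreeAlgebra.ι R l)
        (Finsupp.single r 1) = C y x k l • W.rees e (Pi.single y 1 + (Pi.single x 1 + r))
          (B (B (varVec k) (varVec l)) (Finsupp.single r 1)) := by
      intro k l
      rcases hc x y k l hxy with ⟨h1, h2⟩ | ⟨m, hm, h⟩
      · rw [h1, h2, zero_smul, zero_smul]
      · rw [← intVec_sub_eq_quadWeight x y k l r] at hm
        have hmem : B (B (varVec k) (varVec l)) (Finsupp.single r 1) ∈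
            W.fil ℂ (Pi.single k 1 + (Pi.single l 1 + r)) 0 := by
          rw [← add_assoc]
          exact hB.mul_mem_fil (hB.mem_fil _ _) (W.single_self_mem_fil r 1)
        rw [hw, h, rees_eq_smul e hm hmem, mul_comm, mul_smul, algebraMap_smul]
    have hP : Pi.single x 1 + (Pi.single y 1 + r) = Pi.single y 1 + (Pi.single x 1 + r) := by
      abel
    have hfin : W.rees e (Pi.single y 1 + (Pi.single x 1 + r))
        (B (-B (varVec y) (varVec x) + entrywiseExp L y x • B (varVec x) (varVec y)
          + ∑ k, ∑ l, C y x k l • B (varVec k) (varVec l)) (Finsupp.single r 1)) = 0 := by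
      rw [← hC x y hxy, show ∀ u v : MonoSpace n, -u + v + (u - v) = 0 from fun u v => by abel,
        map_zero, LinearMap.zero_apply, map_zero]
    simp only [map_add, map_neg, map_smul, map_sum, LinearMap.add_apply, LinearMap.neg_apply,
      LinearMap.smul_apply, LinearMap.sum_apply] at hfin
    simp only [quadRelation, map_add, map_neg, map_smul, map_sum, LinearMap.add_apply,
      LinearMap.neg_apply, LinearMap.smul_apply, LinearMap.sum_apply, hterm]
    rw [hw, hw, algebraMap_smul, hP]
    exact hfin
  intro x hx
  -- Let the ideal act on the monomial 1: the sorted words send it to a unitriangular family, so no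
  -- nonzero combination of them acts by zero.
  have h0 : Finsupp.linearCombination R (fun p => W.reesAction e B
      (wordMonomial R (sortedList p)) (Finsupp.single 0 1)) x = 0 := by
    have h1 := LinearMap.congr_fun ((TwoSidedIdeal.mem_ker _).1 (hkill hx)) (Finsupp.single 0 1)
    rw [LinearMap.zero_apply] at h1
    rw [← h1, sortedSection, Finsupp.linearCombination_apply, Finsupp.linearCombination_apply,
      Finsupp.sum, Finsupp.sum, map_sum, LinearMap.sum_apply]
    exact Finset.sum_congr rfl fun p _ => by rw [map_smul, LinearMap.smul_apply]
  refine W.linearCombination_injective _ (fun p => ?_) (h0.trans (map_zero _).symm)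
  have h1 := rees_mem_fil e (wordOp_sorted_sub_mem_fil hB p)
  rw [map_sub, rees_single e (k := 0) (by simpa using W.zero_mem), pow_zero, one_smul] at h1
  rwa [reesAction_word e hB, expo_sortedList, add_zero]

end Rees

end WeightSystem

/-! ### Specialization of the parameter -/

section Specialization

variable {n : ℕ}

/-- Evaluation of the coefficients of noncommutative polynomials. -/
theorem exists_evalHom (n : ℕ) (a : ℂ) : ∃ ev : FreeAlgebra ℂ[X] (Fin n) →+* FreeAlgebra ℂ (Fin n),
    (∀ i, ev (FreeAlgebra.ι ℂ[X] i) = FreeAlgebra.ι ℂ i) ∧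
      ∀ p, ev (algebraMap ℂ[X] _ p) = algebraMap ℂ _ (p.eval a) := by
  let _ : Algebra ℂ[X] (FreeAlgebra ℂ (Fin n)) :=
    Algebra.compHom _ (Polynomial.evalRingHom a)
  refine ⟨(FreeAlgebra.lift ℂ[X] (FreeAlgebra.ι ℂ)).toRingHom, fun i => ?_, fun p => ?_⟩
  · exact FreeAlgebra.lift_ι_apply _ _
  · exact AlgHom.commutes (FreeAlgebra.lift ℂ[X] (FreeAlgebra.ι ℂ)) p

/-- Evaluation of the coefficients of noncommutative polynomials. -/
noncomputable def evalHom (a : ℂ) : FreeAlgebra ℂ[X] (Fin n) →+* FreeAlgebra ℂ (Fin n) :=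
  (exists_evalHom n a).choose

@[simp] theorem evalHom_ι (a : ℂ) (i : Fin n) :
    evalHom a (FreeAlgebra.ι ℂ[X] i) = FreeAlgebra.ι ℂ i :=
  (exists_evalHom n a).choose_spec.1 i

@[simp] theorem evalHom_algebraMap (a : ℂ) (p : ℂ[X]) :
    evalHom a (algebraMap ℂ[X] (FreeAlgebra ℂ[X] (Fin n)) p) = algebraMap ℂ _ (p.eval a) :=
  (exists_evalHom n a).choose_spec.2 p

theorem evalHom_smul (a : ℂ) (p : ℂ[X]) (f : FreeAlgebra ℂ[X] (Fin n)) :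
    evalHom a (p • f) = p.eval a • evalHom a f := by
  rw [Algebra.smul_def, map_mul, evalHom_algebraMap, ← Algebra.smul_def]

theorem evalHom_wordMonomial (a : ℂ) (l : List (Fin n)) :
    evalHom a (wordMonomial ℂ[X] l) = wordMonomial ℂ l := by
  induction l with
  | nil => simp [wordMonomial_nil]
  | cons i l ih => rw [wordMonomial_cons, map_mul, ih, evalHom_ι, wordMonomial_cons]

/-- Evaluation of the coefficients of normal forms. -/
noncomputable def evalVec (a : ℂ) : ((Fin n → ℕ) →₀ ℂ[X]) →+ ((Fin n → ℕ) →₀ ℂ) :=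
  Finsupp.mapRange.addMonoidHom (Polynomial.evalRingHom a).toAddMonoidHom

@[simp] theorem evalVec_apply (a : ℂ) (x : (Fin n → ℕ) →₀ ℂ[X]) (p : Fin n → ℕ) :
    evalVec a x p = (x p).eval a := by
  simp [evalVec]

theorem evalVec_smul (a : ℂ) (r : ℂ[X]) (x : (Fin n → ℕ) →₀ ℂ[X]) :
    evalVec a (r • x) = r.eval a • evalVec a x := by
  ext p
  simp

theorem evalHom_sortedSection (a : ℂ) (x : (Fin n → ℕ) →₀ ℂ[X]) :
    evalHom a (sortedSection ℂ[X] x) = sortedSection ℂ (evalVec a x) := by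
  induction x using Finsupp.induction_linear with
  | zero => simp
  | add x y hx hy => simp only [map_add, hx, hy]
  | single p r =>
    have h1 : evalVec a (Finsupp.single p r) = r.eval a • Finsupp.single p 1 := by
      ext s
      by_cases h : s = p
      · subst h
        simp
      · simp [Finsupp.single_eq_of_ne h]
    rw [h1, map_smul, sortedSection_single, ← mul_one r, ← smul_eq_mul, ← Finsupp.smul_single,
      map_smul, sortedSection_single, evalHom_smul, evalHom_wordMonomial]
    simp

theorem exists_evalHom_eq (a : ℂ) (f : FreeAlgebra ℂ (Fin n)) :
    ∃ F : FreeAlgebra ℂ[X] (Fin n), evalHom a F = f := by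
  induction f using FreeAlgebra.induction with
  | grade0 r => exact ⟨algebraMap _ _ (Polynomial.C r), by simp⟩
  | grade1 i => exact ⟨FreeAlgebra.ι _ i, by simp⟩
  | add f g hf hg =>
    obtain ⟨F, rfl⟩ := hf
    obtain ⟨H, rfl⟩ := hg
    exact ⟨F + H, map_add _ _ _⟩
  | mul f g hf hg =>
    obtain ⟨F, rfl⟩ := hf
    obtain ⟨H, rfl⟩ := hg
    exact ⟨F * H, map_mul _ _ _⟩

/-- Every F differs from the constant extension of its value at a by a multiple of X − a, by
induction over the free algebra. -/
theorem exists_smul_of_evalHom_eq_zero {a : ℂ} {F : FreeAlgebra ℂ[X] (Fin n)}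
    (hF : evalHom a F = 0) : ∃ H, F = (Polynomial.X - Polynomial.C a) • H := by
  let emb : FreeAlgebra ℂ (Fin n) →ₐ[ℂ] FreeAlgebra ℂ[X] (Fin n) :=
    FreeAlgebra.lift ℂ (FreeAlgebra.ι ℂ[X])
  have key : ∀ F : FreeAlgebra ℂ[X] (Fin n),
      ∃ H, F - emb (evalHom a F) = (Polynomial.X - Polynomial.C a) • H := by
    intro F
    induction F using FreeAlgebra.induction with
    | grade0 p =>
      obtain ⟨s, hs⟩ := Polynomial.X_sub_C_dvd_sub_C_eval (a := a) (p := p)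
      refine ⟨algebraMap _ _ s, ?_⟩
      rw [evalHom_algebraMap, AlgHom.commutes,
        IsScalarTower.algebraMap_apply ℂ ℂ[X] (FreeAlgebra ℂ[X] (Fin n)), ← map_sub,
        Polynomial.algebraMap_eq, hs, map_mul, Algebra.smul_def]
    | grade1 i =>
      refine ⟨0, ?_⟩
      rw [evalHom_ι, FreeAlgebra.lift_ι_apply, sub_self, smul_zero]
    | add F F' hF hF' =>
      obtain ⟨H, hH⟩ := hF
      obtain ⟨H', hH'⟩ := hF'
      refine ⟨H + H', ?_⟩
      rw [map_add, map_add, smul_add, ← hH, ← hH']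
      abel
    | mul F F' hF hF' =>
      obtain ⟨H, hH⟩ := hF
      obtain ⟨H', hH'⟩ := hF'
      refine ⟨F * H' + H * emb (evalHom a F'), ?_⟩
      rw [map_mul, map_mul, smul_add, ← mul_smul_comm, ← smul_mul_assoc, ← hH, ← hH', mul_sub,
        sub_mul]
      abel
  obtain ⟨H, hH⟩ := key F
  exact ⟨H, by rw [← hH, hF, map_zero, sub_zero]⟩

theorem evalHom_quadRelation {L : Matrix (Fin n) (Fin n) ℂ} (a : ℂ)
    (c : Fin n → Fin n → Fin n → Fin n → ℂ[X]) (x y : Fin n) :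
    evalHom a (quadRelation ℂ[X] L c x y) =
      quadRelation ℂ L (fun y x k l => (c y x k l).eval a) x y := by
  simp only [quadRelation, map_add, map_neg, map_mul, evalHom_smul, map_sum, evalHom_ι]
  simp

theorem evalHom_mem_quadIdeal {L : Matrix (Fin n) (Fin n) ℂ} (a : ℂ)
    (c : Fin n → Fin n → Fin n → Fin n → ℂ[X]) {F : FreeAlgebra ℂ[X] (Fin n)}
    (hF : F ∈ quadIdeal ℂ[X] L c) :
    evalHom a F ∈ quadIdeal ℂ L (fun y x k l => (c y x k l).eval a) := by
  rw [← TwoSidedIdeal.mem_comap]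
  refine TwoSidedIdeal.span_le.2 ?_ hF
  rintro _ ⟨x, y, hxy, rfl⟩
  rw [SetLike.mem_coe, TwoSidedIdeal.mem_comap, evalHom_quadRelation]
  exact quadRelation_mem_quadIdeal _ _ _ hxy

theorem exists_evalHom_eq_of_mem_quadIdeal {L : Matrix (Fin n) (Fin n) ℂ} (a : ℂ)
    (c : Fin n → Fin n → Fin n → Fin n → ℂ[X]) {f : FreeAlgebra ℂ (Fin n)}
    (hf : f ∈ quadIdeal ℂ L (fun y x k l => (c y x k l).eval a)) :
    ∃ F ∈ quadIdeal ℂ[X] L c, evalHom a F = f := by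
  refine TwoSidedIdeal.span_induction
    (p := fun f _ => ∃ F ∈ quadIdeal ℂ[X] L c, evalHom a F = f) ?_ ?_ ?_ ?_ ?_ ?_ hf
  · rintro _ ⟨x, y, hxy, rfl⟩
    exact ⟨_, quadRelation_mem_quadIdeal _ _ _ hxy, evalHom_quadRelation a c x y⟩
  · exact ⟨0, TwoSidedIdeal.zero_mem _, map_zero _⟩
  · rintro _ _ _ _ ⟨F, hF, rfl⟩ ⟨H, hH, rfl⟩
    exact ⟨F + H, TwoSidedIdeal.add_mem _ hF hH, map_add _ _ _⟩
  · rintro _ _ ⟨F, hF, rfl⟩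
    exact ⟨-F, TwoSidedIdeal.neg_mem _ hF, map_neg _ _⟩
  · rintro f _ _ ⟨F, hF, rfl⟩
    obtain ⟨H, rfl⟩ := exists_evalHom_eq a f
    exact ⟨H * F, TwoSidedIdeal.mul_mem_left _ _ _ hF, map_mul _ _ _⟩
  · rintro f _ _ ⟨F, hF, rfl⟩
    obtain ⟨H, rfl⟩ := exists_evalHom_eq a f
    exact ⟨F * H, TwoSidedIdeal.mul_mem_right _ _ _ hF, map_mul _ _ _⟩

/-- Specialization preserves the independence of the sorted words. -/
theorem SortedIndependent.eval {L : Matrix (Fin n) (Fin n) ℂ} {W : WeightSystem n}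
    {c : Fin n → Fin n → Fin n → Fin n → ℂ[X]} (hc : IsTriangular W c)
    (h : SortedIndependent (quadIdeal ℂ[X] L c)) (a : ℂ) :
    SortedIndependent (quadIdeal ℂ L (fun y x k l => (c y x k l).eval a)) := by
  obtain ⟨κ, hκ⟩ := h.exists_isNormalForm fun f => WeightSystem.exists_sub_sortedSection_mem hc
    (fun x y hxy => quadRelation_mem_quadIdeal _ _ _ hxy) f
  intro x hx
  obtain ⟨F, hF, hFx⟩ := exists_evalHom_eq_of_mem_quadIdeal a c hx
  obtain ⟨z, rfl⟩ : ∃ z, evalVec a z = x := by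
    refine ⟨x.mapRange Polynomial.C (map_zero _), ?_⟩
    ext p
    simp
  -- A lift z of the relation and an element F of the ideal differ by a multiple of X − a. The
  -- normal form is linear and kills F, so z is itself a multiple of X − a and its value at a is
  -- zero.
  obtain ⟨H, hH⟩ := exists_smul_of_evalHom_eq_zero (F := F - sortedSection ℂ[X] z) (a := a) (by
    rw [map_sub, hFx, evalHom_sortedSection, sub_self])
  have h1 := congrArg (fun f => evalVec a (κ f)) hH
  simp only [map_sub, map_smul, (hκ.2.2 F).2 hF, hκ.2.1, evalVec_smul] at h1
  simpa using h1

/-- Flatness and the correct special fibre imply the independence of the sorted words. -/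
theorem IsFlatDeformation.sortedIndependent {J : TwoSidedIdeal (FreeAlgebra ℂ[X] (Fin n))}
    {J₀ : TwoSidedIdeal (FreeAlgebra ℂ (Fin n))} (h : IsFlatDeformation J J₀)
    (h₀ : SortedIndependent J₀) : SortedIndependent J := by
  obtain ⟨φ, h1, h2, -, -⟩ := h.special_fibre
  have hflat := h.flat
  have hφ : ∀ F, φ (J.ringCon.mk' F) = J₀.ringCon.mk' (evalHom 0 F) := by
    intro F
    induction F using FreeAlgebra.induction with
    | grade0 p =>
      rw [evalHom_algebraMap]
      exact h1 p
    | grade1 i => rw [h2, evalHom_ι]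
    | add F F' hF hF' => simp only [map_add, hF, hF']
    | mul F F' hF hF' => simp only [map_mul, hF, hF']
  have hmk : ∀ F, J.ringCon.mk' F = 0 ↔ F ∈ J := fun F => by
    rw [← TwoSidedIdeal.mem_ker, TwoSidedIdeal.ker_ringCon_mk']
  have hmk₀ : ∀ f, J₀.ringCon.mk' f = 0 ↔ f ∈ J₀ := fun f => by
    rw [← TwoSidedIdeal.mem_ker, TwoSidedIdeal.ker_ringCon_mk']
  -- Independence in the special fibre makes a relation among sorted words divisible by X, and
  -- flatness makes the quotient torsion-free, so X can be cancelled. Iterating, the coefficients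
  -- are divisible by all powers of X.
  have hdiv : ∀ x, sortedSection ℂ[X] x ∈ J →
      ∃ y, x = (Polynomial.X : ℂ[X]) • y ∧ sortedSection ℂ[X] y ∈ J := by
    intro x hx
    have h3 : sortedSection ℂ (evalVec 0 x) ∈ J₀ := by
      rw [← evalHom_sortedSection, ← hmk₀, ← hφ, (hmk _).2 hx, map_zero]
    have h4 := h₀ _ h3
    have h5 : x = (Polynomial.X : ℂ[X]) • x.mapRange Polynomial.divX Polynomial.divX_zero := by
      ext1 p
      have h6 : (x p).coeff 0 = 0 := by
        rw [Polynomial.coeff_zero_eq_eval_zero, ← evalVec_apply, h4]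
        rfl
      have h7 := Polynomial.divX_mul_X_add (x p)
      rw [h6, map_zero, add_zero, mul_comm] at h7
      rw [Finsupp.smul_apply, Finsupp.mapRange_apply, smul_eq_mul, h7]
    refine ⟨_, h5, ?_⟩
    have h8 : (Polynomial.X : ℂ[X]) • J.ringCon.mk' (sortedSection ℂ[X]
        (x.mapRange Polynomial.divX Polynomial.divX_zero)) = 0 := by
      have h9 := (hmk _).2 hx
      rw [h5, map_smul] at h9
      exact h9
    rw [← hmk]
    exact (smul_eq_zero.1 h8).resolve_left Polynomial.X_ne_zero
  have hpow : ∀ (k : ℕ) (x : (Fin n → ℕ) →₀ ℂ[X]), sortedSection ℂ[X] x ∈ J →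
      ∀ p, (Polynomial.X : ℂ[X]) ^ k ∣ x p := by
    intro k
    induction k with
    | zero =>
      intro x _ p
      simp
    | succ k ih =>
      intro x hx p
      obtain ⟨y, rfl, hy⟩ := hdiv x hx
      rw [pow_succ', Finsupp.smul_apply, smul_eq_mul]
      exact mul_dvd_mul_left _ (ih y hy p)
  intro x hx
  ext1 p
  ext d
  exact Polynomial.X_pow_dvd_iff.1 (hpow (d + 1) x hx p) d (by omega)

/-- The independence of the sorted words implies flatness and the correct special fibre. -/
theorem isFlatDeformation_of_sortedIndependent {L : Matrix (Fin n) (Fin n) ℂ} {W : WeightSystem n}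
    {c : Fin n → Fin n → Fin n → Fin n → ℂ[X]} (hc : IsTriangular W c)
    (h : SortedIndependent (quadIdeal ℂ[X] L c)) {J₀ : TwoSidedIdeal (FreeAlgebra ℂ (Fin n))}
    (hJ₀ : J₀ = quadIdeal ℂ L (fun y x k l => (c y x k l).eval 0)) :
    IsFlatDeformation (quadIdeal ℂ[X] L c) J₀ := by
  obtain ⟨J, hJ⟩ : ∃ J, J = quadIdeal ℂ[X] L c := ⟨_, rfl⟩
  have h₀ : SortedIndependent J₀ := by
    rw [hJ₀]
    exact h.eval hc 0
  have hev : ∀ F ∈ J, evalHom 0 F ∈ J₀ := by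
    intro F hF
    rw [hJ₀]
    exact evalHom_mem_quadIdeal 0 c (hJ ▸ hF)
  obtain ⟨κ, hκ⟩ := h.exists_isNormalForm fun f => WeightSystem.exists_sub_sortedSection_mem hc
    (fun x y hxy => quadRelation_mem_quadIdeal _ _ _ hxy) f
  rw [← hJ] at hκ h ⊢
  have hmk : ∀ F, J.ringCon.mk' F = 0 ↔ F ∈ J := fun F => by
    rw [← TwoSidedIdeal.mem_ker, TwoSidedIdeal.ker_ringCon_mk']
  have hmk₀ : ∀ f, J₀.ringCon.mk' f = 0 ↔ f ∈ J₀ := fun f => by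
    rw [← TwoSidedIdeal.mem_ker, TwoSidedIdeal.ker_ringCon_mk']
  constructor
  -- Spanning and independence make the quotient free over ℂ[X] on the sorted words.
  · have hbij : Function.Bijective
        (((RingCon.mkₐ ℂ[X] J.ringCon).toLinearMap).comp (sortedSection ℂ[X])) := by
      constructor
      · rw [injective_iff_map_eq_zero]
        intro x hx
        exact h x ((hmk _).1 hx)
      · intro u
        obtain ⟨F, rfl⟩ := RingCon.mk'_surjective J.ringCon u
        refine ⟨κ F, ?_⟩
        have := (hmk _).2 (hκ.1 F)
        rw [map_sub, sub_eq_zero] at this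
        exact this.symm
    exact Module.Flat.of_linearEquiv (LinearEquiv.ofBijective _ hbij).symm
  · have hker : J.ringCon ≤ RingCon.ker ((J₀.ringCon.mk').comp (evalHom 0)) := by
      intro F F' hFF
      rw [TwoSidedIdeal.rel_iff] at hFF
      have h1 := (hmk₀ _).2 (hev _ hFF)
      rw [map_sub, map_sub, sub_eq_zero] at h1
      exact h1
    refine ⟨J.ringCon.lift _ hker, fun p => ?_, fun i => ?_, ?_, fun u => ⟨fun hu => ?_, ?_⟩⟩
    · change J₀.ringCon.mk' (evalHom 0 (algebraMap _ _ p)) = _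
      rw [evalHom_algebraMap]
      rfl
    · change J₀.ringCon.mk' (evalHom 0 (FreeAlgebra.ι _ i)) = _
      rw [evalHom_ι]
    · intro u
      obtain ⟨f, rfl⟩ := RingCon.mk'_surjective J₀.ringCon u
      obtain ⟨F, rfl⟩ := exists_evalHom_eq 0 f
      exact ⟨J.ringCon.mk' F, rfl⟩
    · obtain ⟨F, rfl⟩ := RingCon.mk'_surjective J.ringCon u
      have h1 : evalHom 0 F ∈ J₀ := (hmk₀ _).1 hu
      have h2 := hev _ (hκ.1 F)
      rw [map_sub, evalHom_sortedSection] at h2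
      have h3 := TwoSidedIdeal.sub_mem _ h1 h2
      rw [sub_sub_cancel] at h3
      have h4 := h₀ _ h3
      have h5 : κ F = (Polynomial.X : ℂ[X]) •
          (κ F).mapRange Polynomial.divX Polynomial.divX_zero := by
        ext1 p
        have h6 : (κ F p).coeff 0 = 0 := by
          rw [Polynomial.coeff_zero_eq_eval_zero, ← evalVec_apply, h4]
          rfl
        have h7 := Polynomial.divX_mul_X_add (κ F p)
        rw [h6, map_zero, add_zero, mul_comm] at h7
        rw [Finsupp.smul_apply, Finsupp.mapRange_apply, smul_eq_mul, h7]
      have h8 := (hmk _).2 (hκ.1 F)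
      rw [map_sub, sub_eq_zero, h5, map_smul] at h8
      exact ⟨J.ringCon.mk' (sortedSection ℂ[X]
        ((κ F).mapRange Polynomial.divX Polynomial.divX_zero)), h8⟩
    · rintro ⟨v, rfl⟩
      obtain ⟨F, rfl⟩ := RingCon.mk'_surjective J.ringCon v
      change J₀.ringCon.mk' (evalHom 0 ((Polynomial.X : ℂ[X]) • F)) = 0
      rw [evalHom_smul, Polynomial.eval_X, zero_smul, map_zero]

end Specialization

/-! ### Existence -/

section Existence

variable {n : ℕ} {L b : Matrix (Fin n) (Fin n) ℂ} {G : SimpleGraph (Fin n)}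

theorem sortedIndependent_quadIdeal_zero (R : Type*) [CommRing R] [Algebra ℂ R]
    (W : WeightSystem n) (L : Matrix (Fin n) (Fin n) ℂ) :
    SortedIndependent (quadIdeal R L 0) := by
  refine WeightSystem.sortedIndependent_of_isStar (W := W) (1 : R)
    (WeightSystem.isStar_skewProduct W L)
    (WeightSystem.assoc_eq_zero WeightSystem.assoc_skewProduct) (C := 0) (fun x y hxy => ?_)
    fun x y k l _ => Or.inl ⟨rfl, rfl⟩
  rw [WeightSystem.varVec, WeightSystem.varVec, WeightSystem.skewProduct_single,
    WeightSystem.skewProduct_single, intVec_single, intVec_single, twist_single_single,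
    twist_single_single, if_pos hxy, if_neg hxy.asymm, Complex.exp_zero, one_smul,
    add_comm (Pi.single y 1), entrywiseExp, sub_self]
  simp

theorem eval_deformedCoeff (N : ℕ) (C : Fin n → Fin n → Fin n → Fin n → ℂ) (a : ℂ)
    (y x k l : Fin n) : (deformedCoeff ℂ[X] b G N C Polynomial.X y x k l).eval a =
      deformedCoeff ℂ b G N C a y x k l := by
  simp only [deformedCoeff, Polynomial.eval_finsetSum]
  refine Finset.sum_congr rfl fun m _ => ?_
  split_ifs
  · rw [Polynomial.eval_mul, Polynomial.eval_pow, Polynomial.eval_X]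
    congr 1
    exact Polynomial.eval_C
  · exact Polynomial.eval_zero

theorem deformedCoeff_zero (N : ℕ) (C : Fin n → Fin n → Fin n → Fin n → ℂ) :
    deformedCoeff ℂ b G N C 0 = 0 := by
  ext y x k l
  refine Finset.sum_eq_zero fun m hm => ?_
  rw [Finset.mem_Icc] at hm
  rw [zero_pow (by omega), zero_mul, ite_self]

theorem le_sum_sum {α β : Type*} [Fintype α] [Fintype β] (d : α → β → ℕ) (x : α) (y : β) :
    d x y ≤ ∑ x, ∑ y, d x y :=
  (Finset.single_le_sum (f := d x) (fun _ _ => Nat.zero_le _) (Finset.mem_univ y)).trans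
    (Finset.single_le_sum (f := fun x => ∑ y, d x y) (fun _ _ => Nat.zero_le _)
      (Finset.mem_univ x))

/-- The constants are read off from the commutators of an associative product with prescribed level
one part. Its Rees deformation gives independence over ℂ[X], from which both flatness and the
associated graded condition follow. -/
theorem exists_isFlatFilteredDeformation (halt : IsAlternating L) (hgen : IsGeneric L)
    (hb : IsBiresidue L b) (hG : G.IsAcyclic) (γ : Sym2 (Fin n) → ℂ) :
    ∃ (N : ℕ) (C : Fin n → Fin n → Fin n → Fin n → ℂ),
      IsFlatFilteredDeformation (entrywiseExp L) b G γ N C := by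
  obtain ⟨B, hB, hBa, hγ⟩ := exists_star_of_edgeConstants halt hgen hb hG γ
  obtain ⟨C, hsupp, hC, hlead⟩ := WeightSystem.exists_commutator_coeff hB
  obtain ⟨d, hd⟩ : ∃ d : Fin n → Fin n → ℕ,
    ∀ x y, d x y = (smoothSystem hb hG).depth (Pi.single x 1 + Pi.single y 1) :=
    ⟨_, fun _ _ => rfl⟩
  -- The depths bound all levels that can occur in degree two; the summand 1 ensures N ≥ 1.
  obtain ⟨N, hN⟩ : ∃ N : ℕ, N = 1 + ∑ x, ∑ y, d x y := ⟨_, rfl⟩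
  have hq : ∀ x y k l : Fin n, intVec (Pi.single k 1 + Pi.single l 1) -
      intVec (Pi.single x 1 + Pi.single y 1) = quadWeight x y k l := by
    intro x y k l
    simp only [quadWeight, intVec_add, intVec_single]
    abel
  have hsupp' : ∀ x y k l, C y x k l ≠ 0 →
      x < y ∧ k ≤ l ∧ ∃ m, 1 ≤ m ∧ m ≤ N ∧ quadWeight x y k l ∈ weightSums b G m := by
    intro x y k l hne
    obtain ⟨hxy, hkl, m, hm, hw⟩ := hsupp x y k l hne
    refine ⟨hxy, hkl, m, hm, ?_, hw⟩
    have hw' : intVec (Pi.single k 1 + Pi.single l 1) -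
        intVec (Pi.single x 1 + Pi.single y 1) ∈ (smoothSystem hb hG).level m := by
      rw [hq]
      exact hw
    have h1 := (smoothSystem hb hG).depth_add_le hw'
    have h2 := le_sum_sum d x y
    rw [← hd, ← hd] at h1
    omega
  have hind : SortedIndependent
      (quadIdeal ℂ[X] L (deformedCoeff ℂ[X] b G N C Polynomial.X)) := by
    refine WeightSystem.sortedIndependent_of_isStar (Polynomial.X : ℂ[X]) hB hBa hC
      fun x y k l hxy => ?_
    by_cases h0 : C y x k l = 0
    · exact Or.inl ⟨h0, by simp [deformedCoeff, h0]⟩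
    · obtain ⟨-, hkl, m, hm, hmN, hw⟩ := hsupp' x y k l h0
      exact Or.inr ⟨m, hw, deformedCoeff_eq hb hG (Finset.mem_Icc.2 ⟨hm, hmN⟩) hkl hw⟩
  have htri := isTriangular_deformedCoeff (R := ℂ[X]) hb hG N C Polynomial.X
  refine ⟨N, C, by omega, hsupp', fun i j hadj x y k l hxy hkl hθ => ?_, ?_, ?_⟩
  · have hw : quadWeight x y k l ∈ (smoothSystem hb hG).level 1 :=
      mem_weightSums_one.2 ⟨i, j, hadj, hθ⟩
    have hv : intVec (Pi.single x 1 + Pi.single y 1) + quadWeight x y k l =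
        intVec (Pi.single k 1 + Pi.single l 1) := by
      rw [← hq, add_sub_cancel]
    have h := hγ i j _ hadj hθ x y hxy (by
      rw [hv]
      exact intVec_nonneg _)
    rw [hv] at h
    rw [hlead x y k l hxy hkl hw]
    exact h
  · rw [deformedIdeal_eq_quadIdeal]
    refine isFlatDeformation_of_sortedIndependent htri hind ?_
    simp only [eval_deformedCoeff]
    rw [← quadIdeal_zero_eq_toricIdeal halt]
    congr 1
    exact (deformedCoeff_zero N C).symm
  · rw [deformedIdeal_eq_quadIdeal, ← quadIdeal_zero_eq_toricIdeal halt]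
    have hspan := fun f => WeightSystem.exists_sub_sortedSection_mem htri
      (fun x y hxy => quadRelation_mem_quadIdeal ℂ[X] L _ hxy) f
    have htri₀ : IsTriangular (smoothSystem hb hG)
      (0 : Fin n → Fin n → Fin n → Fin n → ℂ[X]) := isTriangular_zero _
    have hspan₀ := fun f => WeightSystem.exists_sub_sortedSection_mem htri₀
      (fun x y hxy => quadRelation_mem_quadIdeal ℂ[X] L _ hxy) f
    obtain ⟨κ, hκ⟩ := hind.exists_isNormalForm hspan
    obtain ⟨κ₀, hκ₀⟩ := (sortedIndependent_quadIdeal_zero ℂ[X] (smoothSystem hb hG)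
      L).exists_isNormalForm hspan₀
    exact hκ.sameAssociatedGraded htri (fun x y hxy => quadRelation_mem_quadIdeal _ _ _ hxy) hκ₀
      htri₀ (fun x y hxy => quadRelation_mem_quadIdeal _ _ _ hxy)

end Existence

/-! ### The star product of a normal form -/

section NormalProduct

variable {n : ℕ}

/-- The product of normal forms. -/
noncomputable def normalProduct (κ : FreeAlgebra ℂ (Fin n) →ₗ[ℂ] MonoSpace n) : MonoProduct n :=
  ((LinearMap.mul ℂ (FreeAlgebra ℂ (Fin n))).compl₁₂ (sortedSection ℂ) (sortedSection ℂ)).compr₂ κ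

theorem normalProduct_apply (κ : FreeAlgebra ℂ (Fin n) →ₗ[ℂ] MonoSpace n) (x y : MonoSpace n) :
    normalProduct κ x y = κ (sortedSection ℂ x * sortedSection ℂ y) := rfl

variable {J : TwoSidedIdeal (FreeAlgebra ℂ (Fin n))}
  {κ : FreeAlgebra ℂ (Fin n) →ₗ[ℂ] MonoSpace n}

theorem IsNormalForm.map_mul (hκ : IsNormalForm J κ) (f g : FreeAlgebra ℂ (Fin n)) :
    normalProduct κ (κ f) (κ g) = κ (f * g) := by
  rw [normalProduct_apply]
  refine (hκ.eq_of_sub_mem ?_).symm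
  rw [show f * g - sortedSection ℂ (κ f) * sortedSection ℂ (κ g) =
    (f - sortedSection ℂ (κ f)) * g + sortedSection ℂ (κ f) * (g - sortedSection ℂ (κ g)) by
    rw [sub_mul, mul_sub]
    abel]
  exact J.add_mem (J.mul_mem_right _ _ (hκ.1 f)) (J.mul_mem_left _ _ (hκ.1 g))

theorem IsNormalForm.assoc_eq_zero (hκ : IsNormalForm J κ) (x y z : MonoSpace n) :
    WeightSystem.assoc (normalProduct κ) x y z = 0 := by
  have h1 := hκ.map_mul (sortedSection ℂ x * sortedSection ℂ y) (sortedSection ℂ z)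
  have h2 := hκ.map_mul (sortedSection ℂ x) (sortedSection ℂ y * sortedSection ℂ z)
  rw [hκ.2.1] at h1 h2
  rw [WeightSystem.assoc, normalProduct_apply κ x y, normalProduct_apply κ y z, h1, h2, mul_assoc,
    sub_self]

theorem IsNormalForm.sortedWord (hκ : IsNormalForm J κ) (p : Fin n → ℕ) :
    κ (wordMonomial ℂ (sortedList p)) = Finsupp.single p 1 := by
  rw [← sortedSection_single, hκ.2.1]

variable {W : WeightSystem n} {L : Matrix (Fin n) (Fin n) ℂ}
  {c : Fin n → Fin n → Fin n → Fin n → ℂ}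

/-- The passage back from relations to products: a product of sorted words straightens to its sorted
word, scaled by the bicharacter, up to higher level. -/
theorem IsNormalForm.isStar (hκ : IsNormalForm J κ) (hc : IsTriangular W c)
    (hJ : ∀ x y, x < y → quadRelation ℂ L c x y ∈ J) :
    WeightSystem.IsStar W L (normalProduct κ) := by
  refine ⟨fun p q => ?_, fun x => ?_, fun x => ?_⟩
  · have h := hκ.word_sub_mem_fil hc hJ (sortedList p ++ sortedList q)
    rw [expo_append, listTwist_append, expo_sortedList, expo_sortedList, listTwist_sortedList,
      listTwist_sortedList, zero_add, zero_add, wordMonomial_append] at h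
    rw [normalProduct_apply, sortedSection_single, sortedSection_single, Finsupp.smul_single,
      smul_eq_mul, mul_one]
    exact h
  · rw [normalProduct_apply, sortedSection_single, sortedList_zero, wordMonomial_nil, one_mul,
      hκ.2.1]
  · rw [normalProduct_apply, sortedSection_single, sortedList_zero, wordMonomial_nil, mul_one,
      hκ.2.1]

theorem normalProduct_var (κ : FreeAlgebra ℂ (Fin n) →ₗ[ℂ] MonoSpace n) (k l : Fin n) :
    normalProduct κ (Finsupp.single (Pi.single k 1) 1) (Finsupp.single (Pi.single l 1) 1) =
      κ (FreeAlgebra.ι ℂ k * FreeAlgebra.ι ℂ l) := by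
  rw [normalProduct_apply, sortedSection_single, sortedSection_single, sortedList_single,
    sortedList_single, wordMonomial_singleton, wordMonomial_singleton]

theorem IsNormalForm.var_mul_var (hκ : IsNormalForm J κ) {k l : Fin n} (hkl : k ≤ l) :
    κ (FreeAlgebra.ι ℂ k * FreeAlgebra.ι ℂ l) =
      Finsupp.single (Pi.single k 1 + Pi.single l 1) 1 := by
  rw [← wordMonomial_pair, ← sortedList_single_add_single hkl, hκ.sortedWord]

theorem IsNormalForm.commutator (hκ : IsNormalForm J κ) (hc : IsTriangular W c)
    (hJ : ∀ x y, x < y → quadRelation ℂ L c x y ∈ J) {x y : Fin n} (hxy : x < y) :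
    normalProduct κ (Finsupp.single (Pi.single y 1) 1) (Finsupp.single (Pi.single x 1) 1)
      - entrywiseExp L y x •
        normalProduct κ (Finsupp.single (Pi.single x 1) 1) (Finsupp.single (Pi.single y 1) 1) =
      ∑ k, ∑ l, c y x k l • Finsupp.single (Pi.single k 1 + Pi.single l 1) 1 := by
  have h := (hκ.2.2 _).2 (hJ x y hxy)
  have h2 : κ (∑ k, ∑ l, c y x k l • (FreeAlgebra.ι ℂ k * FreeAlgebra.ι ℂ l)) =
      ∑ k, ∑ l, c y x k l • Finsupp.single (Pi.single k 1 + Pi.single l 1) 1 := by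
    simp only [map_sum, map_smul]
    refine Finset.sum_congr rfl fun k _ => Finset.sum_congr rfl fun l _ => ?_
    by_cases h0 : c y x k l = 0
    · rw [h0, zero_smul, zero_smul]
    · rw [hκ.var_mul_var (hc x y k l hxy h0).1]
  rw [quadRelation, map_add, map_add, map_neg, map_smul, h2] at h
  rw [normalProduct_var, normalProduct_var]
  rw [← sub_eq_zero, ← neg_eq_zero, ← h]
  simp only [Algebra.algebraMap_self, RingHom.id_apply]
  abel

end NormalProduct

/-! ### Triangular substitutions -/

section Substitution

variable {n : ℕ}

namespace WeightSystem

/-- The span of the words whose weight lies above `p` by a weight of level at least `m`. -/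
def wordFil (W : WeightSystem n) (p : Fin n → ℕ) (m : ℕ) :
    Submodule ℂ (FreeAlgebra ℂ (Fin n)) :=
  Submodule.span ℂ {f | ∃ l k, m ≤ k ∧ intVec (expo l) - intVec p ∈ W.level k ∧
    f = wordMonomial ℂ l}

variable {W : WeightSystem n}

theorem word_mem_wordFil (l : List (Fin n)) : wordMonomial ℂ l ∈ W.wordFil (expo l) 0 :=
  Submodule.subset_span ⟨l, 0, le_rfl, by simpa using W.zero_mem, rfl⟩

theorem wordFil_anti {p : Fin n → ℕ} {a m : ℕ} (h : a ≤ m) : W.wordFil p m ≤ W.wordFil p a :=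
  Submodule.span_mono fun _ ⟨l, k, hk, h'⟩ => ⟨l, k, h.trans hk, h'⟩

theorem mul_mem_wordFil {p q : Fin n → ℕ} {a m : ℕ} {f g : FreeAlgebra ℂ (Fin n)}
    (hf : f ∈ W.wordFil p a) (hg : g ∈ W.wordFil q m) : f * g ∈ W.wordFil (p + q) (a + m) := by
  have h := Submodule.mul_mem_mul hf hg
  rw [wordFil, wordFil, Submodule.span_mul_span] at h
  refine Submodule.span_mono ?_ h
  rintro _ ⟨_, ⟨l, k, hk, hl, rfl⟩, _, ⟨l', k', hk', hl', rfl⟩, rfl⟩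
  refine ⟨l ++ l', k + k', by omega, ?_, (wordMonomial_append ℂ l l').symm⟩
  rw [expo_append, intVec_add, intVec_add, add_sub_add_comm]
  exact W.add_mem hl hl'

/-- A matrix is triangular if its diagonal entries are nonzero and its other nonzero entries are
at weights of positive level. -/
structure IsTriangularMatrix (W : WeightSystem n) (g : Matrix (Fin n) (Fin n) ℂ) : Prop where
  diag_ne : ∀ i, g i i ≠ 0
  level : ∀ i j, i ≠ j → g j i ≠ 0 →
    ∃ k, 1 ≤ k ∧ (Pi.single j 1 - Pi.single i 1 : Fin n → ℤ) ∈ W.level k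

variable {g : Matrix (Fin n) (Fin n) ℂ}

theorem IsTriangularMatrix.var_sub_mem (hg : IsTriangularMatrix W g) (i : Fin n) :
    linearSubst g (FreeAlgebra.ι ℂ i) - g i i • FreeAlgebra.ι ℂ i ∈ W.wordFil (Pi.single i 1) 1 := by
  rw [linearSubst, FreeAlgebra.lift_ι_apply, ← Finset.sum_erase_add _ _ (Finset.mem_univ i),
    add_sub_cancel_right]
  refine Submodule.sum_mem _ fun j hj => ?_
  by_cases h0 : g j i = 0
  · rw [h0, zero_smul]
    exact Submodule.zero_mem _
  · obtain ⟨k, hk, hw⟩ := hg.level i j (Finset.ne_of_mem_erase hj).symm h0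
    refine Submodule.smul_mem _ _ (Submodule.subset_span ⟨[j], k, hk, ?_,
      (wordMonomial_singleton ℂ j).symm⟩)
    rwa [expo_cons, expo_nil, add_zero, intVec_single, intVec_single]

theorem IsTriangularMatrix.word_sub_mem (hg : IsTriangularMatrix W g) (l : List (Fin n)) :
    linearSubst g (wordMonomial ℂ l) - (l.map fun i => g i i).prod • wordMonomial ℂ l ∈
      W.wordFil (expo l) 1 := by
  induction l with
  | nil => simp [wordMonomial_nil]
  | cons i l ih =>
    have h0 : linearSubst g (wordMonomial ℂ l) ∈ W.wordFil (expo l) 0 := by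
      have := Submodule.add_mem _ (wordFil_anti zero_le_one ih)
        (Submodule.smul_mem _ (l.map fun i => g i i).prod (word_mem_wordFil (W := W) l))
      rwa [sub_add_cancel] at this
    have hi : FreeAlgebra.ι ℂ i ∈ W.wordFil (Pi.single i 1) 0 := by
      have := word_mem_wordFil (W := W) [i]
      rwa [wordMonomial_singleton, expo_cons, expo_nil, add_zero] at this
    have h1 := mul_mem_wordFil (hg.var_sub_mem i) h0
    have h2 := Submodule.smul_mem _ (g i i) (mul_mem_wordFil hi ih)
    have h3 := Submodule.add_mem _ h1 h2
    rw [expo_cons]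
    convert h3 using 1
    rw [wordMonomial_cons, map_mul, List.map_cons, List.prod_cons, sub_mul, mul_sub, smul_sub,
      mul_smul_comm, smul_mul_assoc, smul_smul]
    abel

/-- Off-diagonal entries lead from e_i to basis vectors of smaller depth, so induction on depth puts
every basis vector into the range. -/
theorem IsTriangularMatrix.isUnit (hg : IsTriangularMatrix W g) : IsUnit g := by
  rw [← Matrix.mulVec_surjective_iff_isUnit, ← Matrix.coe_mulVecLin, ← LinearMap.range_eq_top,
    eq_top_iff, ← (Pi.basisFun ℂ (Fin n)).span_eq, Submodule.span_le]
  rintro _ ⟨i, rfl⟩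
  rw [Pi.basisFun_apply]
  obtain ⟨d, hd⟩ : ∃ d, W.depth (Pi.single i 1) = d := ⟨_, rfl⟩
  induction d using Nat.strong_induction_on generalizing i with
  | _ d ih =>
  have h : g.mulVecLin (Pi.single i 1) = ∑ j, g j i • Pi.single j (1 : ℂ) := by
    ext k
    simp [Finset.sum_apply, Pi.single_apply]
  have h2 : g i i • Pi.single i (1 : ℂ) = g.mulVecLin (Pi.single i 1) -
      ∑ j ∈ Finset.univ.erase i, g j i • Pi.single j (1 : ℂ) := by
    rw [h, ← Finset.sum_erase_add _ _ (Finset.mem_univ i), add_sub_cancel_left]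
  have h3 : g i i • Pi.single i (1 : ℂ) ∈ LinearMap.range g.mulVecLin := by
    rw [h2]
    refine Submodule.sub_mem _ (LinearMap.mem_range_self _ _) (Submodule.sum_mem _ fun j hj => ?_)
    by_cases h0 : g j i = 0
    · rw [h0, zero_smul]
      exact Submodule.zero_mem _
    · obtain ⟨k, hk, hw⟩ := hg.level i j (Finset.ne_of_mem_erase hj).symm h0
      rw [← intVec_single, ← intVec_single] at hw
      have := W.depth_add_le hw
      exact Submodule.smul_mem _ _ (ih _ (by omega) j rfl)
  have h4 := Submodule.smul_mem _ (g i i)⁻¹ h3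
  rwa [smul_smul, inv_mul_cancel₀ (hg.diag_ne i), one_smul] at h4

end WeightSystem

variable {L b : Matrix (Fin n) (Fin n) ℂ} {G : SimpleGraph (Fin n)} {g : Matrix (Fin n) (Fin n) ℂ}

/-- The substitution rescales a word and adds words of higher level, so each step is mapped into
itself. For surjectivity induct on depth: up to a nonzero scalar, a word is its image minus words of
smaller depth. -/
theorem WeightSystem.IsTriangularMatrix.isFilteredAutomorphism (hb : IsBiresidue L b)
    (hG : G.IsAcyclic) (hg : (smoothSystem hb hG).IsTriangularMatrix g) :
    IsFilteredAutomorphism b G g := by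
  have hle : ∀ {a m : ℕ} {p : Fin n → ℕ} {w : Fin n → ℤ}, a ≤ m → w ∈ weightSums b G m →
      (∀ i, w i ≤ (p i : ℤ)) → ∀ {l k}, intVec (expo l) - intVec p ∈ (smoothSystem hb hG).level k →
      ∃ w' ∈ weightSums b G (m + k), ∀ i, w' i ≤ (expo l i : ℤ) := by
    intro a m p w hm hw h l k hl
    have hl' : intVec (expo l) - intVec p ∈ weightSums b G k := hl
    refine ⟨_, add_mem_weightSums hw hl', fun i => ?_⟩
    have := h i
    simp only [Pi.add_apply, Pi.sub_apply, intVec_apply]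
    omega
  refine ⟨hg.isUnit, fun a => le_antisymm ?_ ?_⟩
  · rw [Submodule.map_le_iff_le_comap]
    refine Submodule.span_le.2 ?_
    rintro _ ⟨l, rfl, m, hm, w, hw, h⟩
    have h1 : (smoothSystem hb hG).wordFil (expo l) 0 ≤ smoothFiltration ℂ b G a := by
      refine Submodule.span_le.2 ?_
      rintro _ ⟨l', k, -, hk, rfl⟩
      obtain ⟨w', hw', h'⟩ := hle hm hw (p := expo l) h hk
      exact word_mem_smoothFiltration (by omega) hw' h'
    have h2 := Submodule.add_mem _ (h1 (wordFil_anti zero_le_one (hg.word_sub_mem l)))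
      (Submodule.smul_mem _ (l.map fun i => g i i).prod (h1 (word_mem_wordFil l)))
    rw [sub_add_cancel] at h2
    exact h2
  · refine Submodule.span_le.2 ?_
    rintro _ ⟨l, rfl, m, hm, w, hw, h⟩
    obtain ⟨d, hd⟩ : ∃ d, (smoothSystem hb hG).depth (expo l) = d := ⟨_, rfl⟩
    induction d using Nat.strong_induction_on generalizing l m w with
    | _ d ih =>
    have hne : (l.map fun i => g i i).prod ≠ 0 := by
      rw [Ne, List.prod_eq_zero_iff, List.mem_map]
      rintro ⟨i, -, hi⟩
      exact hg.diag_ne i hi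
    have h1 : (smoothSystem hb hG).wordFil (expo l) 1 ≤
        (smoothFiltration ℂ b G a).map (linearSubst g).toLinearMap := by
      refine Submodule.span_le.2 ?_
      rintro _ ⟨l', k, hk1, hk, rfl⟩
      obtain ⟨w', hw', h'⟩ := hle hm hw (p := expo l) h hk
      have := (smoothSystem hb hG).depth_add_le hk
      exact ih _ (by omega) l' (m + k) (by omega) w' hw' h' rfl
    have h2 : linearSubst g (wordMonomial ℂ l) ∈
        (smoothFiltration ℂ b G a).map (linearSubst g).toLinearMap :=
      ⟨_, word_mem_smoothFiltration hm hw h, rfl⟩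
    have h3 := Submodule.smul_mem _ (l.map fun i => g i i).prod⁻¹
      (Submodule.sub_mem _ h2 (h1 (hg.word_sub_mem l)))
    rwa [sub_sub_cancel, smul_smul, inv_mul_cancel₀ hne, one_smul] at h3

end Substitution

/-! ### Comparison of two families of relations -/

section Comparison

variable {n : ℕ} {W : WeightSystem n} {L : Matrix (Fin n) (Fin n) ℂ}
  {c c' : Fin n → Fin n → Fin n → Fin n → ℂ}

theorem exists_eq_single {s : Fin n → ℕ} (hs : ∑ i, s i = 1) : ∃ j, s = Pi.single j 1 := by
  have h0 : s ≠ 0 := by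
    rintro rfl
    simp at hs
  obtain ⟨j, s', rfl, -⟩ := exists_eq_single_add h0
  have h1 : ∑ i, s' i = 0 := by
    simpa [Finset.sum_add_distrib] using hs
  refine ⟨j, ?_⟩
  rw [show s' = 0 from funext fun i => Finset.sum_eq_zero_iff.1 h1 i (Finset.mem_univ i), add_zero]

theorem sortedSection_of_degree_one {i : Fin n} {z : MonoSpace n}
    (hz : z ∈ W.fil ℂ (Pi.single i 1) 0) :
    sortedSection ℂ z = ∑ j, z (Pi.single j 1) • FreeAlgebra.ι ℂ j := by
  let T : MonoSpace n →ₗ[ℂ] FreeAlgebra ℂ (Fin n) := sortedSection ℂ -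
    ∑ j, (Finsupp.lapply (Pi.single j 1)).smulRight (FreeAlgebra.ι ℂ j)
  have hT : ∀ z, T z = sortedSection ℂ z - ∑ j, z (Pi.single j 1) • FreeAlgebra.ι ℂ j := fun z => by
    simp [T, LinearMap.sum_apply]
  rw [← sub_eq_zero, ← hT, ← Submodule.mem_bot ℂ]
  refine W.map_mem_of_mem_fil T ⊥ (fun s k _ hs => ?_) hz
  obtain ⟨a, rfl⟩ := exists_eq_single (s := s) (by rw [W.sum_eq_of_sub_mem hs]; simp)
  rw [Submodule.mem_bot, hT, sortedSection_single, sortedList_single, wordMonomial_singleton,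
    Finset.sum_eq_single_of_mem a (Finset.mem_univ a), Finsupp.single_eq_same, one_smul, sub_self]
  intro j _ hj
  rw [Finsupp.single_eq_of_ne, zero_smul]
  intro h
  have := congrFun h j
  simp [hj] at this

theorem TwoSidedIdeal.map_mem_of_span {A B : Type*} [Ring A] [Ring B] (f : A →+* B) {s : Set A}
    {J : TwoSidedIdeal B} (h : ∀ a ∈ s, f a ∈ J) {a : A} (ha : a ∈ TwoSidedIdeal.span s) :
    f a ∈ J := by
  rw [← TwoSidedIdeal.mem_comap]
  refine TwoSidedIdeal.span_le.2 (fun a ha => ?_) ha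
  rw [SetLike.mem_coe, TwoSidedIdeal.mem_comap]
  exact h a ha

/-- Two families of relations of Poincaré–Birkhoff–Witt type with the same coefficients of level one
are related by a unitriangular substitution. -/
theorem exists_linearSubst (hrig : ∀ m, 2 ≤ m → ∀ w ∈ W.level m, IsRigid L w)
    (hc : IsTriangular W c) (hc' : IsTriangular W c') (hJ : SortedIndependent (quadIdeal ℂ L c))
    (hJ' : SortedIndependent (quadIdeal ℂ L c'))
    (hcc : ∀ x y k l, x < y → k ≤ l → quadWeight x y k l ∈ W.level 1 → c y x k l = c' y x k l) :
    ∃ g, W.IsTriangularMatrix g ∧ (∀ i, g i i = 1) ∧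
      ∀ f, f ∈ quadIdeal ℂ L c ↔ linearSubst g f ∈ quadIdeal ℂ L c' := by
  have hr := fun x y (h : x < y) => quadRelation_mem_quadIdeal ℂ L c h
  have hr' := fun x y (h : x < y) => quadRelation_mem_quadIdeal ℂ L c' h
  obtain ⟨κ, hκ⟩ := hJ.exists_isNormalForm (WeightSystem.exists_sub_sortedSection_mem hc hr)
  obtain ⟨κ', hκ'⟩ := hJ'.exists_isNormalForm (WeightSystem.exists_sub_sortedSection_mem hc' hr')
  obtain ⟨d, hd⟩ : ∃ d : Fin n → Fin n → ℕ,
    ∀ x y, d x y = W.depth (Pi.single x 1 + Pi.single y 1) := ⟨_, fun _ _ => rfl⟩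
  obtain ⟨Φ, hΦ, hD⟩ := WeightSystem.exists_unitriangular hrig (hκ.isStar hc hr)
    (hκ'.isStar hc' hr') hκ.assoc_eq_zero hκ'.assoc_eq_zero (fun w hw i j hij => by
      classical
      rw [hκ.commutator hc hr hij, hκ'.commutator hc' hr' hij]
      simp only [map_sum, map_smul]
      refine Finset.sum_congr rfl fun k _ => Finset.sum_congr rfl fun l _ => ?_
      by_cases hkl : k ≤ l
      · rw [WeightSystem.coef_single]
        split_ifs with h
        · rw [hcc i j k l hij hkl]
          rwa [← WeightSystem.intVec_sub_eq_quadWeight i j k l 0, add_zero, add_zero, h,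
            add_comm (Pi.single j 1), add_sub_cancel_left]
        · simp
      · rw [not_imp_comm.1 (fun h => (hc i j k l hij h).1) hkl,
          not_imp_comm.1 (fun h => (hc' i j k l hij h).1) hkl])
    -- An order beyond all depths in degree two makes Φ exactly multiplicative on pairs of
    -- variables. Nothing more is needed, as the relations are quadratic.
    (1 + ∑ x, ∑ y, d x y)
  have hmul : ∀ k l : Fin n, Φ (κ (FreeAlgebra.ι ℂ k * FreeAlgebra.ι ℂ l)) =
      normalProduct κ' (Φ (Finsupp.single (Pi.single k 1) 1))
        (Φ (Finsupp.single (Pi.single l 1) 1)) := by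
    intro k l
    have h := hD (Pi.single k 1) (Pi.single l 1)
    have h1 := le_sum_sum d k l
    rw [hd] at h1
    rw [W.fil_eq_bot (by omega), Submodule.mem_bot, WeightSystem.mulDefect_apply, sub_eq_zero,
      normalProduct_var] at h
    exact h
  -- Weights have sum zero, so Φ preserves the span of the variables and is given there by a matrix.
  obtain ⟨g, hgdef⟩ : ∃ g : Matrix (Fin n) (Fin n) ℂ,
    ∀ j i, g j i = Φ (Finsupp.single (Pi.single i 1) 1) (Pi.single j 1) := ⟨_, fun _ _ => rfl⟩
  have hsub : ∀ i, linearSubst g (FreeAlgebra.ι ℂ i) =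
      sortedSection ℂ (Φ (Finsupp.single (Pi.single i 1) 1)) := by
    intro i
    rw [sortedSection_of_degree_one (hΦ.mem_fil _), linearSubst, FreeAlgebra.lift_ι_apply]
    simp only [hgdef]
  have hdiag : ∀ i, g i i = 1 := by
    intro i
    rcases W.eq_zero_or_of_mem_fil (hΦ.sub_mem (Pi.single i 1)) (Pi.single i 1) with h | ⟨k, hk, h⟩
    · rw [Finsupp.sub_apply, Finsupp.single_eq_same] at h
      rw [hgdef, sub_eq_zero.1 h]
    · rw [sub_self] at h
      have := W.level_unique h W.zero_mem
      omega
  have hg : W.IsTriangularMatrix g := by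
    refine ⟨fun i => by rw [hdiag]; exact one_ne_zero, fun i j hij hne => ?_⟩
    have hne' : (Pi.single j 1 : Fin n → ℕ) ≠ Pi.single i 1 := by
      intro h
      have := congrFun h i
      simp [hij] at this
    rcases W.eq_zero_or_of_mem_fil (hΦ.sub_mem (Pi.single i 1)) (Pi.single j 1) with h | ⟨k, hk, h⟩
    · rw [Finsupp.sub_apply, Finsupp.single_eq_of_ne hne', sub_zero, ← hgdef] at h
      exact absurd h hne
    · rw [intVec_single, intVec_single] at h
      exact ⟨k, hk, h⟩
  have hquad : ∀ k l : Fin n, κ' (linearSubst g (FreeAlgebra.ι ℂ k * FreeAlgebra.ι ℂ l)) =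
      Φ (κ (FreeAlgebra.ι ℂ k * FreeAlgebra.ι ℂ l)) := by
    intro k l
    rw [hmul, normalProduct_apply, map_mul, hsub, hsub]
  have hforward : ∀ f ∈ quadIdeal ℂ L c, linearSubst g f ∈ quadIdeal ℂ L c' := by
    intro f hf
    refine TwoSidedIdeal.map_mem_of_span (linearSubst g).toRingHom ?_ hf
    rintro _ ⟨x, y, hxy, rfl⟩
    change linearSubst g (quadRelation ℂ L c x y) ∈ _
    rw [← hκ'.2.2]
    have h : κ' (linearSubst g (quadRelation ℂ L c x y)) = Φ (κ (quadRelation ℂ L c x y)) := by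
      simp only [quadRelation, map_add, map_neg, map_smul, map_sum, hquad]
    rw [h, (hκ.2.2 _).2 (hr x y hxy), map_zero]
  refine ⟨g, hg, hdiag, fun f => ⟨hforward f, fun hf => ?_⟩⟩
  -- For the converse, normal forms of substituted sorted words are again unitriangular, hence
  -- independent, so the normal form of f must vanish.
  have h1 : κ' (linearSubst g (sortedSection ℂ (κ f))) = 0 := by
    rw [hκ'.2.2]
    have := (quadIdeal ℂ L c').sub_mem hf (hforward _ (hκ.1 f))
    rwa [map_sub, sub_sub_cancel] at this
  have h2 : ∀ x : MonoSpace n, κ' (linearSubst g (sortedSection ℂ x)) = Finsupp.linearCombination ℂ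
      (fun p => κ' (linearSubst g (wordMonomial ℂ (sortedList p)))) x := by
    intro x
    rw [sortedSection, Finsupp.linearCombination_apply, Finsupp.linearCombination_apply,
      Finsupp.sum, Finsupp.sum]
    simp only [map_sum, map_smul]
  have h3 : Function.Injective (Finsupp.linearCombination ℂ
      (fun p => κ' (linearSubst g (wordMonomial ℂ (sortedList p))))) := by
    refine W.linearCombination_injective _ fun p => ?_
    have e1 : W.wordFil p 1 ≤ (W.fil ℂ p 1).comap κ' := by
      refine Submodule.span_le.2 ?_
      rintro _ ⟨l, k, hk, hl, rfl⟩
      exact W.fil_le hl (m := 0) (by omega) (hκ'.word_mem_fil hc' hr' l)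
    have e2 := hg.word_sub_mem (sortedList p)
    rw [expo_sortedList, show (fun i => g i i) = fun _ => 1 from funext hdiag] at e2
    have e3 := e1 e2
    rw [Submodule.mem_comap, map_sub, List.map_const', List.prod_replicate, one_pow, one_smul,
      hκ'.sortedWord] at e3
    exact e3
  rw [← hκ.2.2]
  rw [h2, ← map_zero (Finsupp.linearCombination ℂ
      (fun p => κ' (linearSubst g (wordMonomial ℂ (sortedList p)))))] at h1
  exact h3 h1

/-- The coefficients of relations of Poincaré–Birkhoff–Witt type are determined by the ideal. -/
theorem coeff_eq_of_quadIdeal_eq (hc : IsTriangular W c) (hc' : IsTriangular W c')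
    (hJ' : SortedIndependent (quadIdeal ℂ L c')) (h : quadIdeal ℂ L c = quadIdeal ℂ L c')
    {x y k l : Fin n} (hxy : x < y) : c y x k l = c' y x k l := by
  have hr' := fun x y (h : x < y) => quadRelation_mem_quadIdeal ℂ L c' h
  obtain ⟨κ', hκ'⟩ := hJ'.exists_isNormalForm (WeightSystem.exists_sub_sortedSection_mem hc' hr')
  -- The difference of the two relations is a combination of sorted words of length two inside one
  -- ideal, so its coefficients vanish.
  have h1 : quadRelation ℂ L c x y - quadRelation ℂ L c' x y ∈ quadIdeal ℂ L c' :=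
    (quadIdeal ℂ L c').sub_mem (h ▸ quadRelation_mem_quadIdeal ℂ L c hxy) (hr' x y hxy)
  have h2 : quadRelation ℂ L c x y - quadRelation ℂ L c' x y =
      ∑ a, ∑ d, (c y x a d - c' y x a d) • (FreeAlgebra.ι ℂ a * FreeAlgebra.ι ℂ d) := by
    simp only [quadRelation, sub_smul, Finset.sum_sub_distrib]
    abel
  have h0 : ∀ a d, ¬ a ≤ d → c y x a d - c' y x a d = 0 := fun a d had => by
    rw [not_imp_comm.1 (fun h => (hc x y a d hxy h).1) had,
      not_imp_comm.1 (fun h => (hc' x y a d hxy h).1) had, sub_self]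
  have h3 := (hκ'.2.2 _).2 h1
  have h4 : ∑ a, ∑ d, (c y x a d - c' y x a d) •
      Finsupp.single (Pi.single a 1 + Pi.single d 1 : Fin n → ℕ) (1 : ℂ) = 0 := by
    rw [← h3, h2]
    simp only [map_sum, map_smul]
    refine Finset.sum_congr rfl fun a _ => Finset.sum_congr rfl fun d _ => ?_
    by_cases had : a ≤ d
    · rw [hκ'.var_mul_var had]
    · rw [h0 a d had, zero_smul, zero_smul]
  rw [← sub_eq_zero]
  by_cases hkl : k ≤ l
  · have h5 := DFunLike.congr_fun h4 (Pi.single k 1 + Pi.single l 1)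
    simp only [Finsupp.finsetSum_apply, Finsupp.smul_apply, smul_eq_mul] at h5
    rw [Finset.sum_eq_single_of_mem k (Finset.mem_univ k),
      Finset.sum_eq_single_of_mem l (Finset.mem_univ l), Finsupp.single_eq_same, mul_one] at h5
    · exact h5
    · intro d _ hd
      by_cases hkd : k ≤ d
      · rw [Finsupp.single_eq_of_ne, mul_zero]
        intro h
        exact hd (WeightSystem.single_add_single_injective hkd hkl h).2.symm
      · rw [h0 k d hkd, zero_mul]
    · intro a _ ha
      refine Finset.sum_eq_zero fun d _ => ?_
      by_cases had : a ≤ d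
      · rw [Finsupp.single_eq_of_ne, mul_zero]
        intro h
        exact ha (WeightSystem.single_add_single_injective had hkl h).1.symm
      · rw [h0 a d had, zero_mul]
  · exact h0 k l hkl

end Comparison

/-! ### Rescaling the variables -/

section Rescaling

variable {n : ℕ} {L : Matrix (Fin n) (Fin n) ℂ}

theorem linearSubst_mul (g h : Matrix (Fin n) (Fin n) ℂ) (f : FreeAlgebra ℂ (Fin n)) :
    linearSubst (g * h) f = linearSubst g (linearSubst h f) := by
  have : linearSubst (g * h) = (linearSubst g).comp (linearSubst h) := by
    apply FreeAlgebra.hom_ext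
    funext i
    simp only [Function.comp_apply, AlgHom.comp_apply, linearSubst, FreeAlgebra.lift_ι_apply,
      map_sum, map_smul, Matrix.mul_apply, Finset.sum_smul, Finset.smul_sum, smul_smul]
    rw [Finset.sum_comm]
    exact Finset.sum_congr rfl fun j _ => Finset.sum_congr rfl fun k _ => by rw [mul_comm]
  rw [this, AlgHom.comp_apply]

theorem linearSubst_one (f : FreeAlgebra ℂ (Fin n)) : linearSubst 1 f = f := by
  have : linearSubst (1 : Matrix (Fin n) (Fin n) ℂ) = AlgHom.id ℂ _ := by
    apply FreeAlgebra.hom_ext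
    funext i
    simp [linearSubst, Matrix.one_apply]
  rw [this, AlgHom.id_apply]

theorem linearSubst_diagonal_ι (t : Fin n → ℂ) (i : Fin n) :
    linearSubst (Matrix.diagonal t) (FreeAlgebra.ι ℂ i) = t i • FreeAlgebra.ι ℂ i := by
  rw [linearSubst, FreeAlgebra.lift_ι_apply, Finset.sum_eq_single_of_mem i (Finset.mem_univ i),
    Matrix.diagonal_apply_eq]
  intro j _ hj
  rw [Matrix.diagonal_apply_ne _ hj, zero_smul]

theorem linearSubst_diagonal_word (t : Fin n → ℂ) (l : List (Fin n)) :
    linearSubst (Matrix.diagonal t) (wordMonomial ℂ l) = (l.map t).prod • wordMonomial ℂ l := by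
  induction l with
  | nil => simp [wordMonomial_nil]
  | cons i l ih =>
    rw [wordMonomial_cons, map_mul, ih, linearSubst_diagonal_ι, List.map_cons, List.prod_cons,
      smul_mul_smul_comm]

/-- The coefficients of the relations after a rescaling of the variables. -/
noncomputable def rescale (t : Fin n → ℂ) (c : Fin n → Fin n → Fin n → Fin n → ℂ)
    (y x k l : Fin n) : ℂ := (t k * t l) / (t x * t y) * c y x k l

variable {t : Fin n → ℂ} {c : Fin n → Fin n → Fin n → Fin n → ℂ}

theorem linearSubst_diagonal_quadRelation (ht : ∀ i, t i ≠ 0) (x y : Fin n) :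
    linearSubst (Matrix.diagonal t) (quadRelation ℂ L c x y) =
      (t x * t y) • quadRelation ℂ L (rescale t c) x y := by
  have h : ∀ k l, t x * t y * rescale t c y x k l = c y x k l * (t k * t l) := by
    intro k l
    rw [rescale]
    field_simp [ht x, ht y]
  simp only [quadRelation, map_add, map_neg, map_smul, map_mul, map_sum, linearSubst_diagonal_ι,
    smul_add, smul_neg, Finset.smul_sum, smul_smul, smul_mul_smul_comm, h]
  congr 2
  · rw [mul_comm (t y)]
  · rw [mul_comm]

theorem linearSubst_diagonal_mem (ht : ∀ i, t i ≠ 0) {f : FreeAlgebra ℂ (Fin n)}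
    (hf : f ∈ quadIdeal ℂ L c) :
    linearSubst (Matrix.diagonal t) f ∈ quadIdeal ℂ L (rescale t c) := by
  refine TwoSidedIdeal.map_mem_of_span (linearSubst (Matrix.diagonal t)).toRingHom ?_ hf
  rintro _ ⟨x, y, hxy, rfl⟩
  change linearSubst (Matrix.diagonal t) (quadRelation ℂ L c x y) ∈ _
  rw [linearSubst_diagonal_quadRelation ht]
  exact TwoSidedIdeal.smul_mem_freeAlgebra _ (quadRelation_mem_quadIdeal ℂ L _ hxy)

theorem linearSubst_diagonal_inv (ht : ∀ i, t i ≠ 0) (f : FreeAlgebra ℂ (Fin n)) :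
    linearSubst (Matrix.diagonal t⁻¹) (linearSubst (Matrix.diagonal t) f) = f := by
  rw [← linearSubst_mul, Matrix.diagonal_mul_diagonal, ← linearSubst_one f]
  congr 2
  · rw [← Matrix.diagonal_one]
    congr 1
    funext i
    rw [Pi.inv_apply, inv_mul_cancel₀ (ht i)]
  · exact linearSubst_one f

theorem rescale_inv_rescale (ht : ∀ i, t i ≠ 0) : rescale t⁻¹ (rescale t c) = c := by
  funext y x k l
  simp only [rescale, Pi.inv_apply]
  have := ht x
  have := ht y
  have := ht k
  have := ht l
  field_simp

theorem linearSubst_diagonal_mem_iff (ht : ∀ i, t i ≠ 0) (f : FreeAlgebra ℂ (Fin n)) :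
    f ∈ quadIdeal ℂ L c ↔ linearSubst (Matrix.diagonal t) f ∈ quadIdeal ℂ L (rescale t c) := by
  refine ⟨linearSubst_diagonal_mem ht, fun h => ?_⟩
  have := linearSubst_diagonal_mem (t := t⁻¹) (fun i => inv_ne_zero (ht i)) h
  rwa [rescale_inv_rescale ht, linearSubst_diagonal_inv ht] at this

/-- A diagonal substitution multiplies each sorted word by a nonzero scalar. -/
theorem SortedIndependent.rescale (ht : ∀ i, t i ≠ 0) (h : SortedIndependent (quadIdeal ℂ L c)) :
    SortedIndependent (quadIdeal ℂ L (rescale t c)) := by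
  obtain ⟨a, ha⟩ : ∃ a : (Fin n → ℂ) → (Fin n → ℕ) → ℂ,
    ∀ t p, a t p = ((sortedList p).map t).prod := ⟨_, fun _ _ => rfl⟩
  have hane : ∀ p, a t⁻¹ p ≠ 0 := by
    intro p
    rw [ha, Ne, List.prod_eq_zero_iff, List.mem_map]
    rintro ⟨i, -, hi⟩
    exact inv_ne_zero (ht i) hi
  intro x hx
  have h1 := linearSubst_diagonal_mem (t := t⁻¹) (fun i => inv_ne_zero (ht i)) hx
  rw [rescale_inv_rescale ht] at h1
  have h2 : linearSubst (Matrix.diagonal t⁻¹) (sortedSection ℂ x) =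
      sortedSection ℂ (Finsupp.linearCombination ℂ (fun p => a t⁻¹ p • Finsupp.single p 1) x) := by
    conv_lhs => rw [sortedSection, Finsupp.linearCombination_apply, Finsupp.sum]
    rw [Finsupp.linearCombination_apply, Finsupp.sum]
    simp only [map_sum, map_smul, linearSubst_diagonal_word, sortedSection_single, ha]
  rw [h2] at h1
  have h3 := h _ h1
  ext p
  have h4 := DFunLike.congr_fun h3 p
  rw [Finsupp.linearCombination_apply, Finsupp.sum, Finsupp.finsetSum_apply] at h4
  by_contra hp
  rw [Finset.sum_eq_single_of_mem p (Finsupp.mem_support_iff.2 hp)] at h4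
  · simp [hane p] at h4
    exact hp h4
  · intro s _ hs
    simp [Finsupp.single_eq_of_ne hs.symm]

end Rescaling

/-! ### Uniqueness -/

section Uniqueness

variable {n : ℕ} {L b : Matrix (Fin n) (Fin n) ℂ} {G : SimpleGraph (Fin n)}
  {γ γ' : Sym2 (Fin n) → ℂ} {N N' : ℕ} {C C' : Fin n → Fin n → Fin n → Fin n → ℂ}

theorem IsTriangular.rescale {W : WeightSystem n} {c : Fin n → Fin n → Fin n → Fin n → ℂ}
    (hc : IsTriangular W c) (t : Fin n → ℂ) : IsTriangular W (rescale t c) :=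
  fun x y k l hxy hne => hc x y k l hxy (right_ne_zero_of_mul hne)

/-- Flatness at the generic parameter is turned into independence of the sorted words over ℂ[X],
which survives every specialization. -/
theorem IsFlatFilteredDeformation.sortedIndependent (halt : IsAlternating L)
    (hb : IsBiresidue L b) (hG : G.IsAcyclic)
    (h : IsFlatFilteredDeformation (entrywiseExp L) b G γ N C) (ε : ℂ) :
    SortedIndependent (quadIdeal ℂ L (deformedCoeff ℂ b G N C ε)) := by
  have h1 := h.flat
  rw [deformedIdeal_eq_quadIdeal, ← quadIdeal_zero_eq_toricIdeal halt] at h1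
  have h2 := h1.sortedIndependent (sortedIndependent_quadIdeal_zero ℂ (smoothSystem hb hG) L)
  have h3 := h2.eval (isTriangular_deformedCoeff hb hG N C Polynomial.X) ε
  simpa only [eval_deformedCoeff] using h3

theorem IsFlatFilteredDeformation.deformedCoeff_of_level_one (hb : IsBiresidue L b)
    (hG : G.IsAcyclic) (h : IsFlatFilteredDeformation (entrywiseExp L) b G γ N C) (ε : ℂ)
    {i j x y k l : Fin n} (hij : G.Adj i j) (hxy : x < y) (hkl : k ≤ l)
    (hw : IsSmoothableWeight b i j (quadWeight x y k l)) :
    deformedCoeff ℂ b G N C ε y x k l = ε * γ s(i, j) := by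
  rw [deformedCoeff_eq hb hG (Finset.mem_Icc.2 ⟨le_rfl, h.one_le⟩) hkl
    (mem_weightSums_one.2 ⟨i, j, hij, hw⟩), pow_one, Algebra.algebraMap_self, RingHom.id_apply,
    h.leading i j hij x y k l hxy hkl hw]

/-- Rescaling the variables by the exponential of an additive function multiplies a coefficient by
the exponential of the value at its weight. On a forest these values may be prescribed edge by edge,
here as logarithms of ratios of the constants. With the level one coefficients matched,
`exists_linearSubst` does the rest. -/
theorem IsFlatFilteredDeformation.exists_filteredAutomorphism (halt : IsAlternating L)
    (hgen : IsGeneric L) (hb : IsBiresidue L b) (hG : G.IsAcyclic)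
    (hγ : ∀ e ∈ G.edgeSet, γ e ≠ 0) (hγ' : ∀ e ∈ G.edgeSet, γ' e ≠ 0)
    (h : IsFlatFilteredDeformation (entrywiseExp L) b G γ N C)
    (h' : IsFlatFilteredDeformation (entrywiseExp L) b G γ' N' C') {ε ε' : ℂ} (hε : ε ≠ 0)
    (hε' : ε' ≠ 0) :
    ∃ g : Matrix (Fin n) (Fin n) ℂ, IsFilteredAutomorphism b G g ∧
      ∀ f : FreeAlgebra ℂ (Fin n),
        f ∈ deformedIdeal ℂ (entrywiseExp L) b G N C ε ↔
          linearSubst g f ∈ deformedIdeal ℂ (entrywiseExp L) b G N' C' ε' := by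
  obtain ⟨φ, hφ⟩ := exists_height hb hG fun e => Complex.log (ε' * γ' e / (ε * γ e))
  obtain ⟨t, htdef⟩ : ∃ t : Fin n → ℂ, ∀ i, t i = Complex.exp (φ (Pi.single i 1)) :=
    ⟨_, fun _ => rfl⟩
  have ht : ∀ i, t i ≠ 0 := fun i => by
    rw [htdef]
    exact Complex.exp_ne_zero _
  have htw : ∀ x y k l, t k * t l / (t x * t y) = Complex.exp (φ (quadWeight x y k l)) := by
    intro x y k l
    simp only [htdef, quadWeight, ← Complex.exp_add, ← Complex.exp_sub, map_add, map_sub, map_neg]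
    congr 1
    ring
  have hc := isTriangular_deformedCoeff (R := ℂ) hb hG N C ε
  have hc' := isTriangular_deformedCoeff (R := ℂ) hb hG N' C' ε'
  obtain ⟨g, hg, hdiag, hmem⟩ := exists_linearSubst
    (fun m hm w hw => isRigid_of_mem_weightSums halt hgen hb hG hm hw) (hc.rescale t) hc'
    ((h.sortedIndependent halt hb hG ε).rescale ht) (h'.sortedIndependent halt hb hG ε')
    (fun x y k l hxy hkl hw => by
      obtain ⟨i, j, hij, hθ⟩ := mem_weightSums_one.1 hw
      rw [h'.deformedCoeff_of_level_one hb hG ε' hij hxy hkl hθ, rescale, htw, hφ i j _ hij hθ,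
        h.deformedCoeff_of_level_one hb hG ε hij hxy hkl hθ]
      have h1 := mul_ne_zero hε (hγ s(i, j) hij)
      rw [Complex.exp_log (div_ne_zero (mul_ne_zero hε' (hγ' s(i, j) hij)) h1),
        div_mul_cancel₀ _ h1])
  refine ⟨g * Matrix.diagonal t,
    WeightSystem.IsTriangularMatrix.isFilteredAutomorphism hb hG ⟨fun i => ?_, fun i j hij hne => ?_⟩,
    fun f => ?_⟩
  · rw [Matrix.mul_diagonal]
    exact mul_ne_zero (hg.diag_ne i) (ht i)
  · rw [Matrix.mul_diagonal] at hne
    exact hg.level i j hij (left_ne_zero_of_mul hne)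
  · rw [deformedIdeal_eq_quadIdeal, deformedIdeal_eq_quadIdeal, linearSubst_mul, ← hmem,
      ← linearSubst_diagonal_mem_iff ht]

/-- Off-diagonal entries of the comparison matrix sit at weights e_j − e_i of positive level, which
`hroot` excludes. So the matrix is the identity, the two ideals coincide, and the ideal determines
the coefficients. -/
theorem IsFlatFilteredDeformation.coeff_eq (halt : IsAlternating L)
    (hgen : IsGeneric L) (hb : IsBiresidue L b) (hG : G.IsAcyclic)
    (hroot : ∀ m : ℕ, 1 ≤ m → ∀ x y : Fin n, x ≠ y →
      (Pi.single x 1 - Pi.single y 1 : Fin n → ℤ) ∉ weightSums b G m)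
    (h : IsFlatFilteredDeformation (entrywiseExp L) b G γ N C)
    (h' : IsFlatFilteredDeformation (entrywiseExp L) b G γ N' C') : C = C' := by
  -- At parameter 1 the powers disappear, and for x < y the coefficients of the relations are those
  -- of C.
  have hc := isTriangular_deformedCoeff (R := ℂ) hb hG N C 1
  have hc' := isTriangular_deformedCoeff (R := ℂ) hb hG N' C' 1
  have hJ' := h'.sortedIndependent halt hb hG 1
  obtain ⟨g, hg, hdiag, hmem⟩ := exists_linearSubst
    (fun m hm w hw => isRigid_of_mem_weightSums halt hgen hb hG hm hw) hc hc'
    (h.sortedIndependent halt hb hG 1) hJ'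
    (fun x y k l hxy hkl hw => by
      obtain ⟨i, j, hij, hθ⟩ := mem_weightSums_one.1 hw
      rw [h'.deformedCoeff_of_level_one hb hG 1 hij hxy hkl hθ,
        h.deformedCoeff_of_level_one hb hG 1 hij hxy hkl hθ])
  have hg1 : g = 1 := by
    ext j i
    by_cases hij : i = j
    · subst hij
      rw [hdiag, Matrix.one_apply_eq]
    · rw [Matrix.one_apply_ne (Ne.symm hij)]
      by_contra hne
      obtain ⟨k, hk, hw⟩ := hg.level i j hij hne
      exact hroot k hk j i (Ne.symm hij) hw
  have hideal : quadIdeal ℂ L (deformedCoeff ℂ b G N C 1) =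
      quadIdeal ℂ L (deformedCoeff ℂ b G N' C' 1) := by
    ext f
    rw [hmem, hg1, linearSubst_one]
  have hcoeff : ∀ {γ : Sym2 (Fin n) → ℂ} {N : ℕ} {C : Fin n → Fin n → Fin n → Fin n → ℂ},
      IsFlatFilteredDeformation (entrywiseExp L) b G γ N C → ∀ x y k l, x < y →
      deformedCoeff ℂ b G N C 1 y x k l = C y x k l := by
    intro γ N C h x y k l _
    by_cases h0 : C y x k l = 0
    · simp [deformedCoeff, h0]
    · obtain ⟨-, hkl, m, hm, hmN, hw⟩ := h.support x y k l h0
      rw [deformedCoeff_eq hb hG (Finset.mem_Icc.2 ⟨hm, hmN⟩) hkl hw, one_pow, one_mul,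
        Algebra.algebraMap_self, RingHom.id_apply]
  funext y x k l
  by_cases hxy : x < y
  · rw [← hcoeff h x y k l hxy, ← hcoeff h' x y k l hxy]
    exact coeff_eq_of_quadIdeal_eq hc hc' hJ' hideal hxy
  · rw [not_imp_comm.1 (fun h0 => (h.support x y k l h0).1) hxy,
      not_imp_comm.1 (fun h0 => (h'.support x y k l h0).1) hxy]

end Uniqueness

theorem mainTheorem4 {n : ℕ} (L b : Matrix (Fin n) (Fin n) ℂ)
    (halt : IsAlternating L) (hnorm : IsNormalized L) (hgen : IsGeneric L)
    (hb : IsBiresidue L b)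
    (G : SimpleGraph (Fin n)) (hacyclic : G.IsAcyclic)
    (hsmooth : ∀ i j, G.Adj i j → IsSmoothableEdge b i j) :
    (∀ γ : Sym2 (Fin n) → ℂ, (∀ e ∈ G.edgeSet, γ e ≠ 0) →
      ∃ (N : ℕ) (C : Fin n → Fin n → Fin n → Fin n → ℂ),
        IsFlatFilteredDeformation (entrywiseExp L) b G γ N C) ∧
    (∀ (γ γ' : Sym2 (Fin n) → ℂ), (∀ e ∈ G.edgeSet, γ e ≠ 0) → (∀ e ∈ G.edgeSet, γ' e ≠ 0) →
      ∀ (N N' : ℕ) (C C' : Fin n → Fin n → Fin n → Fin n → ℂ),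
        IsFlatFilteredDeformation (entrywiseExp L) b G γ N C →
        IsFlatFilteredDeformation (entrywiseExp L) b G γ' N' C' →
        ∀ ε ε' : ℂ, ε ≠ 0 → ε' ≠ 0 →
          ∃ g : Matrix (Fin n) (Fin n) ℂ, IsFilteredAutomorphism b G g ∧
            ∀ f : FreeAlgebra ℂ (Fin n),
              f ∈ deformedIdeal ℂ (entrywiseExp L) b G N C ε ↔
                linearSubst g f ∈ deformedIdeal ℂ (entrywiseExp L) b G N' C' ε') ∧
    ((∀ m : ℕ, 1 ≤ m → ∀ x y : Fin n, x ≠ y →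
        (Pi.single x 1 - Pi.single y 1 : Fin n → ℤ) ∉ weightSums b G m) →
      ∀ γ : Sym2 (Fin n) → ℂ, (∀ e ∈ G.edgeSet, γ e ≠ 0) →
        ∀ (N N' : ℕ) (C C' : Fin n → Fin n → Fin n → Fin n → ℂ),
          IsFlatFilteredDeformation (entrywiseExp L) b G γ N C →
          IsFlatFilteredDeformation (entrywiseExp L) b G γ N' C' → C = C') := by
  exact ⟨fun γ _ => exists_isFlatFilteredDeformation halt hgen hb hacyclic γ,
    fun γ γ' hγ hγ' N N' C C' h h' ε ε' hε hε' =>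
      h.exists_filteredAutomorphism halt hgen hb hacyclic hγ hγ' h' hε hε',
    fun hroot γ _ N N' C C' h h' => h.coeff_eq halt hgen hb hacyclic hroot h'⟩
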